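/- Let $\Omega$ be a finite alphabet with $|\Omega|=q\ge 2$, let $P:\Omega^k\to\{0,1\}$ be a satisfiable predicate and let $1<t\le k$ be an integer. A distribution on $\Omega^k$ is $t$-wise uniform if its marginal on every set of $t$ coordinates is uniform; let $$\delta_P(t)=\min_{\mu,\sigma} d_{\mathrm{TV}}(\mu,\sigma),$$ where $\mu$ ranges over the $t$-wise uniform distributions on $\Omega^k$ and $\sigma$ over the distributions supported on $P^{-1}(1)$. Fix a nonempty set $L$ of permutations of $\Omega$ (the "literals"; for $\Omega=\{0,1\}$ and $L=\{\mathrm{id},\mathrm{negation}\}$ one gets the Boolean problem $\mathrm{CSP}(P^{\pm})$). A constraint on variables $x_1,\dots,x_n$ consists of a scope $S=(S_1,\dots,S_k)$ of $k$ distinct variables and of $\ell\in L^k$, and an assignment $x\in\Omega^n$ satisfies it if $P(\ell_1(x_{S_1}),\dots,\ell_k(x_{S_k}))=1$. A random instance $\mathcal I$ consists of $m=\Delta n$ independent, uniformly random constraints. For variables $i\in[n]$ and letters $c\in\Omega$ let $X_{i,c}$ be indeterminates (standing for the indicator of $x_i=c$). For a real $D\ge0$, a degree-$D$ pseudoexpectation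 is a linear functional $\widetilde{\mathbf E}$ on real polynomials of degree at most $D$ in the $X_{i,c}$ with $\widetilde{\mathbf E}[1]=1$ and $\widetilde{\mathbf E}[p^2]\ge 0$ whenever $\deg p\le D/2$; here it is required to satisfy the identities $\sum_{c}X_{i,c}=1$ and $X_{i,c}^2=X_{i,c}$, where satisfying $p=0$ means $\widetilde{\mathbf E}[pr]=0$ for all polynomials $r$ with $\deg(pr)\le D$. Degree-$D$ SOS $\delta$-refutes $\mathcal I$ if $D\ge k$ and every such $\widetilde{\mathbf E}$ has $\widetilde{\mathbf E}[\text{fraction of satisfied constraints}]\le 1-\delta$, where a constraint $(S,\ell)$ contributes the polynomial $\sum_{a\in\Omega^k:\,P(\ell_1(a_1),\dots,\ell_k(a_k))=1}\ \prod_{j=1}^k X_{S_j,a_j}$. **Theorem.** There is a universal constant $C>0$ (independent of $\Omega,L,k,t,P,n,\Delta,\beta$) such that for all $n\ge1$, all $\Delta\ge 10$ with $m=\Delta n$ an integer, and all $0<\beta<1$, the following holds with $$\varepsilon=2^{\frac{\log n}{2\log\Delta}}\cdot\frac1{\sqrt n},\qquad D=\frac{\beta^{C/t}}{k\cdot 2^{Ck/t}}\cdot\frac{n}{\Delta^{2/(t-1)}\log\Delta}.$$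 Except with probability at most $\beta$ over the random instance $\mathcal I$ with $m$ constraints, degree-$D$ SOS fails to $(\delta_P(t)+\varepsilon)$-refute $\mathcal I$; that is, if $D\ge k$, there is a degree-$D$ pseudoexpectation, satisfying the identities above, for which the pseudo-expected fraction of satisfied constraints exceeds $1-\delta_P(t)-\varepsilon$. Moreover, for every $\Delta=\Delta(n)\ge10$ one has $\varepsilon=o(1)$ as $n\to\infty$, and $\varepsilon=O(1/\sqrt n)$ whenever $\Delta=n^{\Omega(1)}$. -/

import Mathlib

open MeasureTheory ProbabilityTheory Filter Topology Asymptotics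

noncomputable section

namespace RandomCSP

/-! ### Distance of a predicate from supporting a `t`-wise uniform distribution -/

/-- A distribution `μ` on `Ω^k` is `t`-wise uniform: its marginal on every set of `t`
coordinates is the uniform distribution. -/
def IsWiseUniform {Ω : Type*} [Fintype Ω] [DecidableEq Ω] {k : ℕ} (t : ℕ)
    (μ : (Fin k → Ω) → ℝ) : Prop :=
  ∀ T : Finset (Fin k), T.card = t → ∀ a : T → Ω,
    ∑ x : Fin k → Ω with (∀ i : T, x i = a i), μ x = ((Fintype.card Ω : ℝ) ^ t)⁻¹

/-- Total variation distance of two distributions on a finite set. -/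
def tvDist {α : Type*} [Fintype α] (μ σ : α → ℝ) : ℝ :=
  (1 / 2) * ∑ x, |μ x - σ x|

/-- `δ_P(t)`: the least total variation distance between a `t`-wise uniform distribution on `Ω^k`
and a distribution supported on satisfying assignments of `P`.  (For satisfiable `P` the infimum
is over the continuous image of a nonempty compact set, hence a minimum.) -/
def deltaP {Ω : Type*} [Fintype Ω] [DecidableEq Ω] {k : ℕ}
    (P : (Fin k → Ω) → Bool) (t : ℕ) : ℝ :=
  sInf {d : ℝ | ∃ μ ∈ stdSimplex ℝ (Fin k → Ω), ∃ σ ∈ stdSimplex ℝ (Fin k → Ω),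
    IsWiseUniform t μ ∧ (∀ x, P x = false → σ x = 0) ∧ d = tvDist μ σ}

/-! ### Random instances -/

/-- A constraint on `n` variables: an ordered scope of `k` distinct variables and a pattern of
literals, each of them a permutation of the alphabet taken from the set `L`.
For `Ω = Bool` and `L = Finset.univ` (identity and negation) these are the constraints of
`CSP(P^±)`; for larger alphabets `L` may be e.g. the shifts modulo `q` or all permutations. -/
abbrev Constraint (n k : ℕ) {Ω : Type*} (L : Finset (Equiv.Perm Ω)) : Type _ :=
  (Fin k ↪ Fin n) × (Fin k → L)

/-- An instance: a list of `m` constraints. -/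
def CSPInstance (n m k : ℕ) {Ω : Type*} (L : Finset (Equiv.Perm Ω)) : Type _ :=
  Fin m → Constraint n k L

instance (n m k : ℕ) {Ω : Type*} (L : Finset (Equiv.Perm Ω)) :
    MeasurableSpace (CSPInstance n m k L) := ⊤

/-- The law of a random instance: `m` independent, uniformly random constraints, i.e. the uniform
distribution on the finite set of all instances. -/
def randomInstance (n m k : ℕ) {Ω : Type*} (L : Finset (Equiv.Perm Ω)) :
    Measure (CSPInstance n m k L) :=
  uniformOn Set.univ

/-! ### Sum of squares -/

/-- The indicator polynomial of the event that a constraint is satisfied, in the indeterminates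
`X (i, c)` standing for the indicator of "variable `i` is assigned `c`". -/
def Constraint.poly {n k : ℕ} {Ω : Type*} [Fintype Ω] [DecidableEq Ω]
    {L : Finset (Equiv.Perm Ω)} (P : (Fin k → Ω) → Bool) (f : Constraint n k L) :
    MvPolynomial (Fin n × Ω) ℝ :=
  ∑ a : Fin k → Ω with P (fun j => (f.2 j : Equiv.Perm Ω) (a j)) = true,
    ∏ j, MvPolynomial.X (f.1 j, a j)

/-- The fraction of satisfied constraints, as a polynomial. -/
def CSPInstance.valuePoly {n m k : ℕ} {Ω : Type*} [Fintype Ω] [DecidableEq Ω]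
    {L : Finset (Equiv.Perm Ω)} (P : (Fin k → Ω) → Bool) (I : CSPInstance n m k L) :
    MvPolynomial (Fin n × Ω) ℝ :=
  MvPolynomial.C ((m : ℝ)⁻¹) * ∑ f : Fin m, Constraint.poly P (I f)

/-- Degree-`D` pseudoexpectations.  Only the values of `E` on polynomials of degree at most `D`
are constrained; every linear functional on those extends linearly to all polynomials. -/
structure IsPseudoexpectation {V : Type*} (D : ℕ) (E : MvPolynomial V ℝ →ₗ[ℝ] ℝ) : Prop where
  map_one : E 1 = 1
  sq_nonneg : ∀ p : MvPolynomial V ℝ, 2 * p.totalDegree ≤ D → 0 ≤ E (p ^ 2)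

/-- The degree-`D` pseudoexpectation `E` satisfies the polynomial identity `p = 0`. -/
def SatisfiesIdentity {V : Type*} (D : ℕ) (E : MvPolynomial V ℝ →ₗ[ℝ] ℝ)
    (p : MvPolynomial V ℝ) : Prop :=
  ∀ r : MvPolynomial V ℝ, (p * r).totalDegree ≤ D → E (p * r) = 0

/-- Degree-`D` pseudoexpectations on assignments `Fin n → Ω`: the identities
`∑ c, X (i, c) = 1` and `X (i, c) ^ 2 = X (i, c)` are satisfied. -/
structure IsAssignmentPseudoexpectation {n : ℕ} {Ω : Type*} [Fintype Ω] (D : ℕ)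
    (E : MvPolynomial (Fin n × Ω) ℝ →ₗ[ℝ] ℝ) : Prop extends IsPseudoexpectation D E where
  sum_eq_one : ∀ i : Fin n, SatisfiesIdentity D E (∑ c : Ω, MvPolynomial.X (i, c) - 1)
  sq_eq_self : ∀ (i : Fin n) (c : Ω),
    SatisfiesIdentity D E (MvPolynomial.X (i, c) ^ 2 - MvPolynomial.X (i, c))

/-- Degree-`D` SOS `δ`-refutes the instance `I`: the degree-`D` SOS relaxation certifies that at
most a `1 - δ` fraction of the constraints can be satisfied, i.e. every degree-`D`
pseudoexpectation on assignments gives the fraction of satisfied constraints at most `1 - δ`. -/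
def SOSRefutes {n m k : ℕ} {Ω : Type*} [Fintype Ω] [DecidableEq Ω]
    {L : Finset (Equiv.Perm Ω)} (D : ℕ) (P : (Fin k → Ω) → Bool) (δ : ℝ)
    (I : CSPInstance n m k L) : Prop :=
  ∀ E : MvPolynomial (Fin n × Ω) ℝ →ₗ[ℝ] ℝ, IsAssignmentPseudoexpectation D E →
    E (I.valuePoly P) ≤ 1 - δ

/-! ### Parameters -/

/-- `ε = 2^{log n / (2 log Δ)} / √n`. -/
def slack (n : ℕ) (Δ : ℝ) : ℝ :=
  (2 : ℝ) ^ (Real.log n / (2 * Real.log Δ)) / √(n : ℝ)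

/-- `D = β^{C/t} / (k · 2^{C k/t}) · n / (Δ^{2/(t-1)} log Δ)`. -/
def sosDegree (C β : ℝ) (k t n : ℕ) (Δ : ℝ) : ℝ :=
  β ^ (C / (t : ℝ)) / ((k : ℝ) * (2 : ℝ) ^ (C * (k : ℝ) / (t : ℝ))) *
    ((n : ℝ) / (Δ ^ (2 / ((t : ℝ) - 1)) * Real.log Δ))

end RandomCSP

end

/-! Fix a `t`-wise uniform `μ` nearly attaining `δ_P(t)` and pretend that the literals of every
constraint are distributed as `μ`. On a small set `A` of variables this suggests the density
`density φ A`, the product over all constraints of the marginal of `μ` on the part of the scope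
inside `A`. By `t`-wise uniformity only constraints with more than `t` variables in `A` (the active
ones) contribute, and a variable lying in at most one active constraint can be integrated out
without changing the form of the density (`avg_density_erase`). The pseudoexpectation of a monomial
is its expectation under the local density on a closure of its variables.

Closures are governed by the submodular function `weight`. A set is tight if its weight strictly
increases under every bounded enlargement; outside a tight set some variable can always be
eliminated, so the local densities are consistent. Positivity rests on conditional independence of
two tight sets given their intersection: a minimum-cut argument (`IsTight.separated`) shows that no
constraint active in `A ∪ B` crosses from `A \ B` to `B \ A`. A Gram–Schmidt induction over an
intersection-closed family of tight sets (`sum_mean_mul_density_nonneg`) then makes the quadratic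
form nonnegative. The only requirement on the instance is expansion, that is, weight at least `η *
|M|` for small `M`, which keeps closures below size `b / 2`.

A constraint is isolated if no small set containing its scope has weight at most `t`. Its literals
then have exactly the law `μ`, so it is satisfied with pseudoprobability at least `1 - tvDist μ σ`;
constraints that are not isolated are given up.

For a random instance an exponential moment of the weight of a fixed `M` and a union bound over `M`
give expansion except with probability `β / 2` (`card_not_isExpanding_le`), and non-isolation of a
given constraint with probability at most `β / (2√n)` (`card_not_isIsolated_le`). By Markov's
inequality the lost fraction is below `1 / √n ≤ ε` except with probability `β / 2`. -/

noncomputable section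

namespace RandomCSP

/-! ### Averaging over coordinates -/

section Averaging

variable {V Ω : Type*} [Fintype V] [DecidableEq V] [Fintype Ω]

/-- The average of `g` over all coordinates outside `A`. -/
def avg (A : Finset V) (g : (V → Ω) → ℝ) (x : V → Ω) : ℝ :=
  (Fintype.card (V → Ω) : ℝ)⁻¹ * ∑ y, g (A.piecewise x y)

/-- The average of `g` over all coordinates. -/
def mean (g : (V → Ω) → ℝ) : ℝ :=
  (Fintype.card (V → Ω) : ℝ)⁻¹ * ∑ y, g y

lemma avg_empty (g : (V → Ω) → ℝ) (x : V → Ω) : avg ∅ g x = mean g := by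
  simp [avg, mean]

lemma avg_dependsOn (A : Finset V) (g : (V → Ω) → ℝ) : DependsOn (avg A g) (A : Set V) := by
  intro x y h
  unfold avg
  congr 1
  refine Finset.sum_congr rfl fun z _ => ?_
  congr 1
  ext i
  by_cases hi : i ∈ A
  · simp [hi, h i hi]
  · simp [hi]

lemma avg_nonneg {A : Finset V} {g : (V → Ω) → ℝ} (hg : ∀ x, 0 ≤ g x) (x : V → Ω) :
    0 ≤ avg A g x :=
  mul_nonneg (by positivity) (Finset.sum_nonneg fun _ _ => hg _)

lemma mean_nonneg {g : (V → Ω) → ℝ} (hg : ∀ x, 0 ≤ g x) : 0 ≤ mean g :=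
  mul_nonneg (by positivity) (Finset.sum_nonneg fun _ _ => hg _)

lemma mean_add (g h : (V → Ω) → ℝ) : mean (g + h) = mean g + mean h := by
  simp [mean, Finset.sum_add_distrib, mul_add]

lemma mean_smul (c : ℝ) (g : (V → Ω) → ℝ) : mean (c • g) = c * mean g := by
  simp [mean, ← Finset.mul_sum]; ring

lemma mean_zero : mean (0 : (V → Ω) → ℝ) = 0 := by
  simp [mean]

lemma avg_mul_left {A : Finset V} {g : (V → Ω) → ℝ} (hg : DependsOn g (A : Set V))
    (h : (V → Ω) → ℝ) : avg A (g * h) = g * avg A h := by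
  ext x
  simp only [avg, Pi.mul_apply]
  have : ∀ y, g (A.piecewise x y) = g x := fun y =>
    hg (fun i hi => by simp [Finset.mem_coe.1 hi])
  simp only [this, ← Finset.mul_sum]
  rw [mul_left_comm]

/-- Exchanging the coordinates outside `B` between two independent uniform points is an involution
of the product space. -/
lemma sum_sum_piecewise (B : Finset V) (G : (V → Ω) → ℝ) :
    ∑ y : V → Ω, ∑ z : V → Ω, G (B.piecewise y z) = Fintype.card (V → Ω) * ∑ y, G y := by
  have inv : ∀ y z : V → Ω, B.piecewise (B.piecewise y z) (B.piecewise z y) = y := by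
    intro y z
    ext i
    by_cases hi : i ∈ B <;> simp [hi]
  let e : ((V → Ω) × (V → Ω)) ≃ ((V → Ω) × (V → Ω)) :=
    { toFun := fun p => (B.piecewise p.1 p.2, B.piecewise p.2 p.1)
      invFun := fun p => (B.piecewise p.1 p.2, B.piecewise p.2 p.1)
      left_inv := fun p => by simp [inv]
      right_inv := fun p => by simp [inv] }
  have he := Equiv.sum_comp e (fun p : (V → Ω) × (V → Ω) => G p.1)
  rw [Fintype.sum_prod_type, Fintype.sum_prod_type] at he
  refine he.trans ?_
  simp [Finset.mul_sum]

variable [Nonempty Ω]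

lemma card_fun_ne_zero : (Fintype.card (V → Ω) : ℝ) ≠ 0 := by
  exact_mod_cast Fintype.card_ne_zero

lemma mean_const (c : ℝ) : mean (fun _ : V → Ω => c) = c := by
  simp only [mean, Finset.sum_const, nsmul_eq_mul, Finset.card_univ]
  rw [inv_mul_cancel_left₀ card_fun_ne_zero]

lemma avg_of_dependsOn {A : Finset V} {g : (V → Ω) → ℝ} (hg : DependsOn g (A : Set V)) :
    avg A g = g := by
  ext x
  have : ∀ y : V → Ω, g (A.piecewise x y) = g x := fun y =>
    hg (fun i hi => by simp [Finset.mem_coe.1 hi])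
  simp only [avg, this, Finset.sum_const, nsmul_eq_mul, Finset.card_univ]
  rw [inv_mul_cancel_left₀ card_fun_ne_zero]

/-- Under a product measure the coordinates in `A \ B` and outside `A` are resampled independently,
so only those in `A ∩ B` survive both averages. -/
lemma avg_avg (A B : Finset V) (g : (V → Ω) → ℝ) : avg A (avg B g) = avg (A ∩ B) g := by
  ext x
  have key : ∀ y z : V → Ω,
      B.piecewise (A.piecewise x y) z = (A ∩ B).piecewise x (B.piecewise y z) := by
    intro y z
    ext i
    by_cases hA : i ∈ A <;> by_cases hB : i ∈ B <;> simp [hA, hB]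
  have := sum_sum_piecewise B (fun y => g ((A ∩ B).piecewise x y))
  simp only [avg, key, ← Finset.mul_sum, this]
  rw [inv_mul_cancel_left₀ card_fun_ne_zero]

lemma mean_avg (A : Finset V) (g : (V → Ω) → ℝ) : mean (avg A g) = mean g := by
  have x : V → Ω := Classical.arbitrary _
  rw [← avg_empty _ x, avg_avg, Finset.empty_inter, avg_empty]

lemma avg_eq_avg_inter {A B : Finset V} {g : (V → Ω) → ℝ} (hg : DependsOn g (B : Set V)) :
    avg A g = avg (A ∩ B) g := by
  conv_lhs => rw [← avg_of_dependsOn hg]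
  exact avg_avg A B g

lemma mean_mul_avg {A : Finset V} {g : (V → Ω) → ℝ} (hg : DependsOn g (A : Set V))
    (h : (V → Ω) → ℝ) : mean (g * avg A h) = mean (g * h) := by
  rw [← avg_mul_left hg, mean_avg]

/-- If a nonnegative function averages to zero on a fibre, it vanishes there. -/
lemma eq_zero_of_avg_eq_zero {A : Finset V} {g : (V → Ω) → ℝ} (hg : ∀ x, 0 ≤ g x) {x : V → Ω}
    (h : avg A g x = 0) (y : V → Ω) : g (A.piecewise x y) = 0 := by
  rw [avg, mul_eq_zero, inv_eq_zero] at h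
  exact (Finset.sum_eq_zero_iff_of_nonneg fun _ _ => hg _).1
    (h.resolve_left card_fun_ne_zero) y (Finset.mem_univ y)

end Averaging

/-! ### Products of marginal densities -/

section Density

variable {V Ω F : Type*} [Fintype V] [DecidableEq V] [Fintype Ω]

/-- `φ f` is a nonnegative function of the variables in `N f`, all of whose marginals on at most
`t` variables are constantly one. -/
structure IsWiseDensity (t : ℕ) (N : F → Finset V) (φ : F → (V → Ω) → ℝ) : Prop where
  nonneg : ∀ f x, 0 ≤ φ f x
  dependsOn : ∀ f, DependsOn (φ f) (N f : Set V)
  avg_eq_one : ∀ f (A : Finset V), (N f ∩ A).card ≤ t → avg A (φ f) = 1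

/-- Either `v` is in the scope and both marginals are constantly one, or `φ f` does not see `v` at
all. -/
lemma IsWiseDensity.avg_erase [Nonempty Ω] {t : ℕ} {N : F → Finset V}
    {φ : F → (V → Ω) → ℝ} (hφ : IsWiseDensity t N φ) {Q : Finset V} {v : V} {f : F}
    (h : v ∈ N f → (N f ∩ Q).card ≤ t) : avg Q (φ f) = avg (Q.erase v) (φ f) := by
  by_cases hv : v ∈ N f
  · rw [hφ.avg_eq_one f Q (h hv), hφ.avg_eq_one f (Q.erase v)]
    exact (Finset.card_le_card (Finset.inter_subset_inter_left (Q.erase_subset v))).trans (h hv)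
  · rw [avg_eq_avg_inter (hφ.dependsOn f), avg_eq_avg_inter (A := Q.erase v) (hφ.dependsOn f)]
    congr 1
    ext i
    simp only [Finset.mem_inter, Finset.mem_erase]
    constructor
    · rintro ⟨h1, h2⟩
      exact ⟨⟨fun h => hv (h ▸ h2), h1⟩, h2⟩
    · rintro ⟨⟨_, h1⟩, h2⟩
      exact ⟨h1, h2⟩

variable [Fintype F]

/-- The product of the marginals of the densities `φ f` on the variables in `A`. -/
def density (φ : F → (V → Ω) → ℝ) (A : Finset V) : (V → Ω) → ℝ :=
  ∏ f, avg A (φ f)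

/-- At most one constraint with more than `t` variables in `Q` contains `v`. -/
def Eliminable (t : ℕ) (N : F → Finset V) (Q : Finset V) (v : V) : Prop :=
  ∀ f g, v ∈ N f → v ∈ N g → t < (N f ∩ Q).card → t < (N g ∩ Q).card → f = g

variable {t : ℕ} {N : F → Finset V} {φ : F → (V → Ω) → ℝ}

lemma density_dependsOn (A : Finset V) : DependsOn (density φ A) (A : Set V) := by
  intro x y h
  simp only [density, Finset.prod_apply]
  exact Finset.prod_congr rfl fun f _ => avg_dependsOn A (φ f) h

lemma density_nonneg (hφ : IsWiseDensity t N φ) (A : Finset V) (x : V → Ω) :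
    0 ≤ density φ A x := by
  simp only [density, Finset.prod_apply]
  exact Finset.prod_nonneg fun f _ => avg_nonneg (hφ.nonneg f) x

variable [Nonempty Ω]

/-- All factors but at most one are independent of `v`, so they come out of the average; the
remaining factor is averaged to its own marginal on `Q.erase v`. -/
lemma avg_density_erase (hφ : IsWiseDensity t N φ) {Q : Finset V} {v : V}
    (h : Eliminable t N Q v) : avg (Q.erase v) (density φ Q) = density φ (Q.erase v) := by
  classical
  by_cases hf : ∃ f, v ∈ N f ∧ t < (N f ∩ Q).card
  · obtain ⟨f, hvf, hf⟩ := hf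
    have hrest : ∀ g ∈ Finset.univ.erase f, avg Q (φ g) = avg (Q.erase v) (φ g) := by
      intro g hg
      refine hφ.avg_erase fun hv => ?_
      by_contra hcon
      exact (Finset.mem_erase.1 hg).1 (h g f hv hvf (not_le.1 hcon) hf)
    unfold density
    rw [← Finset.mul_prod_erase _ _ (Finset.mem_univ f),
      ← Finset.mul_prod_erase _ (fun g => avg (Q.erase v) (φ g)) (Finset.mem_univ f),
      Finset.prod_congr rfl hrest, mul_comm, avg_mul_left, avg_avg, mul_comm,
      Finset.inter_eq_left.2 (Q.erase_subset v)]
    intro x y hxy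
    simp only [Finset.prod_apply]
    exact Finset.prod_congr rfl fun g _ => avg_dependsOn _ (φ g) hxy
  · push Not at hf
    have : density φ Q = density φ (Q.erase v) :=
      Finset.prod_congr rfl fun g _ => hφ.avg_erase (hf g)
    rw [this, avg_of_dependsOn (density_dependsOn _)]

/-- Eliminating variables one by one does not change expectations of the remaining ones. -/
lemma avg_density_of_eliminable (hφ : IsWiseDensity t N φ) {S : Finset V} (Q : Finset V)
    (hSQ : S ⊆ Q) (h : ∀ M, S ⊂ M → M ⊆ Q → ∃ v ∈ M \ S, Eliminable t N M v) :
    avg S (density φ Q) = density φ S := by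
  induction Q using Finset.strongInduction with
  | H Q ih =>
    rcases hSQ.eq_or_ssubset with rfl | hss
    · exact avg_of_dependsOn (density_dependsOn _)
    · obtain ⟨v, hv, hel⟩ := h Q hss subset_rfl
      rw [Finset.mem_sdiff] at hv
      have hS : S ⊆ Q.erase v := Finset.subset_erase.2 ⟨hSQ, hv.2⟩
      have := ih (Q.erase v) (Finset.erase_ssubset hv.1) hS
        fun M h1 h2 => h M h1 (h2.trans (Q.erase_subset v))
      rw [← this, ← avg_density_erase hφ hel, avg_avg, Finset.inter_eq_left.2 hS]

lemma mean_mul_density_of_eliminable (hφ : IsWiseDensity t N φ) {S Q : Finset V}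
    (hSQ : S ⊆ Q) (h : ∀ M, S ⊂ M → M ⊆ Q → ∃ v ∈ M \ S, Eliminable t N M v)
    {g : (V → Ω) → ℝ} (hg : DependsOn g (S : Set V)) :
    mean (g * density φ Q) = mean (g * density φ S) := by
  rw [← avg_density_of_eliminable hφ Q hSQ h, mean_mul_avg hg]

end Density

/-! ### The weight of a set of variables and tight sets -/

section Weight

variable {V F : Type*} [DecidableEq V] [Fintype F] (t : ℕ) (N : F → Finset V)

/-- Twice the number of variables in `M`, minus the contributions of the constraints that have more
than half of `t + 1` variables in `M`. -/
def weight (M : Finset V) : ℤ :=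
  2 * M.card - ∑ f, max (2 * ((N f ∩ M).card : ℤ) - (t + 1)) 0

/-- Every proper superset with at most `b` elements has larger weight. -/
def IsTight (b : ℕ) (A : Finset V) : Prop :=
  ∀ X, A ⊂ X → X.card ≤ b → weight t N A < weight t N X

variable {t N}

lemma weight_le (M : Finset V) : weight t N M ≤ 2 * M.card := by
  have : 0 ≤ ∑ f, max (2 * ((N f ∩ M).card : ℤ) - (t + 1)) 0 :=
    Finset.sum_nonneg fun _ _ => le_max_right _ _
  unfold weight
  linarith

/-- Submodularity: cardinality is modular, and each subtracted term is a nondecreasing convex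
function of `(N f ∩ M).card`, hence supermodular in `M`. -/
lemma weight_union_add_weight_inter (A B : Finset V) :
    weight t N (A ∪ B) + weight t N (A ∩ B) ≤ weight t N A + weight t N B := by
  have h1 : ((A ∪ B).card : ℤ) + (A ∩ B).card = A.card + B.card := by
    exact_mod_cast Finset.card_union_add_card_inter A B
  have h2 : ∑ f, max (2 * ((N f ∩ A).card : ℤ) - (t + 1)) 0
        + ∑ f, max (2 * ((N f ∩ B).card : ℤ) - (t + 1)) 0
      ≤ ∑ f, max (2 * ((N f ∩ (A ∪ B)).card : ℤ) - (t + 1)) 0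
        + ∑ f, max (2 * ((N f ∩ (A ∩ B)).card : ℤ) - (t + 1)) 0 := by
    rw [← Finset.sum_add_distrib, ← Finset.sum_add_distrib]
    refine Finset.sum_le_sum fun f _ => ?_
    have e := Finset.card_union_add_card_inter (N f ∩ A) (N f ∩ B)
    rw [← Finset.inter_union_distrib_left, ← Finset.inter_inter_distrib_left] at e
    have hA : (N f ∩ A).card ≤ (N f ∩ (A ∪ B)).card :=
      Finset.card_le_card (Finset.inter_subset_inter_left Finset.subset_union_left)
    have hB : (N f ∩ B).card ≤ (N f ∩ (A ∪ B)).card :=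
      Finset.card_le_card (Finset.inter_subset_inter_left Finset.subset_union_right)
    omega
  unfold weight
  linarith

/-- The change of the weight when a set is enlarged, estimated through a set `G` of constraints
with more than `t` variables in the larger set. -/
lemma weight_le_weight_add {A X : Finset V} (hAX : A ⊆ X) (G : Finset F)
    (hG : ∀ f ∈ G, t < (N f ∩ X).card) :
    weight t N X ≤ weight t N A + 2 * (X \ A).card
      - ∑ v ∈ X \ A, ((G.filter fun f => v ∈ N f).card : ℤ)
      - ∑ f ∈ G, (min (N f ∩ A).card (N f ∩ (X \ A)).card : ℤ) := by
  classical
  have hcard : (X.card : ℤ) = A.card + (X \ A).card := by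
    have := Finset.card_sdiff_add_card_eq_card hAX
    omega
  have hN : ∀ f, (N f ∩ X).card = (N f ∩ A).card + (N f ∩ (X \ A)).card := by
    intro f
    rw [← Finset.card_union_of_disjoint, ← Finset.inter_union_distrib_left,
      Finset.union_sdiff_of_subset hAX]
    exact Finset.disjoint_sdiff.mono Finset.inter_subset_right Finset.inter_subset_right
  have hdc : ∑ v ∈ X \ A, ((G.filter fun f => v ∈ N f).card : ℤ)
      = ∑ f ∈ G, ((N f ∩ (X \ A)).card : ℤ) := by
    have := Finset.sum_card_bipartiteAbove_eq_sum_card_bipartiteBelow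
      (s := X \ A) (t := G) (fun v f => v ∈ N f)
    simp only [Finset.bipartiteAbove, Finset.bipartiteBelow] at this
    have e : ∀ f, (X \ A).filter (fun v => v ∈ N f) = N f ∩ (X \ A) := by
      intro f
      ext v
      simp [and_comm]
    simp only [e] at this
    exact_mod_cast this
  have key : ∑ f ∈ G, ((N f ∩ (X \ A)).card : ℤ)
      + ∑ f ∈ G, (min (N f ∩ A).card (N f ∩ (X \ A)).card : ℤ)
      + ∑ f, max (2 * ((N f ∩ A).card : ℤ) - (t + 1)) 0
      ≤ ∑ f, max (2 * ((N f ∩ X).card : ℤ) - (t + 1)) 0 := by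
    have e : ∀ c : F → ℤ, ∑ f ∈ G, c f = ∑ f, if f ∈ G then c f else 0 := fun c => by
      rw [Finset.sum_ite_mem, Finset.univ_inter]
    rw [← Finset.sum_add_distrib, e, ← Finset.sum_add_distrib]
    refine Finset.sum_le_sum fun f _ => ?_
    have := hN f
    -- For `f ∈ G` with `a` variables in `A` and `d` in `X \ A`, the contribution grows by at least
    -- `min (2a + 2d - (t+1)) (2d)`. As `a + d ≥ t + 1`, this is at least `min (a + d) (2d) = d +
    -- min a d`. This is what the threshold at half of `t + 1` achieves.
    split_ifs with hf
    · have := hG f hf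
      omega
    · omega
  rw [hdc]
  unfold weight
  linarith

lemma two_le_card_of_not_eliminable {Q : Finset V} {v : V} (h : ¬ Eliminable t N Q v) :
    2 ≤ ((Finset.univ.filter fun f => t < (N f ∩ Q).card).filter fun f => v ∈ N f).card := by
  unfold Eliminable at h
  push Not at h
  obtain ⟨f, g, hf, hg, h1, h2, hne⟩ := h
  exact Finset.one_lt_card.2 ⟨f, by simp [hf, h1], g, by simp [hg, h2], hne⟩

/-- Outside of a tight set some variable can be eliminated. -/
lemma IsTight.exists_eliminable {b : ℕ} {A M : Finset V} (hA : IsTight t N b A) (hAM : A ⊂ M)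
    (hM : M.card ≤ b) : ∃ v ∈ M \ A, Eliminable t N M v := by
  by_contra! hcon
  have h1 := hA M hAM hM
  have h2 := weight_le_weight_add (t := t) (N := N) hAM.1 (Finset.univ.filter fun f => t < (N f ∩ M).card)
    (by simp)
  -- Every new variable lies in two active constraints, and these two incidences cancel its cost
  -- `2`; the weight would not increase, against tightness.
  have h3 : ∑ v ∈ M \ A, (2 : ℤ) ≤ ∑ v ∈ M \ A,
      (((Finset.univ.filter fun f => t < (N f ∩ M).card).filter fun f => v ∈ N f).card : ℤ) :=
    Finset.sum_le_sum fun v hv => by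
      exact_mod_cast two_le_card_of_not_eliminable (hcon v hv)
  have h4 : 0 ≤ ∑ f ∈ Finset.univ.filter fun f => t < (N f ∩ M).card,
      (min (N f ∩ A).card (N f ∩ (M \ A)).card : ℤ) :=
    Finset.sum_nonneg fun f _ => by positivity
  simp only [Finset.sum_const, nsmul_eq_mul] at h3
  linarith

/-- Small sets of variables have weight at least `η` times their size. -/
def IsExpanding (t : ℕ) (N : F → Finset V) (η : ℝ) (b : ℕ) : Prop :=
  ∀ M : Finset V, M.card ≤ b → η * M.card ≤ weight t N M

end Weight

/-! ### Tight sets are separated by their intersection -/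

section Separation

variable {V F : Type*} [DecidableEq V] (t : ℕ) (N : F → Finset V)

/-- `X` and `Y` cover `Q`, contain `A` and `B`, and every constraint with more than `t` variables in
`Q` has its variables in `Q` on one side. -/
structure IsSeparation (A B Q X Y : Finset V) : Prop where
  left : A ⊆ X
  right : B ⊆ Y
  union : X ∪ Y = Q
  side : ∀ f, t < (N f ∩ Q).card → N f ∩ Q ⊆ X ∨ N f ∩ Q ⊆ Y

variable {t N}

lemma IsSeparation.symm {A B Q X Y : Finset V} (h : IsSeparation t N A B Q X Y) :
    IsSeparation t N B A Q Y X :=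
  ⟨h.right, h.left, by rw [Finset.union_comm, h.union], fun f hf => (h.side f hf).symm⟩

variable [Fintype F]

/-- In a separation with smallest overlap, the weight of a side is at most that of the set it
contains. -/
lemma IsSeparation.weight_le {A B Q X Y : Finset V} (h : IsSeparation t N A B Q X Y)
    (hmin : ∀ X' Y', IsSeparation t N A B Q X' Y' → (X ∩ Y).card ≤ (X' ∩ Y').card)
    (hQ : ∀ v ∈ Q, v ∉ A → v ∉ B → ¬ Eliminable t N Q v) :
    weight t N X ≤ weight t N A := by
  classical
  have hXQ : X ⊆ Q := h.union ▸ Finset.subset_union_left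
  have hYQ : Y ⊆ Q := h.union ▸ Finset.subset_union_right
  have hNX : ∀ f, N f ∩ Q ⊆ X → N f ∩ Q = N f ∩ X := fun f hf =>
    Finset.Subset.antisymm (Finset.subset_inter Finset.inter_subset_left hf)
      (Finset.inter_subset_inter_left hXQ)
  set G : Finset F := Finset.univ.filter fun f => t < (N f ∩ Q).card ∧ N f ∩ Q ⊆ X with hGdef
  have hG : ∀ f, f ∈ G ↔ t < (N f ∩ Q).card ∧ N f ∩ Q ⊆ X := by simp [hGdef]
  -- the overlap outside `A` is at most the number of variables needed to cut around `A`
  have hcut : ((X ∩ Y) \ A).card ≤ ∑ f ∈ G, min (N f ∩ A).card (N f ∩ (X \ A)).card := by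
    -- Competing separation that cuts around `A`: each constraint on the side of `X` is cut at the
    -- smaller of its parts inside and outside `A`, at a cost of `min`. Constraints on the side of
    -- `Y` can meet `A` only in the overlap, which is kept.
    set c : F → Finset V := fun f =>
      if (N f ∩ A).card ≤ (N f ∩ (X \ A)).card then N f ∩ A else N f ∩ (X \ A) with hc
    have hcX : ∀ f, c f ⊆ X := by
      intro f
      simp only [hc]
      split_ifs
      · exact Finset.inter_subset_right.trans h.left
      · exact Finset.inter_subset_right.trans Finset.sdiff_subset
    set U := (X ∩ Y ∩ A) ∪ G.biUnion c with hU
    have hUX : U ⊆ X := Finset.union_subset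
      (Finset.inter_subset_left.trans Finset.inter_subset_left)
      (Finset.biUnion_subset.2 fun f _ => hcX f)
    have hsep : IsSeparation t N A B Q (A ∪ U) ((Q \ A) ∪ U) := by
      refine ⟨Finset.subset_union_left, ?_, ?_, ?_⟩
      · intro v hv
        by_cases hvA : v ∈ A
        · refine Finset.mem_union_right _ (Finset.mem_union_left _ ?_)
          simp [h.left hvA, h.right hv, hvA]
        · exact Finset.mem_union_left _ (by simp [hYQ (h.right hv), hvA])
      · ext v
        have h1 : v ∈ A → v ∈ Q := fun hv => hXQ (h.left hv)
        have h2 : v ∈ U → v ∈ Q := fun hv => hXQ (hUX hv)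
        simp only [Finset.mem_union, Finset.mem_sdiff]
        tauto
      · intro f hf
        by_contra hcon
        push Not at hcon
        obtain ⟨⟨y, hy, hy'⟩, a, ha, ha'⟩ :=
          And.imp Finset.not_subset.1 Finset.not_subset.1 hcon
        simp only [Finset.mem_union, Finset.mem_sdiff, not_or, not_and, not_not] at hy' ha'
        have haA : a ∈ A := ha'.1 (Finset.mem_inter.1 ha).2
        rcases h.side f hf with hX | hY
        · have hfG : f ∈ G := (hG f).2 ⟨hf, hX⟩
          by_cases hle : (N f ∩ A).card ≤ (N f ∩ (X \ A)).card
          · refine ha'.2 (Finset.mem_union_right _ (Finset.mem_biUnion.2 ⟨f, hfG, ?_⟩))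
            simp only [hc, hle, if_true]
            exact Finset.mem_inter.2 ⟨(Finset.mem_inter.1 ha).1, haA⟩
          · refine hy'.2 (Finset.mem_union_right _ (Finset.mem_biUnion.2 ⟨f, hfG, ?_⟩))
            simp only [hc, hle, if_false]
            exact Finset.mem_inter.2 ⟨(Finset.mem_inter.1 hy).1,
              Finset.mem_sdiff.2 ⟨hX hy, hy'.1⟩⟩
        · refine ha'.2 (Finset.mem_union_left _ ?_)
          simp [h.left haA, hY ha, haA]
    have hle := hmin _ _ hsep
    have hinter : (A ∪ U) ∩ ((Q \ A) ∪ U) ⊆ U := by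
      intro v
      simp only [Finset.mem_inter, Finset.mem_union, Finset.mem_sdiff]
      tauto
    have hUcard : U.card ≤ (X ∩ Y ∩ A).card + ∑ f ∈ G, min (N f ∩ A).card (N f ∩ (X \ A)).card := by
      refine (Finset.card_union_le _ _).trans (Nat.add_le_add_left ?_ _)
      refine Finset.card_biUnion_le.trans (Finset.sum_le_sum fun f _ => ?_)
      simp only [hc]
      split_ifs <;> omega
    have := Finset.card_le_card hinter
    have := Finset.card_sdiff_add_card_inter (X ∩ Y) A
    omega
  -- every variable of the overlap outside `A` is in a constraint on the side of `X`
  have hone : ∀ u ∈ X \ A, u ∈ Y → 1 ≤ (G.filter fun f => u ∈ N f).card := by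
    intro u hu huY
    rw [Finset.mem_sdiff] at hu
    by_contra hcon
    have hemp : ∀ f ∈ G, u ∉ N f := by
      intro f hf huf
      exact hcon (Finset.card_pos.2 ⟨f, Finset.mem_filter.2 ⟨hf, huf⟩⟩)
    have hsep : IsSeparation t N A B Q (X.erase u) Y := by
      refine ⟨Finset.subset_erase.2 ⟨h.left, hu.2⟩, h.right, ?_, ?_⟩
      · rw [← h.union]
        ext v
        simp only [Finset.mem_union, Finset.mem_erase]
        by_cases hv : v = u
        · subst hv; simp [huY]
        · simp [hv]
      · intro f hf
        rcases h.side f hf with hX | hY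
        · refine Or.inl (Finset.subset_erase.2 ⟨hX, fun hmem => ?_⟩)
          exact hemp f ((hG f).2 ⟨hf, hX⟩) (Finset.mem_inter.1 hmem).1
        · exact Or.inr hY
    have h1 := hmin _ _ hsep
    rw [Finset.erase_inter] at h1
    have h2 : ((X ∩ Y).erase u).card < (X ∩ Y).card :=
      Finset.card_erase_lt_of_mem (Finset.mem_inter.2 ⟨hu.1, huY⟩)
    omega
  -- Such a variable is in neither `A` nor `B`, so it cannot be eliminated; its two active
  -- constraints cannot lie inside `Y`, so both belong to `G`.
  have htwo : ∀ u ∈ X \ A, u ∉ Y → 2 ≤ (G.filter fun f => u ∈ N f).card := by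
    intro u hu huY
    rw [Finset.mem_sdiff] at hu
    have := two_le_card_of_not_eliminable
      (hQ u (hXQ hu.1) hu.2 fun hB => huY (h.right hB))
    refine this.trans (Finset.card_le_card fun f hf => ?_)
    simp only [Finset.mem_filter, Finset.mem_univ, true_and] at hf ⊢
    refine ⟨(hG f).2 ⟨hf.1, ?_⟩, hf.2⟩
    refine (h.side f hf.1).resolve_right fun hY => huY (hY ?_)
    exact Finset.mem_inter.2 ⟨hf.2, hXQ hu.1⟩
  have hdeg : 2 * ((X \ A).card : ℤ) - ((X ∩ Y) \ A).card
      ≤ ∑ v ∈ X \ A, ((G.filter fun f => v ∈ N f).card : ℤ) := by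
    have e : (X ∩ Y) \ A = (X \ A).filter fun v => v ∈ Y := by
      ext v
      simp only [Finset.mem_sdiff, Finset.mem_inter, Finset.mem_filter]
      tauto
    calc 2 * ((X \ A).card : ℤ) - ((X ∩ Y) \ A).card
        = ∑ v ∈ X \ A, ((2 : ℤ) - if v ∈ Y then 1 else 0) := by
          rw [Finset.sum_sub_distrib, e, ← Finset.sum_filter]
          simp [mul_comm]
      _ ≤ _ := by
          refine Finset.sum_le_sum fun v hv => ?_
          split_ifs with hY
          · have := hone v hv hY
            omega
          · have := htwo v hv hY
            omega
  -- By `hdeg` the incidences fall short of `2 * (X \ A).card` by at most the overlap outside `A`,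
  -- and by `hcut` the `min` terms make up for this deficit.
  have hmain := weight_le_weight_add h.left G
    (fun f hf => by rw [← hNX f ((hG f).1 hf).2]; exact ((hG f).1 hf).1)
  have hcut' : (((X ∩ Y) \ A).card : ℤ)
      ≤ ∑ f ∈ G, (min (N f ∩ A).card (N f ∩ (X \ A)).card : ℤ) := by exact_mod_cast hcut
  linarith

/-- If no variable outside of two tight sets `A`, `B` can be eliminated from `Q`, then `Q` is their
union and no constraint with more than `t` variables in `Q` crosses from `A \ B` to `B \ A`. -/
lemma IsTight.separated [Fintype V] {b : ℕ} {A B Q : Finset V} (hA : IsTight t N b A)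
    (hB : IsTight t N b B) (hAQ : A ⊆ Q) (hBQ : B ⊆ Q) (hcard : Q.card ≤ b)
    (hQ : ∀ v ∈ Q, v ∉ A → v ∉ B → ¬ Eliminable t N Q v) : IsSeparation t N A B Q A B := by
  classical
  -- Minimum cut, with the trivial separation `(Q, Q)` as a candidate. Its sides weigh no more than
  -- the tight sets they contain, so they equal them.
  obtain ⟨⟨X, Y⟩, hXY, hmin⟩ := Finset.exists_min_image
    (Finset.univ.filter fun p : Finset V × Finset V => IsSeparation t N A B Q p.1 p.2)
    (fun p => (p.1 ∩ p.2).card)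
    ⟨(Q, Q), by simpa using ⟨hAQ, hBQ, Finset.union_self Q, fun f _ =>
      Or.inl Finset.inter_subset_right⟩⟩
  simp only [Finset.mem_filter, Finset.mem_univ, true_and, Prod.forall] at hXY hmin
  have hXQ : X ⊆ Q := hXY.union ▸ Finset.subset_union_left
  have hYQ : Y ⊆ Q := hXY.union ▸ Finset.subset_union_right
  have hX : A = X := by
    by_contra hne
    have := hA X (hXY.left.ssubset_of_ne hne) ((Finset.card_le_card hXQ).trans hcard)
    exact this.not_ge (hXY.weight_le hmin hQ)
  have hY : B = Y := by
    by_contra hne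
    have := hB Y (hXY.right.ssubset_of_ne hne) ((Finset.card_le_card hYQ).trans hcard)
    refine this.not_ge (hXY.symm.weight_le (fun X' Y' h' => ?_) fun v hv h1 h2 => hQ v hv h2 h1)
    rw [Finset.inter_comm, Finset.inter_comm X']
    exact hmin _ _ h'.symm
  rw [← hX, ← hY] at hXY
  exact hXY

/-- If nothing outside `A ∪ B` could be eliminated, `separated` would force `M = A ∪ B`. This gives
consistency of the densities above a union of tight sets without the union being assumed tight. -/
lemma IsTight.exists_eliminable_union [Fintype V] {b : ℕ} {A B M : Finset V}
    (hA : IsTight t N b A) (hB : IsTight t N b B) (hM : A ∪ B ⊂ M) (hcard : M.card ≤ b) :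
    ∃ v ∈ M \ (A ∪ B), Eliminable t N M v := by
  by_contra! hcon
  have := hA.separated hB (Finset.subset_union_left.trans hM.1)
    (Finset.subset_union_right.trans hM.1) hcard
    (fun v hv h1 h2 => hcon v (by simp [hv, h1, h2]))
  exact hM.ne this.union

end Separation

/-! ### Closures -/

section Closure

variable {V F : Type*} [Fintype V] [DecidableEq V] [Fintype F] {t : ℕ} {N : F → Finset V}

/-- Among the minimisers of the weight a largest one is taken: the tie-break by cardinality makes
the growth of the weight strict. -/
lemma exists_isTight (t : ℕ) (N : F → Finset V) {b : ℕ} {S : Finset V} (hS : S.card ≤ b) :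
    ∃ A, S ⊆ A ∧ A.card ≤ b ∧ IsTight t N b A ∧
      ∀ M, S ⊆ M → M.card ≤ b → weight t N A ≤ weight t N M := by
  classical
  set 𝓜 := Finset.univ.filter fun M : Finset V => S ⊆ M ∧ M.card ≤ b with h𝓜
  obtain ⟨A, hA, hmin⟩ := Finset.exists_min_image 𝓜
    (fun M => toLex (weight t N M, -(M.card : ℤ))) ⟨S, by simp [h𝓜, hS]⟩
  simp only [h𝓜, Finset.mem_filter, Finset.mem_univ, true_and] at hA hmin
  refine ⟨A, hA.1, hA.2, fun X hX hXb => ?_, fun M hM hMb => ?_⟩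
  · have := hmin X ⟨hA.1.trans hX.1, hXb⟩
    have hc := Finset.card_lt_card hX
    rw [Prod.Lex.toLex_le_toLex] at this
    rcases this with h | h
    · exact h
    · have := h.2
      simp only at this
      omega
  · have := hmin M ⟨hM, hMb⟩
    rw [Prod.Lex.toLex_le_toLex] at this
    rcases this with h | h
    · exact h.le
    · exact h.1.le

/-- Smallest tight set above `S`: the largest minimiser of the weight among the supersets of `S` with
at most `b` elements. -/
def closure (t : ℕ) (N : F → Finset V) (b : ℕ) (S : Finset V) : Finset V :=
  if h : S.card ≤ b then (exists_isTight t N h).choose else S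

lemma subset_closure (b : ℕ) (S : Finset V) : S ⊆ closure t N b S := by
  unfold closure
  split_ifs with h
  · exact (exists_isTight t N h).choose_spec.1
  · exact subset_rfl

lemma closure_card_le {b : ℕ} {S : Finset V} (h : S.card ≤ b) : (closure t N b S).card ≤ b := by
  rw [closure, dif_pos h]
  exact (exists_isTight t N h).choose_spec.2.1

lemma closure_isTight {b : ℕ} {S : Finset V} (h : S.card ≤ b) :
    IsTight t N b (closure t N b S) := by
  rw [closure, dif_pos h]
  exact (exists_isTight t N h).choose_spec.2.2.1

lemma weight_closure_le {b : ℕ} {S M : Finset V} (hSM : S ⊆ M) (hM : M.card ≤ b) :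
    weight t N (closure t N b S) ≤ weight t N M := by
  have h := (Finset.card_le_card hSM).trans hM
  rw [closure, dif_pos h]
  exact (exists_isTight t N h).choose_spec.2.2.2 M hSM hM

/-- Otherwise joining the closure to `A` would increase the weight, and by submodularity the
intersection of the two, which still contains `S`, would weigh less than the closure. -/
lemma closure_subset {b : ℕ} {S A : Finset V} (hA : IsTight t N b A) (hSA : S ⊆ A)
    (hcard : (closure t N b S ∪ A).card ≤ b) : closure t N b S ⊆ A := by
  by_contra hcon
  have h1 : A ⊂ closure t N b S ∪ A :=
    Finset.subset_union_right.ssubset_of_ne fun h => hcon (Finset.union_eq_right.1 h.symm)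
  have h2 := hA _ h1 hcard
  have h3 := weight_union_add_weight_inter (t := t) (N := N) (closure t N b S) A
  have h4 := weight_closure_le (t := t) (N := N) (b := b)
    (Finset.subset_inter (subset_closure (t := t) (N := N) b S) hSA)
    ((Finset.card_le_card (Finset.inter_subset_left.trans Finset.subset_union_left)).trans hcard)
  linarith

end Closure

/-! ### Positivity -/

section Juntas

variable {V Ω : Type*}

/-- The functions that depend only on the variables in `A`. -/
def juntas (Ω : Type*) (A : Finset V) : Submodule ℝ ((V → Ω) → ℝ) where
  carrier := {g | DependsOn g (A : Set V)}
  add_mem' := fun hg hh x y hxy => by simp [hg hxy, hh hxy]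
  zero_mem' := fun _ _ _ => rfl
  smul_mem' := fun c g hg x y hxy => by simp [hg hxy]

lemma dependsOn_mul {A : Finset V} {g h : (V → Ω) → ℝ} (hg : DependsOn g (A : Set V))
    (hh : DependsOn h (A : Set V)) : DependsOn (g * h) (A : Set V) :=
  fun x y hxy => by simp [hg hxy, hh hxy]

lemma dependsOn_of_subset {A B : Finset V} {g : (V → Ω) → ℝ} (hg : DependsOn g (A : Set V))
    (h : A ⊆ B) : DependsOn g (B : Set V) :=
  fun _ _ hxy => hg fun i hi => hxy i (h hi)

end Juntas

/-! ### Conditional independence and the Gram–Schmidt induction. -/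

section Positivity

variable {V Ω F : Type*} [Fintype V] [DecidableEq V] [Fintype Ω] [Fintype F]
  {t : ℕ} {N : F → Finset V} {φ : F → (V → Ω) → ℝ}

/-- Orthogonal projection onto sums of juntas with respect to a nonnegative density. -/
lemma exists_projection {D : (V → Ω) → ℝ} (hD : ∀ x, 0 ≤ D x) (𝓒 : Finset (Finset V))
    (u : (V → Ω) → ℝ) :
    ∃ l : Finset V → (V → Ω) → ℝ, (∀ C, DependsOn (l C) (C : Set V)) ∧
      ∀ C ∈ 𝓒, ∀ h : (V → Ω) → ℝ, DependsOn h (C : Set V) →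
        mean ((u - ∑ C ∈ 𝓒, l C) * h * D) = 0 := by
  classical
  -- Multiplication by `√D` carries the possibly degenerate form of `L²(D)` to the Euclidean inner
  -- product, so zeros of `D` are harmless.
  let T : ((V → Ω) → ℝ) →ₗ[ℝ] EuclideanSpace ℝ (V → Ω) :=
    { toFun := fun g => WithLp.toLp 2 fun x => √(D x) * g x
      map_add' := fun g h => by ext x; simp [mul_add]
      map_smul' := fun c g => by ext x; simp; ring }
  have hT : ∀ g h, inner ℝ (T g) (T h) = ∑ x, h x * g x * D x := by
    intro g h
    simp only [T, LinearMap.coe_mk, AddHom.coe_mk, PiLp.inner_apply, RCLike.inner_apply,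
      conj_trivial]
    refine Finset.sum_congr rfl fun x _ => ?_
    have := Real.mul_self_sqrt (hD x)
    linear_combination (h x * g x) * this
  set K := (⨆ C ∈ 𝓒, juntas Ω C).map T with hK
  obtain ⟨p, hp, r, hr, hpr⟩ := K.exists_add_mem_mem_orthogonal (T u)
  obtain ⟨l, hl, rfl⟩ := Submodule.mem_map.1 hp
  obtain ⟨c, hc⟩ := (Submodule.mem_iSup_finset_iff_exists_sum _ _).1 hl
  refine ⟨fun C => c C, fun C => (c C).2, fun C hC h hh => ?_⟩
  have hmem : T h ∈ K := Submodule.mem_map_of_mem (Submodule.mem_iSup_of_mem C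
    (Submodule.mem_iSup_of_mem hC hh))
  have h0 := (K.mem_orthogonal r).1 hr _ hmem
  have hr' : r = T (u - l) := by rw [map_sub, hpr]; abel
  rw [hr', hT, ← hc] at h0
  simp only [mean, Pi.mul_apply]
  rw [h0, mul_zero]

lemma mean_sum_mul {ι : Type*} (s : Finset ι) (c : ι → (V → Ω) → ℝ) (h : (V → Ω) → ℝ) :
    mean ((∑ i ∈ s, c i) * h) = ∑ i ∈ s, mean (c i * h) := by
  classical
  induction s using Finset.induction_on with
  | empty => simp [mean_zero]
  | insert i s hi ih => rw [Finset.sum_insert hi, Finset.sum_insert hi, add_mul, mean_add, ih]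

variable [Nonempty Ω]

lemma mean_mul_density_union (hφ : IsWiseDensity t N φ) {b : ℕ} {A B Q : Finset V}
    (hA : IsTight t N b A) (hB : IsTight t N b B) (hAQ : A ⊆ Q) (hBQ : B ⊆ Q) (hQ : Q.card ≤ b)
    {g : (V → Ω) → ℝ} (hg : DependsOn g ((A ∪ B : Finset V) : Set V)) :
    mean (g * density φ Q) = mean (g * density φ (A ∪ B)) :=
  mean_mul_density_of_eliminable hφ (Finset.union_subset hAQ hBQ)
    (fun _ h1 h2 => hA.exists_eliminable_union hB h1 ((Finset.card_le_card h2).trans hQ)) hg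

lemma mean_mul_density_of_isTight (hφ : IsWiseDensity t N φ) {b : ℕ} {A Q : Finset V}
    (hA : IsTight t N b A) (hAQ : A ⊆ Q) (hQ : Q.card ≤ b)
    {g : (V → Ω) → ℝ} (hg : DependsOn g (A : Set V)) :
    mean (g * density φ Q) = mean (g * density φ A) :=
  mean_mul_density_of_eliminable hφ hAQ
    (fun _ h1 h2 => hA.exists_eliminable h1 ((Finset.card_le_card h2).trans hQ)) hg

/-- The variables in two tight sets are conditionally independent given those in their
intersection. -/
lemma exists_condExp (hφ : IsWiseDensity t N φ) {b : ℕ} {A B : Finset V}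
    (hA : IsTight t N b A) (hB : IsTight t N b B) (hAB : (A ∪ B).card ≤ b)
    {v : (V → Ω) → ℝ} (hv : DependsOn v (B : Set V)) :
    ∃ w : (V → Ω) → ℝ, DependsOn w ((A ∩ B : Finset V) : Set V) ∧
      ∀ u : (V → Ω) → ℝ, DependsOn u (A : Set V) →
        mean (u * v * density φ (A ∪ B)) = mean (u * w * density φ A) := by
  classical
  have hsep : IsSeparation t N A B (A ∪ B) A B :=
    hA.separated hB Finset.subset_union_left Finset.subset_union_right hAB
      (fun x hx h1 h2 => by simp [h1, h2] at hx)
  -- The density on `A ∪ B` factors into a function on `A` and a function on `B`: by the separation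
  -- each active constraint lies on one side, and the marginals of the others are constantly one.
  set FA : (V → Ω) → ℝ := ∏ f ∈ Finset.univ.filter (fun f => N f ∩ (A ∪ B) ⊆ A),
    avg A (φ f) with hFA
  set FB : (V → Ω) → ℝ := ∏ f ∈ Finset.univ.filter (fun f => ¬ N f ∩ (A ∪ B) ⊆ A),
    avg B (φ f) with hFB
  have hFAd : DependsOn FA (A : Set V) := by
    intro x y hxy
    simp only [hFA, Finset.prod_apply]
    exact Finset.prod_congr rfl fun f _ => avg_dependsOn A (φ f) hxy
  have hFBd : DependsOn FB (B : Set V) := by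
    intro x y hxy
    simp only [hFB, Finset.prod_apply]
    exact Finset.prod_congr rfl fun f _ => avg_dependsOn B (φ f) hxy
  have hFB0 : ∀ x, 0 ≤ FB x := by
    intro x
    simp only [hFB, Finset.prod_apply]
    exact Finset.prod_nonneg fun f _ => avg_nonneg (hφ.nonneg f) x
  have hsub : ∀ (f : F) (C : Finset V), C ⊆ A ∪ B → N f ∩ (A ∪ B) ⊆ C →
      avg (A ∪ B) (φ f) = avg C (φ f) := by
    intro f C hC hf
    rw [avg_eq_avg_inter (hφ.dependsOn f), avg_eq_avg_inter (A := C) (hφ.dependsOn f)]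
    congr 1
    refine Finset.Subset.antisymm (Finset.subset_inter ?_ Finset.inter_subset_right)
      (Finset.inter_subset_inter_right hC)
    rwa [Finset.inter_comm]
  have hprod : density φ (A ∪ B) = FA * FB := by
    unfold density
    rw [← Finset.prod_filter_mul_prod_filter_not Finset.univ (fun f => N f ∩ (A ∪ B) ⊆ A)]
    congr 1
    · refine Finset.prod_congr rfl fun f hf => ?_
      exact hsub f A Finset.subset_union_left (Finset.mem_filter.1 hf).2
    · refine Finset.prod_congr rfl fun f hf => ?_
      by_cases hact : t < (N f ∩ (A ∪ B)).card
      · exact hsub f B Finset.subset_union_right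
          ((hsep.side f hact).resolve_left (Finset.mem_filter.1 hf).2)
      · rw [hφ.avg_eq_one f _ (not_lt.1 hact), hφ.avg_eq_one f B]
        exact (Finset.card_le_card (Finset.inter_subset_inter_left
          Finset.subset_union_right)).trans (not_lt.1 hact)
  have hν : ∀ g : (V → Ω) → ℝ, DependsOn g (B : Set V) →
      DependsOn (avg A g) ((A ∩ B : Finset V) : Set V) := by
    intro g hg
    rw [avg_eq_avg_inter hg]
    exact avg_dependsOn _ _
  -- The conditional expectation of `v` given the variables in `A`; since `v` and `FB` depend only
  -- on `B`, it depends only on `A ∩ B`.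
  set w : (V → Ω) → ℝ := avg A (v * FB) / avg A FB with hw
  have hwd : DependsOn w ((A ∩ B : Finset V) : Set V) := by
    intro x y hxy
    simp only [hw, Pi.div_apply]
    rw [hν _ (dependsOn_mul hv hFBd) hxy, hν _ hFBd hxy]
  have hwmul : w * avg A FB = avg A (v * FB) := by
    ext x
    simp only [hw, Pi.mul_apply, Pi.div_apply]
    -- Where the denominator vanishes, the nonnegative `FB` vanishes on the whole fibre, hence so
    -- does the numerator, and the value of the quotient does not matter.
    by_cases h0 : avg A FB x = 0
    · have : avg A (v * FB) x = 0 := by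
        unfold avg
        simp [eq_zero_of_avg_eq_zero hFB0 h0]
      rw [h0, this]
      simp
    · exact div_mul_cancel₀ _ h0
  refine ⟨w, hwd, fun u hu => ?_⟩
  have hwA : DependsOn w (A : Set V) := dependsOn_of_subset hwd Finset.inter_subset_left
  calc mean (u * v * density φ (A ∪ B))
      = mean ((u * FA) * (v * FB)) := by rw [hprod]; congr 1; ring
    _ = mean ((u * FA) * avg A (v * FB)) := (mean_mul_avg (dependsOn_mul hu hFAd) _).symm
    _ = mean ((u * FA * w) * avg A FB) := by rw [← hwmul]; congr 1; ring
    _ = mean ((u * FA * w) * FB) := mean_mul_avg (dependsOn_mul (dependsOn_mul hu hFAd) hwA) _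
    _ = mean ((u * w) * density φ (A ∪ B)) := by rw [hprod]; congr 1; ring
    _ = mean (u * w * density φ A) :=
        mean_mul_density_of_isTight hφ hA Finset.subset_union_left hAB (dependsOn_mul hu hwA)

/-- The quadratic form defined by the local densities is nonnegative. -/
theorem sum_mean_mul_density_nonneg (hφ : IsWiseDensity t N φ) {b : ℕ} (𝓐 : Finset (Finset V))
    (htight : ∀ A ∈ 𝓐, IsTight t N b A) (hcard : ∀ A ∈ 𝓐, ∀ B ∈ 𝓐, (A ∪ B).card ≤ b)
    (hinter : ∀ A ∈ 𝓐, ∀ B ∈ 𝓐, A ∩ B ∈ 𝓐)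
    (g : Finset V → (V → Ω) → ℝ) (hg : ∀ A, DependsOn (g A) (A : Set V)) :
    0 ≤ ∑ A ∈ 𝓐, ∑ B ∈ 𝓐, mean (g A * g B * density φ (A ∪ B)) := by
  classical
  induction 𝓐 using Finset.strongInduction generalizing g with
  | H 𝓐 ih =>
    rcases 𝓐.eq_empty_or_nonempty with rfl | hne
    · simp
    -- Maximal cardinality ensures that `A ∩ B` is a proper subset of `A` for every other member
    -- `B`, so it remains in the family once `A` is removed.
    obtain ⟨A, hA, hmax⟩ := 𝓐.exists_max_image Finset.card hne
    set 𝓑 := 𝓐.erase A with h𝓑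
    have h𝓑𝓐 : ∀ B ∈ 𝓑, B ∈ 𝓐 := fun B hB => Finset.mem_of_mem_erase hB
    set 𝓒 := 𝓑.filter (· ⊆ A) with h𝓒
    have hne_of : ∀ B ∈ 𝓑, A ∩ B ∈ 𝓒 := by
      intro B hB
      refine Finset.mem_filter.2 ⟨Finset.mem_erase.2 ⟨fun h => ?_, hinter A hA B (h𝓑𝓐 B hB)⟩,
        Finset.inter_subset_left⟩
      have hsub : A ⊆ B := Finset.inter_eq_left.1 h
      exact (Finset.mem_erase.1 hB).1
        (Finset.eq_of_subset_of_card_le hsub (hmax B (h𝓑𝓐 B hB))).symm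
    -- The part of `g A` explained by smaller members inside `A` is split off. The remainder `u` is
    -- orthogonal to every `B ≠ A`, because conditioning moves a function on `B` to `A ∩ B`, which
    -- is in `𝓒`.
    obtain ⟨l, hl, horth⟩ := exists_projection (density_nonneg hφ A) 𝓒 (g A)
    set u := g A - ∑ C ∈ 𝓒, l C with hu
    have hud : DependsOn u (A : Set V) := by
      have : u ∈ juntas Ω A := Submodule.sub_mem _ (hg A) (Submodule.sum_mem _ fun C hC =>
        dependsOn_of_subset (hl C) (Finset.mem_filter.1 hC).2)
      exact this
    have hgA : g A = u + ∑ C ∈ 𝓒, l C := by rw [hu]; abel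
    -- `u` is orthogonal to everything else
    have hu0 : ∀ B ∈ 𝓑, ∀ v : (V → Ω) → ℝ, DependsOn v (B : Set V) →
        mean (u * v * density φ (A ∪ B)) = 0 := by
      intro B hB v hv
      obtain ⟨w, hw, hw'⟩ := exists_condExp hφ (htight A hA) (htight B (h𝓑𝓐 B hB))
        (hcard A hA B (h𝓑𝓐 B hB)) hv
      rw [hw' u hud]
      exact horth _ (hne_of B hB) w hw
    have hcons : ∀ C ∈ 𝓒, ∀ B ∈ 𝓐, ∀ v : (V → Ω) → ℝ, DependsOn v (B : Set V) →
        mean (l C * v * density φ (A ∪ B)) = mean (l C * v * density φ (C ∪ B)) := by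
      intro C hC B hB v hv
      have hC' := Finset.mem_filter.1 hC
      refine mean_mul_density_union hφ (htight C (h𝓑𝓐 C hC'.1)) (htight B hB)
        (hC'.2.trans Finset.subset_union_left) Finset.subset_union_right (hcard A hA B hB) ?_
      exact dependsOn_mul (dependsOn_of_subset (hl C) Finset.subset_union_left)
        (dependsOn_of_subset hv Finset.subset_union_right)
    set l' : Finset V → (V → Ω) → ℝ := fun B => if B ∈ 𝓒 then l B else 0 with hl'
    have hl'd : ∀ B, DependsOn (l' B) (B : Set V) := by
      intro B
      simp only [hl']
      split_ifs
      · exact hl B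
      · exact fun _ _ _ => rfl
    have hsum : ∀ c : Finset V → ℝ, (∀ B ∉ 𝓒, c B = 0) → ∑ B ∈ 𝓒, c B = ∑ B ∈ 𝓑, c B := by
      intro c hc
      exact Finset.sum_subset (Finset.filter_subset _ _) fun B _ hB => hc B hB
    have hl'0 : ∀ B ∉ 𝓒, l' B = 0 := fun B hB => by simp [hl', hB]
    have hl'C : ∀ B ∈ 𝓒, l' B = l B := fun B hB => by simp [hl', hB]
    have hmix : ∀ B ∈ 𝓑, mean (g A * g B * density φ (A ∪ B))
        = ∑ C ∈ 𝓑, mean (l' C * g B * density φ (C ∪ B)) := by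
      intro B hB
      rw [hgA, add_mul, add_mul, mean_add, hu0 B hB _ (hg B), zero_add, mul_assoc, mean_sum_mul,
        ← hsum _ (fun C hC => by simp [hl'0 C hC, mean_zero])]
      refine Finset.sum_congr rfl fun C hC => ?_
      rw [hl'C C hC, ← mul_assoc, hcons C hC B (h𝓑𝓐 B hB) _ (hg B)]
    have hdiag : mean (g A * g A * density φ (A ∪ A)) = mean (u * u * density φ A)
        + ∑ C ∈ 𝓑, ∑ C' ∈ 𝓑, mean (l' C * l' C' * density φ (C ∪ C')) := by
      have h1 : ∀ C ∈ 𝓒, mean (u * l C * density φ A) = 0 := fun C hC => horth C hC _ (hl C)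
      have h2 : mean (u * (∑ C ∈ 𝓒, l C) * density φ A) = 0 := by
        rw [mul_comm u, mul_assoc, mean_sum_mul]
        refine Finset.sum_eq_zero fun C hC => ?_
        rw [← h1 C hC]; congr 1; ring
      have h3 : mean ((∑ C ∈ 𝓒, l C) * (∑ C ∈ 𝓒, l C) * density φ A)
          = ∑ C ∈ 𝓑, ∑ C' ∈ 𝓑, mean (l' C * l' C' * density φ (C ∪ C')) := by
        rw [mul_assoc, mean_sum_mul, ← hsum _ (fun C hC => by simp [hl'0 C hC, mean_zero])]
        refine Finset.sum_congr rfl fun C hC => ?_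
        rw [mul_left_comm, mean_sum_mul,
          ← hsum _ (fun C' hC' => by simp [hl'0 C' hC', mean_zero])]
        refine Finset.sum_congr rfl fun C' hC' => ?_
        have hCA := Finset.mem_filter.1 hC'
        rw [hl'C C hC, hl'C C' hC', ← mul_assoc, mul_comm (l C'),
          ← hcons C hC C' (h𝓑𝓐 _ hCA.1) _ (hl C'), Finset.union_eq_left.2 hCA.2]
      rw [Finset.union_self, ← h3]
      have : g A * g A * density φ A = u * u * density φ A
          + (2 : ℝ) • (u * (∑ C ∈ 𝓒, l C) * density φ A)
          + (∑ C ∈ 𝓒, l C) * (∑ C ∈ 𝓒, l C) * density φ A := by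
        rw [hgA]
        ext x
        simp only [Pi.mul_apply, Pi.add_apply, Pi.smul_apply, smul_eq_mul]
        ring
      rw [this, mean_add, mean_add, mean_smul, h2]
      ring
    -- The projected part is absorbed into the functions on the smaller sets; the form becomes the
    -- square of `u` plus the form of `g + l'` on `𝓑`.
    have hrest := ih 𝓑 (Finset.erase_ssubset hA) (fun B hB => htight B (h𝓑𝓐 B hB))
      (fun B hB C hC => hcard B (h𝓑𝓐 B hB) C (h𝓑𝓐 C hC))
      (fun B hB C hC => by
        refine Finset.mem_erase.2 ⟨fun h => ?_, hinter B (h𝓑𝓐 B hB) C (h𝓑𝓐 C hC)⟩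
        have hsub : A ⊆ B := h ▸ Finset.inter_subset_left
        exact (Finset.mem_erase.1 hB).1
          (Finset.eq_of_subset_of_card_le hsub (hmax B (h𝓑𝓐 B hB))).symm)
      (fun B => g B + l' B) (fun B => (juntas Ω B).add_mem (hg B) (hl'd B))
    have huu : 0 ≤ mean (u * u * density φ A) :=
      mean_nonneg fun x => mul_nonneg (mul_self_nonneg (u x)) (density_nonneg hφ A x)
    have hexp : ∑ B ∈ 𝓑, ∑ C ∈ 𝓑, mean ((g B + l' B) * (g C + l' C) * density φ (B ∪ C))
        = ∑ B ∈ 𝓑, ∑ C ∈ 𝓑, mean (g B * g C * density φ (B ∪ C))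
          + 2 * ∑ B ∈ 𝓑, ∑ C ∈ 𝓑, mean (l' C * g B * density φ (C ∪ B))
          + ∑ B ∈ 𝓑, ∑ C ∈ 𝓑, mean (l' B * l' C * density φ (B ∪ C)) := by
      have h4 : ∑ B ∈ 𝓑, ∑ C ∈ 𝓑, mean (l' B * g C * density φ (B ∪ C))
          = ∑ B ∈ 𝓑, ∑ C ∈ 𝓑, mean (l' C * g B * density φ (C ∪ B)) := Finset.sum_comm
      rw [two_mul]
      nth_rewrite 1 [← h4]
      simp only [← Finset.sum_add_distrib]
      refine Finset.sum_congr rfl fun B _ => Finset.sum_congr rfl fun C _ => ?_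
      rw [Finset.union_comm C B, ← mean_add, ← mean_add, ← mean_add]
      congr 1
      ring
    have htotal : ∑ B ∈ 𝓐, ∑ C ∈ 𝓐, mean (g B * g C * density φ (B ∪ C))
        = mean (g A * g A * density φ (A ∪ A))
          + 2 * ∑ B ∈ 𝓑, mean (g A * g B * density φ (A ∪ B))
          + ∑ B ∈ 𝓑, ∑ C ∈ 𝓑, mean (g B * g C * density φ (B ∪ C)) := by
      rw [← Finset.add_sum_erase _ _ hA, ← Finset.add_sum_erase _ _ hA]
      have : ∀ B ∈ 𝓑, ∑ C ∈ 𝓐, mean (g B * g C * density φ (B ∪ C))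
          = mean (g A * g B * density φ (A ∪ B))
            + ∑ C ∈ 𝓑, mean (g B * g C * density φ (B ∪ C)) := by
        intro B _
        rw [← Finset.add_sum_erase _ _ hA, mul_comm (g B), Finset.union_comm B]
      rw [Finset.sum_congr rfl this, Finset.sum_add_distrib]
      ring
    rw [htotal, hdiag, Finset.sum_congr rfl hmix]
    rw [hexp] at hrest
    linarith

end Positivity

/-! ### Polynomials as functions of assignments -/

section Evaluation

variable {V Ω : Type*}

/-- The polynomials in the indicators of the variables in `A`. -/
abbrev polysOn (Ω : Type*) (A : Finset V) : Subalgebra ℝ (MvPolynomial (V × Ω) ℝ) :=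
  MvPolynomial.supported ℝ {p : V × Ω | p.1 ∈ A}

lemma polysOn_mono {A B : Finset V} (h : A ⊆ B) : polysOn Ω A ≤ polysOn Ω B :=
  MvPolynomial.supported_mono fun _ hp => h hp

section

variable [DecidableEq V]

/-- The variables that occur in a monomial. -/
def monomialVars (e : V × Ω →₀ ℕ) : Finset V :=
  e.support.image Prod.fst

lemma card_monomialVars_le (e : V × Ω →₀ ℕ) : (monomialVars e).card ≤ e.sum fun _ k => k := by
  refine Finset.card_image_le.trans ?_
  rw [Finsupp.sum, Finset.card_eq_sum_ones]
  exact Finset.sum_le_sum fun i hi => Nat.one_le_iff_ne_zero.2 (Finsupp.mem_support_iff.1 hi)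

lemma monomial_mem_polysOn {A : Finset V} {e : V × Ω →₀ ℕ} (h : monomialVars e ⊆ A) (c : ℝ) :
    MvPolynomial.monomial e c ∈ polysOn Ω A := by
  rw [MvPolynomial.mem_supported]
  intro p hp
  rw [Finset.mem_coe, MvPolynomial.mem_vars_iff_mem_support] at hp
  obtain ⟨d, hd, hpd⟩ := hp
  rw [Finset.mem_singleton.1 (MvPolynomial.support_monomial_subset hd)] at hpd
  exact h (Finset.mem_image_of_mem _ hpd)

lemma monomialVars_subset {A : Finset V} {p : MvPolynomial (V × Ω) ℝ} (hp : p ∈ polysOn Ω A)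
    {e : V × Ω →₀ ℕ} (he : e ∈ p.support) : monomialVars e ⊆ A := by
  rw [MvPolynomial.mem_supported] at hp
  intro i hi
  obtain ⟨q, hq, rfl⟩ := Finset.mem_image.1 hi
  exact hp ((MvPolynomial.mem_vars_iff_mem_support _).2 ⟨e, he, hq⟩)

end

variable [DecidableEq Ω]

/-- The function on assignments given by a polynomial in the indicators. -/
def evalFun : MvPolynomial (V × Ω) ℝ →ₐ[ℝ] ((V → Ω) → ℝ) :=
  MvPolynomial.aeval fun p x => if x p.1 = p.2 then 1 else 0

lemma evalFun_X (i : V) (c : Ω) (x : V → Ω) :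
    evalFun (MvPolynomial.X (i, c)) x = if x i = c then 1 else 0 := by
  simp [evalFun]

lemma dependsOn_evalFun {A : Finset V} {p : MvPolynomial (V × Ω) ℝ} (hp : p ∈ polysOn Ω A) :
    DependsOn (evalFun p) (A : Set V) := by
  intro x y hxy
  induction hp using Algebra.adjoin_induction with
  | mem p hp =>
    obtain ⟨⟨i, c⟩, hi, rfl⟩ := hp
    rw [evalFun_X, evalFun_X, hxy i hi]
  | algebraMap r => simp
  | add p q _ _ h1 h2 => simp [h1, h2]
  | mul p q _ _ h1 h2 => simp [h1, h2]

end Evaluation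

/-! ### The pseudoexpectation defined by the local densities -/

section Pseudoexpectation

variable {V Ω F : Type*} [Fintype V] [DecidableEq V] [Fintype Ω] [Fintype F]

variable {t : ℕ} {N : F → Finset V} {φ : F → (V → Ω) → ℝ} {η : ℝ} {b D : ℕ}

/-- The parameters of an instance for which local densities define a pseudoexpectation of
degree `D`. -/
structure IsPlausible (t : ℕ) (N : F → Finset V) (φ : F → (V → Ω) → ℝ) (η : ℝ) (b D : ℕ) :
    Prop where
  wise : IsWiseDensity t N φ
  expanding : IsExpanding t N η b
  pos : 0 < η
  le_one : η ≤ 1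
  degree_le : 4 * (D : ℝ) ≤ η * b

namespace IsPlausible

lemma four_mul_le (h : IsPlausible t N φ η b D) : 4 * D ≤ b := by
  have h1 := h.degree_le
  have h2 : η * b ≤ 1 * b := mul_le_mul_of_nonneg_right h.le_one (Nat.cast_nonneg b)
  have h3 : (4 : ℝ) * D ≤ b := by linarith
  exact_mod_cast h3

/-- Expansion turns a weight bound into a size bound: `η * |M| ≤ 2D ≤ η * b / 2`. The factor one
half leaves room for unions of two such sets. -/
lemma card_le_of_weight_le (h : IsPlausible t N φ η b D) {M : Finset V} (hM : M.card ≤ b) (hw : weight t N M ≤ 2 * D) :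
    2 * M.card ≤ b := by
  have h1 := h.expanding M hM
  have h2 : (weight t N M : ℝ) ≤ 2 * D := by exact_mod_cast hw
  have h3 := h.degree_le
  have h4 : η * (2 * (M.card : ℝ)) ≤ η * b := by linarith
  exact_mod_cast le_of_mul_le_mul_left h4 h.pos

lemma weight_nonneg (h : IsPlausible t N φ η b D) {M : Finset V} (hM : M.card ≤ b) : 0 ≤ weight t N M := by
  have h1 := h.expanding M hM
  have h2 : 0 ≤ η * (M.card : ℝ) := mul_nonneg h.pos.le (Nat.cast_nonneg _)
  exact_mod_cast h2.trans h1

lemma card_closure_le (h : IsPlausible t N φ η b D) {S : Finset V} (hS : S.card ≤ D) : 2 * (closure t N b S).card ≤ b := by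
  have hSb : S.card ≤ b := by have := h.four_mul_le; omega
  refine h.card_le_of_weight_le (closure_card_le hSb) ?_
  have h1 := weight_closure_le (t := t) (N := N) (subset_refl S) hSb
  have h2 := weight_le (t := t) (N := N) S
  have h3 : (S.card : ℤ) ≤ D := by exact_mod_cast hS
  linarith

end IsPlausible

variable [DecidableEq Ω]

/-- The expectation of a monomial is taken with respect to the density on the closure of its set of
variables. -/
def pseudoExp (t : ℕ) (N : F → Finset V) (φ : F → (V → Ω) → ℝ) (b : ℕ) :
    MvPolynomial (V × Ω) ℝ →ₗ[ℝ] ℝ :=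
  (MvPolynomial.basisMonomials _ ℝ).constr ℝ fun e =>
    mean (evalFun (MvPolynomial.monomial e 1) * density φ (closure t N b (monomialVars e)))

lemma pseudoExp_monomial (e : V × Ω →₀ ℕ) (c : ℝ) :
    pseudoExp t N φ b (MvPolynomial.monomial e c) =
      mean (evalFun (MvPolynomial.monomial e c) * density φ (closure t N b (monomialVars e))) := by
  have h1 : MvPolynomial.monomial e c = c • (MvPolynomial.monomial e (1 : ℝ)) := by
    rw [MvPolynomial.smul_monomial, smul_eq_mul, mul_one]
  have h2 : pseudoExp t N φ b (MvPolynomial.monomial e 1) =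
      mean (evalFun (MvPolynomial.monomial e 1) *
        density φ (closure t N b (monomialVars e))) := by
    have := (MvPolynomial.basisMonomials (V × Ω) ℝ).constr_basis ℝ (fun e =>
      mean (evalFun (MvPolynomial.monomial e 1) * density φ (closure t N b (monomialVars e)))) e
    rwa [MvPolynomial.coe_basisMonomials] at this
  rw [h1, map_smul, map_smul, smul_mul_assoc, mean_smul, h2, smul_eq_mul]

namespace IsPlausible

variable [Nonempty Ω]

/-- The closure of each monomial lies inside `A` by `closure_subset`, and the remaining variables of
`A` are eliminated. Thus any tight set of moderate size may replace the individual closures. -/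
lemma pseudoExp_eq (h : IsPlausible t N φ η b D) {A : Finset V} (hA : IsTight t N b A) (hcard : 2 * A.card ≤ b)
    {p : MvPolynomial (V × Ω) ℝ} (hp : p ∈ polysOn Ω A) (hdeg : p.totalDegree ≤ D) :
    pseudoExp t N φ b p = mean (evalFun p * density φ A) := by
  rw [p.as_sum, map_sum, map_sum, mean_sum_mul]
  refine Finset.sum_congr rfl fun e he => ?_
  rw [pseudoExp_monomial]
  have hvars := monomialVars_subset hp he
  have hle : (monomialVars e).card ≤ D :=
    (card_monomialVars_le e).trans ((MvPolynomial.le_totalDegree he).trans hdeg)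
  have hcl := h.card_closure_le hle
  have hb := h.four_mul_le
  have hsub : closure t N b (monomialVars e) ⊆ A :=
    closure_subset hA hvars ((Finset.card_union_le _ _).trans (by omega))
  refine (mean_mul_density_of_isTight h.wise (closure_isTight (by omega)) hsub (by omega)
    (dependsOn_evalFun (monomial_mem_polysOn (subset_closure b _) _))).symm

/-- Submodularity and nonnegativity of the weight of `A ∩ B` bound the weight of the union by `4d ≤
2D`, so its closure is still small; from there the variables outside `A ∪ B` are eliminated. -/
lemma pseudoExp_eq_union (h : IsPlausible t N φ η b D) {A B : Finset V} (hA : IsTight t N b A) (hB : IsTight t N b B)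
    (hAb : A.card ≤ b) (hBb : B.card ≤ b) {d : ℕ} (hd : 2 * d ≤ D)
    (hAw : weight t N A ≤ 2 * d) (hBw : weight t N B ≤ 2 * d)
    {p : MvPolynomial (V × Ω) ℝ} (hp : p ∈ polysOn Ω (A ∪ B)) (hdeg : p.totalDegree ≤ D) :
    pseudoExp t N φ b p = mean (evalFun p * density φ (A ∪ B)) := by
  have hd' : (2 * d : ℤ) ≤ D := by exact_mod_cast hd
  have hD : (0 : ℤ) ≤ D := Int.natCast_nonneg D
  have h1 := h.card_le_of_weight_le hAb (by linarith)
  have h2 := h.card_le_of_weight_le hBb (by linarith)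
  have hun : (A ∪ B).card ≤ b := (Finset.card_union_le _ _).trans (by omega)
  have h3 := weight_union_add_weight_inter (t := t) (N := N) A B
  have h4 := h.weight_nonneg (M := A ∩ B)
    ((Finset.card_le_card Finset.inter_subset_left).trans hAb)
  have h5 := weight_closure_le (t := t) (N := N) (subset_refl (A ∪ B)) hun
  have h6 := h.card_le_of_weight_le (closure_card_le (t := t) (N := N) hun) (by linarith)
  rw [h.pseudoExp_eq (closure_isTight hun) h6 (polysOn_mono (subset_closure b _) hp) hdeg]
  exact mean_mul_density_union h.wise hA hB (Finset.subset_union_left.trans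
    (subset_closure b _)) (Finset.subset_union_right.trans (subset_closure b _))
    (closure_card_le hun) (dependsOn_evalFun hp)

lemma pseudoExp_one (h : IsPlausible t N φ η b D) : pseudoExp t N φ b 1 = 1 := by
  have hw0 : weight t N ∅ = 0 := by
    simp only [weight, Finset.card_empty, Finset.inter_empty]
    rw [Finset.sum_eq_zero fun f _ => max_eq_right (by push_cast; linarith)]
    simp
  have htight : IsTight t N b ∅ := by
    intro X hX hXb
    have h1 := h.expanding X hXb
    have h2 : 0 < X.card := Finset.card_pos.2 (Finset.empty_ssubset.1 hX)
    have h3 : 0 < η * (X.card : ℝ) := mul_pos h.pos (by exact_mod_cast h2)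
    rw [hw0]
    exact_mod_cast h3.trans_le h1
  rw [h.pseudoExp_eq htight (by simp) (one_mem _) (by simp), map_one, one_mul]
  have : density φ (∅ : Finset V) = 1 :=
    Finset.prod_eq_one fun f _ => h.wise.avg_eq_one f ∅ (by simp)
  rw [this]
  exact mean_const 1

/-- Grouping the monomials of `p` by their closures turns the value on `p ^ 2` into the quadratic
form of `sum_mean_mul_density_nonneg`. The family used consists of all tight sets of weight at most
`2d`, which is closed under intersection. -/
lemma pseudoExp_sq_nonneg (h : IsPlausible t N φ η b D) (p : MvPolynomial (V × Ω) ℝ) (hp : 2 * p.totalDegree ≤ D) :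
    0 ≤ pseudoExp t N φ b (p ^ 2) := by
  classical
  set d := p.totalDegree with hd
  have hb := h.four_mul_le
  set 𝓐 : Finset (Finset V) := Finset.univ.filter fun A =>
    IsTight t N b A ∧ A.card ≤ b ∧ weight t N A ≤ 2 * d with h𝓐
  have hmem : ∀ A, A ∈ 𝓐 ↔ IsTight t N b A ∧ A.card ≤ b ∧ weight t N A ≤ 2 * d := by
    simp [h𝓐]
  have hd' : (2 * d : ℤ) ≤ D := by exact_mod_cast hp
  have hhalf : ∀ A ∈ 𝓐, 2 * A.card ≤ b := by
    intro A hA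
    rw [hmem] at hA
    exact h.card_le_of_weight_le hA.2.1 (by have := hA.2.2; linarith)
  have hunion : ∀ A ∈ 𝓐, ∀ B ∈ 𝓐, (A ∪ B).card ≤ b := by
    intro A hA B hB
    have h1 := hhalf A hA
    have h2 := hhalf B hB
    exact (Finset.card_union_le _ _).trans (by omega)
  have hinter : ∀ A ∈ 𝓐, ∀ B ∈ 𝓐, A ∩ B ∈ 𝓐 := by
    intro A hA B hB
    have hA' := (hmem A).1 hA
    have hB' := (hmem B).1 hB
    -- By tightness the union weighs at least as much as `A`, so submodularity leaves the
    -- intersection at most the weight of `B`.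
    have hwle : weight t N (A ∩ B) ≤ 2 * d := by
      have h1 := weight_union_add_weight_inter (t := t) (N := N) A B
      have h2 : weight t N A ≤ weight t N (A ∪ B) := by
        rcases (Finset.subset_union_left (s₁ := A) (s₂ := B)).eq_or_ssubset with he | hs
        · rw [← he]
        · exact (hA'.1 _ hs (hunion A hA B hB)).le
      have := hB'.2.2
      linarith
    have hib : (A ∩ B).card ≤ b := (Finset.card_le_card Finset.inter_subset_left).trans hA'.2.1
    have hcw := weight_closure_le (t := t) (N := N) (subset_refl (A ∩ B)) hib
    have hch := h.card_le_of_weight_le (closure_card_le (t := t) (N := N) hib) (by linarith)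
    have hcA := closure_subset hA'.1 (Finset.inter_subset_left (s₂ := B))
      ((Finset.card_union_le _ _).trans (by have := hhalf A hA; omega))
    have hcB := closure_subset hB'.1 (Finset.inter_subset_right (s₁ := A))
      ((Finset.card_union_le _ _).trans (by have := hhalf B hB; omega))
    -- The closure lies in both tight sets, so the intersection is its own closure and therefore
    -- tight.
    have heq : closure t N b (A ∩ B) = A ∩ B :=
      Finset.Subset.antisymm (Finset.subset_inter hcA hcB) (subset_closure b _)
    refine (hmem _).2 ⟨?_, hib, hwle⟩
    have := closure_isTight (t := t) (N := N) hib
    rwa [heq] at this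
  have hdeg : ∀ e ∈ p.support, (monomialVars e).card ≤ d := fun e he =>
    (card_monomialVars_le e).trans (MvPolynomial.le_totalDegree he)
  have hcl : ∀ e ∈ p.support, closure t N b (monomialVars e) ∈ 𝓐 := by
    intro e he
    have h1 := hdeg e he
    have h2 : (monomialVars e).card ≤ b := by omega
    refine (hmem _).2 ⟨closure_isTight h2, closure_card_le h2, ?_⟩
    have h3 := weight_closure_le (t := t) (N := N) (subset_refl (monomialVars e)) h2
    have h4 := weight_le (t := t) (N := N) (monomialVars e)
    have h5 : ((monomialVars e).card : ℤ) ≤ d := by exact_mod_cast h1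
    linarith
  set q : Finset V → MvPolynomial (V × Ω) ℝ := fun A =>
    ∑ e ∈ p.support with closure t N b (monomialVars e) = A,
      MvPolynomial.monomial e (p.coeff e) with hq
  have hpq : p = ∑ A ∈ 𝓐, q A := by
    conv_lhs => rw [p.as_sum]
    exact (Finset.sum_fiberwise_of_maps_to hcl _).symm
  have hqA : ∀ A, q A ∈ polysOn Ω A := by
    intro A
    refine Subalgebra.sum_mem _ fun e he => monomial_mem_polysOn ?_ _
    rw [← (Finset.mem_filter.1 he).2]
    exact subset_closure b _
  have hqd : ∀ A, (q A).totalDegree ≤ d := by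
    intro A
    refine MvPolynomial.totalDegree_finsetSum_le fun e he => ?_
    exact (MvPolynomial.totalDegree_monomial_le _ _).trans
      (MvPolynomial.le_totalDegree (Finset.mem_filter.1 he).1)
  have hE : ∀ A ∈ 𝓐, ∀ B ∈ 𝓐, pseudoExp t N φ b (q A * q B)
      = mean (evalFun (q A) * evalFun (q B) * density φ (A ∪ B)) := by
    intro A hA B hB
    have hA' := (hmem A).1 hA
    have hB' := (hmem B).1 hB
    rw [h.pseudoExp_eq_union hA'.1 hB'.1 hA'.2.1 hB'.2.1 hp hA'.2.2 hB'.2.2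
      (mul_mem (polysOn_mono Finset.subset_union_left (hqA A))
        (polysOn_mono Finset.subset_union_right (hqA B))), map_mul]
    refine (MvPolynomial.totalDegree_mul _ _).trans ?_
    have h1 := hqd A
    have h2 := hqd B
    omega
  have hsq : pseudoExp t N φ b (p ^ 2)
      = ∑ A ∈ 𝓐, ∑ B ∈ 𝓐, mean (evalFun (q A) * evalFun (q B) * density φ (A ∪ B)) := by
    rw [hpq, sq, Finset.sum_mul_sum, map_sum]
    refine Finset.sum_congr rfl fun A hA => ?_
    rw [map_sum]
    exact Finset.sum_congr rfl fun B hB => hE A hA B hB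
  rw [hsq]
  exact sum_mean_mul_density_nonneg h.wise 𝓐 (fun A hA => ((hmem A).1 hA).1) hunion hinter
    (fun A => evalFun (q A)) fun A => dependsOn_evalFun (hqA A)

/-- Polynomials in the indicators of one variable that vanish on all assignments are satisfied as
identities. -/
lemma satisfiesIdentity (h : IsPlausible t N φ η b D) {i : V} {q : MvPolynomial (V × Ω) ℝ} (hq : q ∈ polysOn Ω {i})
    (hq0 : evalFun q = 0) : SatisfiesIdentity D (pseudoExp t N φ b) q := by
  intro r hr
  by_cases hq1 : q = 0
  · simp [hq1]
  by_cases hr1 : r = 0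
  · simp [hr1]
  -- A nonzero constant does not vanish on assignments. The degree of `q` is thus at least one,
  -- which pays for adding `i` to the variables of a monomial of `r`.
  have hdeg : q.totalDegree ≠ 0 := by
    intro h0
    rw [MvPolynomial.totalDegree_eq_zero_iff_eq_C] at h0
    rw [h0] at hq0
    have := congrFun hq0 (Classical.arbitrary _)
    simp only [evalFun, MvPolynomial.aeval_C, Pi.algebraMap_apply, Algebra.algebraMap_self,
      RingHom.id_apply, Pi.zero_apply] at this
    rw [this, map_zero] at h0
    exact hq1 h0
  rw [MvPolynomial.totalDegree_mul_of_isDomain hq1 hr1] at hr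
  rw [r.as_sum, Finset.mul_sum, map_sum]
  refine Finset.sum_eq_zero fun e he => ?_
  have hle := MvPolynomial.le_totalDegree he
  have hS : (insert i (monomialVars e)).card ≤ D := by
    have h1 := Finset.card_insert_le i (monomialVars e)
    have h2 := card_monomialVars_le e
    omega
  have hb := h.four_mul_le
  have hsub := subset_closure (t := t) (N := N) b (insert i (monomialVars e))
  rw [h.pseudoExp_eq (closure_isTight (by omega)) (h.card_closure_le hS)
    (mul_mem (polysOn_mono ?_ hq) (monomial_mem_polysOn ?_ _)), map_mul, hq0, zero_mul, zero_mul,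
    mean_zero]
  · have h1 := MvPolynomial.totalDegree_mul q (MvPolynomial.monomial e (r.coeff e))
    have h2 := MvPolynomial.totalDegree_monomial_le e (r.coeff e)
    change _ ≤ e.sum fun _ k => k at h2
    omega
  · exact (Finset.singleton_subset_iff.2 (Finset.mem_insert_self _ _)).trans hsub
  · exact (Finset.subset_insert _ _).trans hsub

end IsPlausible

/-- The local densities of a plausible instance define a pseudoexpectation on assignments. -/
theorem IsPlausible.isAssignmentPseudoexpectation [Nonempty Ω] {n : ℕ} {N : F → Finset (Fin n)}
    {φ : F → (Fin n → Ω) → ℝ} (h : IsPlausible t N φ η b D) :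
    IsAssignmentPseudoexpectation D (pseudoExp t N φ b) where
  map_one := h.pseudoExp_one
  sq_nonneg := h.pseudoExp_sq_nonneg
  sum_eq_one := fun i => by
    refine h.satisfiesIdentity (i := i) (sub_mem (Subalgebra.sum_mem _ fun c _ =>
      MvPolynomial.X_mem_supported.2 (Finset.mem_singleton_self i)) (one_mem _)) ?_
    ext x
    simp [evalFun_X]
  sq_eq_self := fun i c => by
    have hX : (MvPolynomial.X (i, c) : MvPolynomial (Fin n × Ω) ℝ) ∈ polysOn Ω {i} :=
      MvPolynomial.X_mem_supported.2 (Finset.mem_singleton_self i)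
    refine h.satisfiesIdentity (i := i) (sub_mem (pow_mem hX 2) hX) ?_
    ext x
    simp [evalFun_X]

end Pseudoexpectation

/-! ### Constraints -/

section Constraint

variable {n k : ℕ} {Ω : Type*} {L : Finset (Equiv.Perm Ω)}

/-- The set of variables of a constraint. -/
def Constraint.scope (c : Constraint n k L) : Finset (Fin n) :=
  Finset.univ.map c.1

/-- The values of the literals of a constraint under an assignment. -/
def Constraint.read (c : Constraint n k L) (x : Fin n → Ω) : Fin k → Ω :=
  fun j => (c.2 j : Equiv.Perm Ω) (x (c.1 j))

lemma Constraint.card_scope (c : Constraint n k L) : (Constraint.scope c).card = k := by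
  simp [Constraint.scope]

lemma Constraint.mem_scope (c : Constraint n k L) (j : Fin k) : c.1 j ∈ Constraint.scope c := by
  simp [Constraint.scope]

lemma Constraint.dependsOn_read (c : Constraint n k L) (G : (Fin k → Ω) → ℝ) :
    DependsOn (fun x => G (Constraint.read c x)) (Constraint.scope c : Set (Fin n)) := by
  intro x y hxy
  simp only
  congr 1
  ext j
  simp only [Constraint.read]
  rw [hxy _ (Constraint.mem_scope c j)]

variable [Fintype Ω]

/-- Swapping the values read by the constraint with an independent `y` is an involution on pairs, so
the values read are uniform. -/
lemma Constraint.mean_read [Nonempty Ω] (c : Constraint n k L) (G : (Fin k → Ω) → ℝ) :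
    mean (fun x => G (Constraint.read c x)) = mean G := by
  classical
  let put : (Fin k → Ω) → (Fin n → Ω) → Fin n → Ω := fun y x =>
    Function.extend c.1 (fun j => (c.2 j : Equiv.Perm Ω).symm (y j)) x
  have h1 : ∀ x y, Constraint.read c (put y x) = y := by
    intro x y
    ext j
    simp [Constraint.read, put, c.1.injective.extend_apply]
  have h2 : ∀ x y, put (Constraint.read c x) (put y x) = x := by
    intro x y
    ext i
    by_cases hi : ∃ j, c.1 j = i
    · obtain ⟨j, rfl⟩ := hi
      simp [Constraint.read, put, c.1.injective.extend_apply]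
    · simp [put, Function.extend_apply' _ _ _ hi]
  let e : ((Fin n → Ω) × (Fin k → Ω)) ≃ ((Fin n → Ω) × (Fin k → Ω)) :=
    { toFun := fun p => (put p.2 p.1, Constraint.read c p.1)
      invFun := fun p => (put p.2 p.1, Constraint.read c p.1)
      left_inv := fun p => by simp [h1, h2]
      right_inv := fun p => by simp [h1, h2] }
  have he := Equiv.sum_comp e (fun p : (Fin n → Ω) × (Fin k → Ω) => G p.2)
  rw [Fintype.sum_prod_type, Fintype.sum_prod_type] at he
  simp only [e, Equiv.coe_fn_mk, Finset.sum_const, nsmul_eq_mul, Finset.card_univ,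
    ← Finset.mul_sum] at he
  unfold mean
  have hn : (Fintype.card (Fin n → Ω) : ℝ) ≠ 0 := card_fun_ne_zero
  have hk : (Fintype.card (Fin k → Ω) : ℝ) ≠ 0 := card_fun_ne_zero
  field_simp
  linarith

lemma Constraint.avg_read [Nonempty Ω] (c : Constraint n k L) (G : (Fin k → Ω) → ℝ)
    (A : Finset (Fin n)) (x : Fin n → Ω) :
    avg A (fun x => G (Constraint.read c x)) x =
      avg (Finset.univ.filter fun j => c.1 j ∈ A) G (Constraint.read c x) := by
  have h : ∀ y, Constraint.read c (A.piecewise x y) =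
      (Finset.univ.filter fun j => c.1 j ∈ A).piecewise (Constraint.read c x)
        (Constraint.read c y) := by
    intro y
    ext j
    by_cases hj : c.1 j ∈ A <;> simp [Constraint.read, hj]
  have := Constraint.mean_read c (fun z =>
    G ((Finset.univ.filter fun j => c.1 j ∈ A).piecewise (Constraint.read c x) z))
  simp only [avg, h]
  exact this

/-- The density, relative to the uniform distribution on assignments, of the distribution `μ` on
the values of the literals of a constraint. -/
def Constraint.density (μ : (Fin k → Ω) → ℝ) (c : Constraint n k L) (x : Fin n → Ω) : ℝ :=
  Fintype.card (Fin k → Ω) * μ (Constraint.read c x)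

lemma card_filter_eq_on [DecidableEq Ω] (T : Finset (Fin k)) (a : Fin k → Ω) :
    (Finset.univ.filter fun y : Fin k → Ω => ∀ i : T, y i = a i).card
      = Fintype.card Ω ^ (k - T.card) := by
  have e : (Finset.univ.filter fun y : Fin k → Ω => ∀ i : T, y i = a i)
      = Fintype.piFinset fun i => if i ∈ T then {a i} else Finset.univ := by
    ext y
    simp only [Finset.mem_filter, Finset.mem_univ, true_and, Fintype.mem_piFinset,
      Subtype.forall]
    refine forall_congr' fun i => ?_
    split_ifs with hi <;> simp [hi]
  rw [e, Fintype.card_piFinset]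
  have e2 : ∀ i, (if i ∈ T then ({a i} : Finset Ω) else Finset.univ).card
      = if i ∈ T then 1 else Fintype.card Ω := by
    intro i
    split_ifs <;> simp
  simp only [e2]
  rw [Finset.prod_ite, Finset.prod_const_one, one_mul, Finset.prod_const]
  congr 1
  have := Finset.card_compl T
  rw [Fintype.card_fin] at this
  rw [← this]
  congr 1
  ext i
  simp

/-- `T` is enlarged to exactly `t` coordinates, where the marginal is uniform by hypothesis;
averaging the resulting constant again handles the smaller set. -/
lemma avg_of_isWiseUniform [DecidableEq Ω] [Nonempty Ω] {t : ℕ} (htk : t ≤ k)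
    {μ : (Fin k → Ω) → ℝ} (hμ : IsWiseUniform t μ) {T : Finset (Fin k)} (hT : T.card ≤ t)
    (a : Fin k → Ω) : avg T μ a = (Fintype.card (Fin k → Ω) : ℝ)⁻¹ := by
  classical
  obtain ⟨T', hTT', hT'⟩ := Finset.exists_superset_card_eq hT (by simpa using htk)
  have hq : (Fintype.card Ω : ℝ) ≠ 0 := by exact_mod_cast Fintype.card_ne_zero
  have main : ∀ a : Fin k → Ω, ∑ z, μ (T'.piecewise a z) = 1 := by
    intro a
    have h1 := sum_sum_piecewise T' (fun y => if ∀ i : T', y i = a i then μ y else 0)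
    have h2 : ∀ y z : Fin k → Ω,
        (if ∀ i : T', T'.piecewise y z i = a i then μ (T'.piecewise y z) else 0)
          = if ∀ i : T', y i = a i then μ (T'.piecewise a z) else 0 := by
      intro y z
      have e : (∀ i : T', T'.piecewise y z i = a i) ↔ ∀ i : T', y i = a i :=
        forall_congr' fun i => by rw [Finset.piecewise_eq_of_mem _ _ _ i.2]
      simp only [e]
      split_ifs with hy
      · congr 1
        ext i
        by_cases hi : i ∈ T'
        · simpa [hi] using hy ⟨i, hi⟩
        · simp [hi]
      · rfl
    simp only [h2] at h1
    rw [← Finset.sum_filter (fun y : Fin k → Ω => ∀ i : T', y i = a i) μ,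
      hμ T' hT' (fun i => a i)] at h1
    have h3 : ∀ y : Fin k → Ω,
        (∑ z, if ∀ i : T', y i = a i then μ (T'.piecewise a z) else 0)
          = if ∀ i : T', y i = a i then ∑ z, μ (T'.piecewise a z) else 0 := by
      intro y
      split_ifs <;> simp
    simp only [h3] at h1
    rw [← Finset.sum_filter, Finset.sum_const, nsmul_eq_mul] at h1
    have hcard := card_filter_eq_on T' a
    rw [hT'] at hcard
    rw [hcard, Fintype.card_fun, Fintype.card_fin] at h1
    push_cast at h1
    have h4 : (Fintype.card Ω : ℝ) ^ k = (Fintype.card Ω : ℝ) ^ (k - t) * Fintype.card Ω ^ t := by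
      rw [← pow_add, Nat.sub_add_cancel htk]
    rw [h4, mul_assoc, mul_inv_cancel₀ (pow_ne_zero _ hq)] at h1
    exact mul_left_cancel₀ (pow_ne_zero _ hq) h1
  have hconst : avg T' μ = fun _ => (Fintype.card (Fin k → Ω) : ℝ)⁻¹ := by
    ext a
    rw [avg, main a, mul_one]
  rw [← Finset.inter_eq_left.2 hTT', ← avg_avg, hconst]
  have := avg_of_dependsOn (A := T) (g := fun _ : Fin k → Ω => (Fintype.card (Fin k → Ω) : ℝ)⁻¹)
    (fun _ _ _ => rfl)
  rw [this]

lemma isWiseDensity_constraint [DecidableEq Ω] [Nonempty Ω] {m t : ℕ} (htk : t ≤ k)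
    {μ : (Fin k → Ω) → ℝ} (hμ0 : ∀ x, 0 ≤ μ x) (hμ : IsWiseUniform t μ)
    (I : CSPInstance n m k L) :
    IsWiseDensity t (fun f => Constraint.scope (I f)) (fun f => Constraint.density μ (I f)) where
  nonneg := fun f x => mul_nonneg (Nat.cast_nonneg _) (hμ0 _)
  dependsOn := fun f => Constraint.dependsOn_read (I f)
    fun y => (Fintype.card (Fin k → Ω) : ℝ) * μ y
  avg_eq_one := fun f A hA => by
    ext x
    have hT : (Finset.univ.filter fun j => (I f).1 j ∈ A).card ≤ t := by
      refine le_trans (le_of_eq ?_) hA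
      rw [← Finset.card_map (I f).1]
      congr 1
      ext i
      simp only [Constraint.scope, Finset.mem_map, Finset.mem_filter, Finset.mem_univ, true_and,
        Finset.mem_inter]
      constructor
      · rintro ⟨j, hj, rfl⟩
        exact ⟨⟨j, rfl⟩, hj⟩
      · rintro ⟨⟨j, rfl⟩, hj⟩
        exact ⟨j, hj, rfl⟩
    have h1 := Constraint.avg_read (I f) (fun y => (Fintype.card (Fin k → Ω) : ℝ) * μ y) A x
    have h2 := avg_of_isWiseUniform htk hμ hT (Constraint.read (I f) x)
    have h3 : avg (Finset.univ.filter fun j => (I f).1 j ∈ A)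
        (fun y => (Fintype.card (Fin k → Ω) : ℝ) * μ y) (Constraint.read (I f) x)
        = (Fintype.card (Fin k → Ω) : ℝ) * avg (Finset.univ.filter fun j => (I f).1 j ∈ A) μ
          (Constraint.read (I f) x) := by
      simp only [avg, ← Finset.mul_sum]
      ring
    refine h1.trans ?_
    rw [h3, h2, mul_inv_cancel₀ card_fun_ne_zero]
    rfl

lemma evalFun_poly [DecidableEq Ω] (P : (Fin k → Ω) → Bool) (c : Constraint n k L)
    (x : Fin n → Ω) :
    evalFun (Constraint.poly P c) x = if P (Constraint.read c x) = true then 1 else 0 := by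
  have h : ∀ a : Fin k → Ω, evalFun (∏ j, MvPolynomial.X (c.1 j, a j)) x
      = if (fun j => x (c.1 j)) = a then 1 else 0 := by
    intro a
    rw [map_prod, Finset.prod_apply]
    simp only [evalFun_X]
    by_cases ha : (fun j => x (c.1 j)) = a
    · subst ha
      simp
    · rw [if_neg ha]
      obtain ⟨j, hj⟩ := Function.ne_iff.1 ha
      exact Finset.prod_eq_zero (Finset.mem_univ j) (if_neg hj)
  rw [Constraint.poly, map_sum, Finset.sum_apply]
  simp only [h]
  rw [Finset.sum_ite_eq]
  simp only [Finset.mem_filter, Finset.mem_univ, true_and]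
  rfl

lemma poly_mem_polysOn [DecidableEq Ω] (P : (Fin k → Ω) → Bool) (c : Constraint n k L) :
    Constraint.poly P c ∈ polysOn Ω (Constraint.scope c) :=
  Subalgebra.sum_mem _ fun _ _ => Subalgebra.prod_mem _ fun j _ =>
    MvPolynomial.X_mem_supported.2 (Constraint.mem_scope c j)

lemma totalDegree_poly_le [DecidableEq Ω] (P : (Fin k → Ω) → Bool) (c : Constraint n k L) :
    (Constraint.poly P c).totalDegree ≤ k := by
  refine MvPolynomial.totalDegree_finsetSum_le fun a _ => ?_
  refine (MvPolynomial.totalDegree_finsetProd _ _).trans ?_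
  simp

/-- Pointwise, `σ` exceeds the part of `μ` on `P` by at most the positive part of `σ - μ`, and these
positive parts sum to the total variation distance. -/
lemma one_sub_tvDist_le {α : Type*} [Fintype α] {P : α → Bool} {μ σ : α → ℝ}
    (hμ : μ ∈ stdSimplex ℝ α) (hσ : σ ∈ stdSimplex ℝ α) (hP : ∀ x, P x = false → σ x = 0) :
    1 - tvDist μ σ ≤ ∑ x, if P x = true then μ x else 0 := by
  have h1 : ∀ x, σ x - (if P x = true then μ x else 0) ≤ (1 / 2) * (|μ x - σ x| + (σ x - μ x)) := by
    intro x
    split_ifs with h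
    · have := neg_le_abs (μ x - σ x)
      linarith
    · rw [hP x (by simpa using h)]
      have := le_abs_self (μ x - 0)
      linarith
  have h2 := Finset.sum_le_sum fun x (_ : x ∈ Finset.univ) => h1 x
  rw [Finset.sum_sub_distrib, ← Finset.mul_sum, Finset.sum_add_distrib, Finset.sum_sub_distrib,
    hσ.2, hμ.2] at h2
  unfold tvDist
  linarith

lemma tvDist_nonneg {α : Type*} [Fintype α] (μ σ : α → ℝ) : 0 ≤ tvDist μ σ :=
  mul_nonneg (by norm_num) (Finset.sum_nonneg fun _ _ => abs_nonneg _)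

end Constraint

/-! ### The value of the pseudoexpectation -/

section Value

variable {V F : Type*} [DecidableEq V] [Fintype F] {t : ℕ} {N : F → Finset V}

/-- All small sets containing the variables of `f` have weight more than `t`. -/
def IsIsolated (t : ℕ) (N : F → Finset V) (b : ℕ) (f : F) : Prop :=
  ∀ M, N f ⊆ M → M.card ≤ b → (t + 1 : ℤ) ≤ weight t N M

/-- A scope of size `k` weighs `2k - (2k - (t+1))` before the other constraints are subtracted.
Hence `IsIsolated` says that the scope has minimal weight among its small supersets. -/
lemma weight_scope_le {f : F} (hk : t + 1 ≤ 2 * (N f).card) : weight t N (N f) ≤ t + 1 := by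
  have h := Finset.single_le_sum (s := Finset.univ)
    (f := fun g => max (2 * ((N g ∩ N f).card : ℤ) - (t + 1)) 0)
    (fun g _ => le_max_right _ _) (Finset.mem_univ f)
  simp only [Finset.inter_self] at h
  unfold weight
  omega

/-- A second constraint with more than `t` variables in the scope would lower its weight by at least
`t + 1`. -/
lemma IsIsolated.card_inter_le {b : ℕ} {f g : F} (h : IsIsolated t N b f) (hb : (N f).card ≤ b)
    (hk : t + 1 ≤ 2 * (N f).card) (hgf : g ≠ f) : (N g ∩ N f).card ≤ t := by
  classical
  by_contra hcon
  have hsum := Finset.sum_le_sum_of_subset_of_nonneg (Finset.subset_univ {g, f})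
    (f := fun g => max (2 * ((N g ∩ N f).card : ℤ) - (t + 1)) 0)
    (fun g _ _ => le_max_right _ _)
  rw [Finset.sum_pair hgf] at hsum
  simp only [Finset.inter_self] at hsum
  have hw := h (N f) subset_rfl hb
  unfold weight at hw
  omega

/-- The scope is only known to have minimal weight, so the tightness argument leaves the case of
equality. There all `min` terms vanish: active constraints meeting `M \ N f` avoid `N f`, and `M \ N
f` alone would have weight at most zero, against expansion. -/
lemma IsIsolated.exists_eliminable {η : ℝ} {b : ℕ} {f : F} (h : IsIsolated t N b f)
    (hexp : IsExpanding t N η b) (hη : 0 < η) (hk : t + 1 ≤ 2 * (N f).card) {M : Finset V}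
    (hM : N f ⊂ M) (hMb : M.card ≤ b) : ∃ v ∈ M \ N f, Eliminable t N M v := by
  classical
  by_contra! hcon
  set G := Finset.univ.filter fun g => t < (N g ∩ M).card with hG
  have hmemG : ∀ g, g ∈ G ↔ t < (N g ∩ M).card := by simp [hG]
  have h1 := weight_le_weight_add (t := t) (N := N) hM.1 G (fun g hg => (hmemG g).1 hg)
  have h2 : ∑ v ∈ M \ N f, (2 : ℤ) ≤ ∑ v ∈ M \ N f, ((G.filter fun g => v ∈ N g).card : ℤ) :=
    Finset.sum_le_sum fun v hv => by exact_mod_cast two_le_card_of_not_eliminable (hcon v hv)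
  rw [Finset.sum_const, nsmul_eq_mul] at h2
  have h3 := weight_scope_le hk
  have h4 := h M hM.1 hMb
  have h5 : ∑ g ∈ G, (min (N g ∩ N f).card (N g ∩ (M \ N f)).card : ℤ) = 0 :=
    le_antisymm (by linarith) (Finset.sum_nonneg fun g _ => by positivity)
  have h6 : ∀ g ∈ G, ∀ v ∈ M \ N f, v ∈ N g → N g ∩ M = N g ∩ (M \ N f) := by
    intro g hg v hv hvg
    have h7 := (Finset.sum_eq_zero_iff_of_nonneg (fun g _ => by positivity)).1 h5 g hg
    have h8 : 0 < (N g ∩ (M \ N f)).card := Finset.card_pos.2 ⟨v, Finset.mem_inter.2 ⟨hvg, hv⟩⟩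
    have h9 : (N g ∩ N f).card = 0 := by omega
    rw [Finset.card_eq_zero] at h9
    ext u
    simp only [Finset.mem_inter, Finset.mem_sdiff]
    constructor
    · rintro ⟨hu1, hu2⟩
      refine ⟨hu1, hu2, fun hu3 => ?_⟩
      have : u ∈ N g ∩ N f := Finset.mem_inter.2 ⟨hu1, hu3⟩
      rw [h9] at this
      simp at this
    · rintro ⟨hu1, hu2, _⟩
      exact ⟨hu1, hu2⟩
  have hM' : (M \ N f).card ≤ b := (Finset.card_le_card Finset.sdiff_subset).trans hMb
  have h10 := weight_le_weight_add (t := t) (N := N) (Finset.empty_subset (M \ N f))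
    (Finset.univ.filter fun g => t < (N g ∩ (M \ N f)).card) (by simp)
  rw [Finset.sdiff_empty] at h10
  have h11 : ∑ v ∈ M \ N f, (2 : ℤ) ≤ ∑ v ∈ M \ N f,
      (((Finset.univ.filter fun g => t < (N g ∩ (M \ N f)).card).filter
        fun g => v ∈ N g).card : ℤ) := by
    refine Finset.sum_le_sum fun v hv => ?_
    have := two_le_card_of_not_eliminable (hcon v hv)
    have hsub : (G.filter fun g => v ∈ N g).card ≤ ((Finset.univ.filter fun g =>
        t < (N g ∩ (M \ N f)).card).filter fun g => v ∈ N g).card := by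
      refine Finset.card_le_card fun g hg => ?_
      rw [Finset.mem_filter] at hg ⊢
      refine ⟨?_, hg.2⟩
      rw [Finset.mem_filter, ← h6 g hg.1 v hv hg.2]
      exact ⟨Finset.mem_univ g, (hmemG g).1 hg.1⟩
    exact_mod_cast this.trans hsub
  rw [Finset.sum_const, nsmul_eq_mul] at h11
  have h12 : 0 ≤ ∑ g ∈ Finset.univ.filter fun g => t < (N g ∩ (M \ N f)).card,
      (min (N g ∩ ∅).card (N g ∩ (M \ N f)).card : ℤ) :=
    Finset.sum_nonneg fun g _ => by positivity
  have h13 := weight_le (t := t) (N := N) (∅ : Finset V)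
  rw [Finset.card_empty, Nat.cast_zero, mul_zero] at h13
  have h14 := hexp _ hM'
  have h15 : 0 < (M \ N f).card := Finset.card_pos.2 (Finset.sdiff_nonempty.2 hM.2)
  have h16 : 0 < η * ((M \ N f).card : ℝ) := mul_pos hη (by exact_mod_cast h15)
  have h17 : (weight t N (M \ N f) : ℝ) ≤ 0 := by
    have : weight t N (M \ N f) ≤ 0 := by linarith
    exact_mod_cast this
  linarith

end Value

/-! ### Pseudoexpectations of constraints and the criterion for non-refutation. -/

section Satisfied

variable {n m k t : ℕ} {Ω : Type*} [Fintype Ω] [DecidableEq Ω] [Nonempty Ω]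
  {L : Finset (Equiv.Perm Ω)} {μ : (Fin k → Ω) → ℝ} {η : ℝ} {b D : ℕ} {I : CSPInstance n m k L}

lemma pseudoExp_poly_nonneg
    (h : IsPlausible t (fun f => Constraint.scope (I f)) (fun f => Constraint.density μ (I f)) η b D)
    (hkD : k ≤ D) (P : (Fin k → Ω) → Bool) (f : Fin m) :
    0 ≤ pseudoExp t (fun f => Constraint.scope (I f)) (fun f => Constraint.density μ (I f)) b
      (Constraint.poly P (I f)) := by
  have hb := h.four_mul_le
  have hS : (Constraint.scope (I f)).card ≤ D := by rw [Constraint.card_scope]; exact hkD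
  rw [h.pseudoExp_eq (closure_isTight (by omega)) (h.card_closure_le hS)
    (polysOn_mono (subset_closure b _) (poly_mem_polysOn P (I f)))
    ((totalDegree_poly_le P (I f)).trans hkD)]
  refine mean_nonneg fun x => mul_nonneg ?_ (density_nonneg h.wise _ x)
  rw [evalFun_poly]
  split_ifs <;> norm_num

/-- The closure can be eliminated down to the scope, where only the constraint's own factor remains,
so the literals have exactly the law `μ`. -/
lemma pseudoExp_poly_of_isIsolated
    (h : IsPlausible t (fun f => Constraint.scope (I f)) (fun f => Constraint.density μ (I f)) η b D)
    (hkD : k ≤ D) (htk : t ≤ k) (ht : 1 ≤ t) (P : (Fin k → Ω) → Bool) {f : Fin m}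
    (hf : IsIsolated t (fun f => Constraint.scope (I f)) b f) :
    pseudoExp t (fun f => Constraint.scope (I f)) (fun f => Constraint.density μ (I f)) b
      (Constraint.poly P (I f)) = ∑ y, if P y = true then μ y else 0 := by
  have hb := h.four_mul_le
  have hS : (Constraint.scope (I f)).card ≤ D := by rw [Constraint.card_scope]; exact hkD
  have hk : t + 1 ≤ 2 * (Constraint.scope (I f)).card := by rw [Constraint.card_scope]; omega
  have hSb : (Constraint.scope (I f)).card ≤ b := by omega
  rw [h.pseudoExp_eq (closure_isTight hSb) (h.card_closure_le hS)
    (polysOn_mono (subset_closure b _) (poly_mem_polysOn P (I f)))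
    ((totalDegree_poly_le P (I f)).trans hkD),
    mean_mul_density_of_eliminable h.wise (subset_closure b _)
      (fun M h1 h2 => hf.exists_eliminable h.expanding h.pos hk h1
        ((Finset.card_le_card h2).trans (closure_card_le hSb)))
      (dependsOn_evalFun (poly_mem_polysOn P (I f)))]
  have hdens : density (fun f => Constraint.density μ (I f)) (Constraint.scope (I f))
      = Constraint.density μ (I f) := by
    unfold density
    rw [Finset.prod_eq_single f]
    · exact avg_of_dependsOn (h.wise.dependsOn f)
    · intro g _ hgf
      exact h.wise.avg_eq_one g _ (hf.card_inter_le hSb hk hgf)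
    · simp
  rw [hdens]
  set G : (Fin k → Ω) → ℝ := fun y => (if P y = true then (1 : ℝ) else 0) *
    (Fintype.card (Fin k → Ω) * μ y) with hG
  have hread : evalFun (Constraint.poly P (I f)) * Constraint.density μ (I f)
      = fun x => G (Constraint.read (I f) x) := by
    ext x
    rw [Pi.mul_apply, evalFun_poly, Constraint.density]
  rw [hread]
  refine (Constraint.mean_read (I f) G).trans ?_
  rw [mean, Finset.mul_sum]
  refine Finset.sum_congr rfl fun y _ => ?_
  have hne : (Fintype.card (Fin k → Ω) : ℝ) ≠ 0 := card_fun_ne_zero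
  simp only [hG]
  split_ifs
  · rw [one_mul, inv_mul_cancel_left₀ hne]
  · simp

/-- The set whose infimum is `deltaP P t` is nonempty. -/
lemma exists_tvDist (htk : t ≤ k) {P : (Fin k → Ω) → Bool} (hP : ∃ x, P x = true) :
    ∃ d, ∃ μ ∈ stdSimplex ℝ (Fin k → Ω), ∃ σ ∈ stdSimplex ℝ (Fin k → Ω),
      IsWiseUniform t μ ∧ (∀ x, P x = false → σ x = 0) ∧ d = tvDist μ σ := by
  classical
  obtain ⟨y, hy⟩ := hP
  have hq : (Fintype.card Ω : ℝ) ≠ 0 := by exact_mod_cast Fintype.card_ne_zero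
  refine ⟨_, fun _ => (Fintype.card (Fin k → Ω) : ℝ)⁻¹, ⟨fun _ => by positivity, ?_⟩,
    Pi.single y 1, single_mem_stdSimplex ℝ y, ?_, fun x hx => ?_, rfl⟩
  · rw [Finset.sum_const, nsmul_eq_mul, Finset.card_univ, mul_inv_cancel₀ card_fun_ne_zero]
  · intro T hT a
    set a' : Fin k → Ω := fun i => if h : i ∈ T then a ⟨i, h⟩ else Classical.arbitrary Ω with ha'
    have e : ∀ i : T, a i = a' i := fun i => by simp [ha']
    simp only [e]
    rw [Finset.sum_const, card_filter_eq_on T a', hT, nsmul_eq_mul, Fintype.card_fun,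
      Fintype.card_fin]
    push_cast
    have h4 : (Fintype.card Ω : ℝ) ^ k = (Fintype.card Ω : ℝ) ^ (k - t) * Fintype.card Ω ^ t := by
      rw [← pow_add, Nat.sub_add_cancel htk]
    rw [h4, mul_inv, mul_inv_cancel_left₀ (pow_ne_zero _ hq)]
  · rw [Pi.single_eq_of_ne]
    rintro rfl
    simp [hy] at hx

/-- An expanding instance in which most constraints are isolated is not refuted. -/
theorem not_sosRefutes_of_isExpanding (ht : 1 < t) (htk : t ≤ k) {P : (Fin k → Ω) → Bool}
    (hP : ∃ x, P x = true) (hm : 0 < m)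
    (hexp : IsExpanding t (fun f => Constraint.scope (I f)) η b) (hη : 0 < η) (hη1 : η ≤ 1)
    (hD : 4 * (D : ℝ) ≤ η * b) (hkD : k ≤ D) {ε : ℝ} {G : Finset (Fin m)}
    (hG : ∀ f ∈ G, IsIsolated t (fun f => Constraint.scope (I f)) b f)
    (hbad : (m : ℝ) - G.card < ε * m) : ¬ SOSRefutes D P (deltaP P t + ε) I := by
  intro href
  have hm' : (0 : ℝ) < m := by exact_mod_cast hm
  -- The strict inequality `hbad` leaves a margin, so a nearly optimal pair suffices and attainment
  -- of the infimum is not needed.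
  have hlt : deltaP P t < deltaP P t + (ε - (m - G.card) / m) := by
    have : (m - G.card : ℝ) / m < ε := by rwa [div_lt_iff₀ hm']
    linarith
  obtain ⟨d, ⟨μ, hμ, σ, hσ, hunif, hsupp, rfl⟩, hd⟩ :=
    exists_lt_of_csInf_lt (exists_tvDist (t := t) htk hP) hlt
  have h : IsPlausible t (fun f => Constraint.scope (I f))
      (fun f => Constraint.density μ (I f)) η b D :=
    ⟨isWiseDensity_constraint htk hμ.1 hunif I, hexp, hη, hη1, hD⟩
  have hle := href _ h.isAssignmentPseudoexpectation
  rw [CSPInstance.valuePoly, ← MvPolynomial.smul_eq_C_mul, map_smul, map_sum, smul_eq_mul] at hle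
  have h1 : (G.card : ℝ) * (1 - tvDist μ σ) ≤ ∑ f : Fin m,
      pseudoExp t (fun f => Constraint.scope (I f)) (fun f => Constraint.density μ (I f)) b
        (Constraint.poly P (I f)) := by
    refine le_trans ?_ (Finset.sum_le_sum_of_subset_of_nonneg (Finset.subset_univ G)
      fun f _ _ => pseudoExp_poly_nonneg h hkD P f)
    rw [← nsmul_eq_mul, ← Finset.sum_const]
    refine Finset.sum_le_sum fun f hf => ?_
    rw [pseudoExp_poly_of_isIsolated h hkD htk ht.le P (hG f hf)]
    exact one_sub_tvDist_le hμ hσ hsupp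
  have h2 : (m : ℝ) * (1 - tvDist μ σ) - (m - G.card) ≤ G.card * (1 - tvDist μ σ) := by
    have h3 : (G.card : ℝ) ≤ m := by
      have := Finset.card_le_univ G
      rw [Fintype.card_fin] at this
      exact_mod_cast this
    have h4 := mul_nonneg (sub_nonneg.2 h3) (tvDist_nonneg μ σ)
    linarith
  have h5 : (m : ℝ)⁻¹ * (m * (1 - tvDist μ σ) - (m - G.card)) ≤ 1 - (deltaP P t + ε) :=
    (mul_le_mul_of_nonneg_left (h2.trans h1) (inv_nonneg.2 hm'.le)).trans hle
  have h6 : (m : ℝ)⁻¹ * (m * (1 - tvDist μ σ) - (m - G.card))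
      = 1 - tvDist μ σ - (m - G.card) / m := by
    field_simp
  linarith

/-- A pseudoexpectation is not constrained on polynomials of degree larger than `D`. -/
theorem not_sosRefutes_of_lt {P : (Fin k → Ω) → Bool} (hP : ∃ x, P x = true) (hm : 0 < m)
    (hDk : D < k) (δ : ℝ) : ¬ SOSRefutes D P δ I := by
  intro href
  have hm' : (0 : ℝ) < m := by exact_mod_cast hm
  set x₀ : Fin n → Ω := Classical.arbitrary _
  let E₀ : MvPolynomial (Fin n × Ω) ℝ →ₗ[ℝ] ℝ := (LinearMap.proj x₀).comp evalFun.toLinearMap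
  have hE₀ : ∀ p, E₀ p = evalFun p x₀ := fun p => rfl
  -- The sum of the coefficients in degree `k > D`: zero on everything that is constrained, yet
  -- positive on the value polynomial, so adding a multiple of it to evaluation at `x₀` reaches any
  -- value.
  let top : MvPolynomial (Fin n × Ω) ℝ →ₗ[ℝ] ℝ :=
    (MvPolynomial.aeval fun _ => (1 : ℝ)).toLinearMap.comp (MvPolynomial.homogeneousComponent k)
  have htop : ∀ p, top p
      = MvPolynomial.aeval (fun _ => (1 : ℝ)) (MvPolynomial.homogeneousComponent k p) :=
    fun p => rfl
  have htop0 : ∀ p : MvPolynomial (Fin n × Ω) ℝ, p.totalDegree ≤ D → top p = 0 := by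
    intro p hp
    rw [htop, MvPolynomial.homogeneousComponent_eq_zero _ _ (by omega), map_zero]
  have htopP : ∀ c : Constraint n k L, 0 < top (Constraint.poly P c) := by
    intro c
    have hhom : (Constraint.poly P c).IsHomogeneous k := by
      refine MvPolynomial.IsHomogeneous.sum _ _ _ fun a _ => ?_
      have := MvPolynomial.IsHomogeneous.prod (Finset.univ : Finset (Fin k))
        (fun j => (MvPolynomial.X (c.1 j, a j) : MvPolynomial (Fin n × Ω) ℝ)) (fun _ => 1)
        (fun j _ => MvPolynomial.isHomogeneous_X _ _)
      simpa using this
    rw [htop, MvPolynomial.homogeneousComponent_of_mem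
      ((MvPolynomial.mem_homogeneousSubmodule _ _).2 hhom), if_pos rfl, Constraint.poly, map_sum]
    simp only [map_prod, MvPolynomial.aeval_X, Finset.prod_const_one, Finset.sum_const,
      nsmul_eq_mul, mul_one, Nat.cast_pos]
    obtain ⟨y, hy⟩ := hP
    exact Finset.card_pos.2 ⟨fun j => (c.2 j : Equiv.Perm Ω).symm (y j), by simp [hy]⟩
  have htopv : 0 < top (I.valuePoly P) := by
    rw [CSPInstance.valuePoly, ← MvPolynomial.smul_eq_C_mul, map_smul, map_sum, smul_eq_mul]
    refine mul_pos (inv_pos.2 hm') (Finset.sum_pos (fun f _ => htopP _) ?_)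
    exact ⟨⟨0, hm⟩, Finset.mem_univ _⟩
  -- Chosen so that the value becomes `2 - δ`.
  set c : ℝ := (2 - δ - E₀ (I.valuePoly P)) / top (I.valuePoly P) with hc
  have hE : ∀ p : MvPolynomial (Fin n × Ω) ℝ, p.totalDegree ≤ D →
      (E₀ + c • top) p = evalFun p x₀ := by
    intro p hp
    rw [LinearMap.add_apply, LinearMap.smul_apply, htop0 p hp, smul_zero, add_zero, hE₀]
  have hps : IsAssignmentPseudoexpectation D (E₀ + c • top) :=
    { map_one := by rw [hE 1 (by simp), map_one]; rfl
      sq_nonneg := fun p hp => by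
        rw [hE _ ((MvPolynomial.totalDegree_pow p 2).trans hp), map_pow]
        exact pow_two_nonneg _
      sum_eq_one := fun i r hr => by
        rw [hE _ hr, map_mul, Pi.mul_apply]
        simp [evalFun_X]
      sq_eq_self := fun i a r hr => by
        rw [hE _ hr, map_mul, Pi.mul_apply]
        simp [evalFun_X] }
  have hle := href _ hps
  rw [LinearMap.add_apply, LinearMap.smul_apply, smul_eq_mul, hc,
    div_mul_cancel₀ _ htopv.ne'] at hle
  linarith

end Satisfied

/-! ### Sums over random constraints -/

section Sums

variable {n k : ℕ} {Ω : Type*} {L : Finset (Equiv.Perm Ω)}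

/-- Distinctness of the variables costs a factor two per position, since each position has at least
`n + 1 - k ≥ n / 2` choices. -/
lemma pow_le_two_pow_mul_card_embedding (h : 2 * k ≤ n) :
    (n : ℝ) ^ k ≤ 2 ^ k * Fintype.card (Fin k ↪ Fin n) := by
  rw [Fintype.card_embedding_eq, Fintype.card_fin, Fintype.card_fin]
  have h1 : n ^ k ≤ 2 ^ k * n.descFactorial k := by
    calc n ^ k ≤ (2 * (n + 1 - k)) ^ k := Nat.pow_le_pow_left (by omega) k
      _ = 2 ^ k * (n + 1 - k) ^ k := Nat.mul_pow _ _ _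
      _ ≤ 2 ^ k * n.descFactorial k := Nat.mul_le_mul_left _ (Nat.pow_sub_le_descFactorial n k)
  exact_mod_cast h1

lemma sum_embedding_prod_le {w : Fin n → ℝ} (hw : ∀ i, 0 ≤ w i) :
    ∑ e : Fin k ↪ Fin n, ∏ j, w (e j) ≤ (∑ i, w i) ^ k := by
  classical
  rw [Fintype.sum_pow]
  have := Finset.sum_le_sum_of_subset_of_nonneg
    (Finset.subset_univ (Finset.univ.map ⟨fun e : Fin k ↪ Fin n => (e : Fin k → Fin n),
      DFunLike.coe_injective⟩))
    (f := fun p : Fin k → Fin n => ∏ j, w (p j))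
    (fun p _ _ => Finset.prod_nonneg fun j _ => hw _)
  rw [Finset.sum_map] at this
  exact this

lemma sum_constraint_prod_le (h : 2 * k ≤ n) (hn : 0 < n) {w : Fin n → ℝ} (hw : ∀ i, 0 ≤ w i) :
    ∑ c : Constraint n k L, ∏ j, w (c.1 j)
      ≤ Fintype.card (Constraint n k L) * (2 * (∑ i, w i) / n) ^ k := by
  have hn' : (0 : ℝ) < n := by exact_mod_cast hn
  have h1 : ∑ c : Constraint n k L, ∏ j, w (c.1 j)
      = Fintype.card (Fin k → L) * ∑ e : Fin k ↪ Fin n, ∏ j, w (e j) := by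
    rw [Fintype.sum_prod_type, Finset.mul_sum]
    simp
  have h2 : (1 : ℝ) ≤ Fintype.card (Fin k ↪ Fin n) * (2 / n) ^ k := by
    rw [div_pow, ← mul_div_assoc, one_le_div (by positivity), mul_comm]
    exact pow_le_two_pow_mul_card_embedding h
  have h3 := sum_embedding_prod_le (k := k) hw
  have h4 : 0 ≤ (∑ i, w i) ^ k := pow_nonneg (Finset.sum_nonneg fun i _ => hw i) k
  rw [h1, Fintype.card_prod, Nat.cast_mul, mul_comm (Fintype.card (Fin k ↪ Fin n) : ℝ), mul_assoc]
  refine mul_le_mul_of_nonneg_left (h3.trans ?_) (Nat.cast_nonneg _)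
  have h5 : (2 * (∑ i, w i) / n) ^ k = (2 / n : ℝ) ^ k * (∑ i, w i) ^ k := by
    rw [← mul_pow]
    congr 1
    ring
  rw [h5, ← mul_assoc]
  exact le_mul_of_one_le_left h4 h2

/-- The exponent by which a constraint contributes to the exponential moment of the weight of
`M`. -/
def tilt (u ζ : ℝ) (t : ℕ) (M : Finset (Fin n)) (c : Constraint n k L) : ℝ :=
  if t + 1 < 2 * (Constraint.scope c ∩ M).card then
    u + ζ * (2 * ((Constraint.scope c ∩ M).card : ℝ) - (t + 1)) else 0

lemma prod_scope (c : Constraint n k L) (w : Fin n → ℝ) :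
    ∏ j, w (c.1 j) = ∏ i ∈ Constraint.scope c, w i := by
  rw [Constraint.scope, Finset.prod_map]

/-- The exponential of `|scope ∩ M|` is dominated by a product of weights over the positions. By
`hζ` these weights sum to `n * (1 + exp 5)`, and `2 * (1 + exp 5) ≤ exp 6` accounts for the `6 * k`.
-/
lemma sum_exp_tilt_le (h : 2 * k ≤ n) (hn : 0 < n) {t : ℕ} {u ζ : ℝ} {M : Finset (Fin n)}
    (hζ : Real.exp (2 * ζ) * M.card = Real.exp 5 * n) :
    ∑ c : Constraint n k L, Real.exp (tilt u ζ t M c)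
      ≤ Fintype.card (Constraint n k L) * (1 + Real.exp (u - ζ * (t + 1) + 6 * k)) := by
  classical
  have hn' : (0 : ℝ) < n := by exact_mod_cast hn
  set w : Fin n → ℝ := fun i => if i ∈ M then 1 + Real.exp (2 * ζ) else 1 with hw
  have hw0 : ∀ i, 1 ≤ w i := by
    intro i
    simp only [hw]
    split_ifs
    · linarith [Real.exp_pos (2 * ζ)]
    · exact le_rfl
  have hwsum : ∑ i, w i = n * (1 + Real.exp 5) := by
    have : ∀ i, w i = 1 + if i ∈ M then Real.exp (2 * ζ) else 0 := by
      intro i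
      simp only [hw]
      split_ifs <;> simp
    simp only [this]
    rw [Finset.sum_add_distrib, Finset.sum_ite_mem, Finset.univ_inter, Finset.sum_const,
      Finset.sum_const, Finset.card_univ, Fintype.card_fin, nsmul_eq_mul, nsmul_eq_mul, mul_one,
      mul_comm (M.card : ℝ), hζ]
    ring
  have hpoint : ∀ c : Constraint n k L, Real.exp (tilt u ζ t M c)
      ≤ 1 + Real.exp (u - ζ * (t + 1)) * ∏ j, w (c.1 j) := by
    intro c
    have hprod : Real.exp (2 * ζ) ^ (Constraint.scope c ∩ M).card ≤ ∏ j, w (c.1 j) := by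
      rw [prod_scope, ← Finset.prod_const]
      calc ∏ i ∈ Constraint.scope c ∩ M, Real.exp (2 * ζ)
          ≤ ∏ i ∈ Constraint.scope c ∩ M, w i := by
            refine Finset.prod_le_prod (fun _ _ => (Real.exp_pos _).le) fun i hi => ?_
            simp only [hw, (Finset.mem_inter.1 hi).2, if_true]
            linarith
        _ ≤ ∏ i ∈ Constraint.scope c, w i := by
            rw [← Finset.prod_inter_mul_prod_sdiff (Constraint.scope c) M w]
            refine le_mul_of_one_le_right
              (Finset.prod_nonneg fun i _ => zero_le_one.trans (hw0 i)) ?_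
            rw [← Finset.prod_const_one (s := Constraint.scope c \ M)]
            exact Finset.prod_le_prod (fun _ _ => zero_le_one) fun i _ => hw0 i
    unfold tilt
    split_ifs with hact
    · have e : u + ζ * (2 * ((Constraint.scope c ∩ M).card : ℝ) - (t + 1))
          = u - ζ * (t + 1) + (Constraint.scope c ∩ M).card * (2 * ζ) := by ring
      rw [e, Real.exp_add, Real.exp_nat_mul]
      have := mul_le_mul_of_nonneg_left hprod (Real.exp_pos (u - ζ * (t + 1))).le
      linarith
    · rw [Real.exp_zero]
      have : 0 ≤ Real.exp (u - ζ * (t + 1)) * ∏ j, w (c.1 j) :=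
        mul_nonneg (Real.exp_pos _).le (Finset.prod_nonneg fun j _ => zero_le_one.trans (hw0 _))
      linarith
  have hsum := sum_constraint_prod_le (L := L) h hn (fun i => zero_le_one.trans (hw0 i))
  have hK : (2 * (∑ i, w i) / n) ^ k ≤ Real.exp (6 * k) := by
    rw [hwsum, mul_comm (6 : ℝ), Real.exp_nat_mul]
    have e : 2 * (n * (1 + Real.exp 5)) / n = 2 * (1 + Real.exp 5) := by field_simp
    rw [e]
    refine pow_le_pow_left₀ (by positivity) ?_ k
    have h1 : Real.exp 6 = Real.exp 5 * Real.exp 1 := by rw [← Real.exp_add]; norm_num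
    have h2 := Real.add_one_le_exp (5 : ℝ)
    have h3 := Real.exp_one_gt_d9
    rw [h1]
    nlinarith
  calc ∑ c : Constraint n k L, Real.exp (tilt u ζ t M c)
      ≤ ∑ c : Constraint n k L, (1 + Real.exp (u - ζ * (t + 1)) * ∏ j, w (c.1 j)) :=
        Finset.sum_le_sum fun c _ => hpoint c
    _ = Fintype.card (Constraint n k L)
        + Real.exp (u - ζ * (t + 1)) * ∑ c : Constraint n k L, ∏ j, w (c.1 j) := by
        rw [Finset.sum_add_distrib, ← Finset.mul_sum]
        simp
    _ ≤ Fintype.card (Constraint n k L) + Real.exp (u - ζ * (t + 1)) *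
        (Fintype.card (Constraint n k L) * Real.exp (6 * k)) := by
        refine add_le_add_right (mul_le_mul_of_nonneg_left (hsum.trans ?_) (Real.exp_pos _).le) _
        exact mul_le_mul_of_nonneg_left hK (Nat.cast_nonneg _)
    _ = _ := by
        rw [Real.exp_add (u - ζ * (t + 1))]
        ring

lemma sum_scope_subset_le (h : 2 * k ≤ n) (hn : 0 < n) (M : Finset (Fin n)) :
    ∑ c : Constraint n k L, (if Constraint.scope c ⊆ M then (1 : ℝ) else 0)
      ≤ Fintype.card (Constraint n k L) * (2 * M.card / n) ^ k := by
  classical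
  have := sum_constraint_prod_le (L := L) h hn (w := fun i => if i ∈ M then (1 : ℝ) else 0)
    (fun i => by split_ifs <;> norm_num)
  have e : ∑ i : Fin n, (if i ∈ M then (1 : ℝ) else 0) = M.card := by simp
  rw [e] at this
  refine le_trans (le_of_eq (Finset.sum_congr rfl fun c _ => ?_)) this
  rw [prod_scope c (fun i => if i ∈ M then (1 : ℝ) else 0)]
  split_ifs with hc
  · exact (Finset.prod_eq_one fun i hi => if_pos (hc hi)).symm
  · obtain ⟨i, hi, hiM⟩ := Finset.not_subset.1 hc
    exact (Finset.prod_eq_zero hi (if_neg hiM)).symm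

lemma sum_prod_eq {ι X : Type*} [Fintype ι] [DecidableEq ι] [Fintype X] (W : ι → X → ℝ) :
    ∑ I : ι → X, ∏ f, W f (I f) = ∏ f, ∑ c, W f c := by
  rw [Finset.prod_univ_sum, Fintype.piFinset_univ]

end Sums

/-! ### Exponential moments -/

section Moments

variable {n m k t : ℕ} {Ω : Type*} {L : Finset (Equiv.Perm Ω)} {Δ : ℝ}

/-- Half the logarithm of `e⁵ n / v`. -/
def logRatio (n v : ℕ) : ℝ :=
  (5 + Real.log n - Real.log v) / 2

/-- The logarithm of the factor gained from each constraint. -/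
def logGain (k t n : ℕ) (Δ : ℝ) (v : ℕ) : ℝ :=
  ((t : ℝ) - 1) * logRatio n v - Real.log Δ - 6 * k

lemma exp_two_mul_logRatio {v : ℕ} (hn : 0 < n) (hv : 0 < v) :
    Real.exp (2 * logRatio n v) * v = Real.exp 5 * n := by
  have hn' : (0 : ℝ) < n := by exact_mod_cast hn
  have hv' : (0 : ℝ) < v := by exact_mod_cast hv
  have e : 2 * logRatio n v = 5 + Real.log n - Real.log v := by unfold logRatio; ring
  rw [e, Real.exp_sub, Real.exp_add, Real.exp_log hn', Real.exp_log hv']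
  field_simp

lemma logRatio_nonneg {v : ℕ} (hv : 0 < v) (hvn : v ≤ n) : 0 ≤ logRatio n v := by
  have hv' : (0 : ℝ) < v := by exact_mod_cast hv
  have := Real.log_le_log hv' (by exact_mod_cast hvn : (v : ℝ) ≤ n)
  unfold logRatio
  linarith

/-- `logGain` is defined so that the exponent is `-(2 * logRatio) - log Δ`; the exponential is then
`v / (exp 5 * Δ * n)`, and `m = Δ * n` constraints give a total of at most `v`. -/
lemma one_add_exp_pow_le (hn : 0 < n) (hΔ : 0 < Δ) (hm : (m : ℝ) = Δ * n) {v : ℕ} (hv : 0 < v) :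
    (1 + Real.exp (logGain k t n Δ v - logRatio n v * (t + 1) + 6 * k)) ^ m ≤ Real.exp v := by
  have hv' : (0 : ℝ) < v := by exact_mod_cast hv
  have e : logGain k t n Δ v - logRatio n v * (t + 1) + 6 * k
      = -(2 * logRatio n v) - Real.log Δ := by
    unfold logGain
    ring
  have h1 := exp_two_mul_logRatio hn hv
  set p := Real.exp (-(2 * logRatio n v) - Real.log Δ) with hp
  have hmp : m * p ≤ v := by
    rw [hp, Real.exp_sub, Real.exp_neg, Real.exp_log hΔ, hm]
    have h2 : Δ * n * ((Real.exp (2 * logRatio n v))⁻¹ / Δ) = n / Real.exp (2 * logRatio n v) := by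
      field_simp
    rw [h2, div_le_iff₀ (Real.exp_pos _), mul_comm, h1]
    have h3 : (1 : ℝ) ≤ Real.exp 5 := Real.one_le_exp (by norm_num)
    exact le_mul_of_one_le_left (Nat.cast_nonneg n) h3
  rw [e]
  calc (1 + p) ^ m ≤ Real.exp p ^ m := by
        refine pow_le_pow_left₀ (by positivity) ?_ m
        linarith [Real.add_one_le_exp p]
    _ = Real.exp (m * p) := (Real.exp_nat_mul p m).symm
    _ ≤ Real.exp v := Real.exp_le_exp.2 hmp

lemma sum_exp_sum_tilt_le (h : 2 * k ≤ n) (hn : 0 < n) (hΔ : 0 < Δ) (hm : (m : ℝ) = Δ * n)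
    {M : Finset (Fin n)} (hM : 0 < M.card) :
    ∑ I : Fin m → Constraint n k L, Real.exp (∑ f,
        tilt (logGain k t n Δ M.card) (logRatio n M.card) t M (I f))
      ≤ (Fintype.card (Constraint n k L) : ℝ) ^ m * Real.exp M.card := by
  simp only [Real.exp_sum]
  rw [sum_prod_eq (fun (_ : Fin m) c =>
    Real.exp (tilt (logGain k t n Δ M.card) (logRatio n M.card) t M c)), Finset.prod_const,
    Finset.card_univ, Fintype.card_fin]
  have h1 := sum_exp_tilt_le (L := L) (k := k) (t := t) (u := logGain k t n Δ M.card) h hn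
    (exp_two_mul_logRatio hn hM)
  refine (pow_le_pow_left₀ (Finset.sum_nonneg fun _ _ => (Real.exp_pos _).le) h1 m).trans ?_
  rw [mul_pow]
  exact mul_le_mul_of_nonneg_left (one_add_exp_pow_le hn hΔ hm hM) (by positivity)

lemma sum_scope_subset_exp_sum_tilt_le (h : 2 * k ≤ n) (hn : 0 < n) (hΔ : 0 < Δ)
    (hm : (m : ℝ) = Δ * n) {M : Finset (Fin n)} (hM : 0 < M.card) (f₀ : Fin m) :
    ∑ I : Fin m → Constraint n k L, (if Constraint.scope (I f₀) ⊆ M then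
        Real.exp (∑ f ∈ Finset.univ.erase f₀,
          tilt (logGain k t n Δ M.card) (logRatio n M.card) t M (I f)) else 0)
      ≤ (Fintype.card (Constraint n k L) : ℝ) ^ m * ((2 * M.card / n) ^ k * Real.exp M.card) := by
  classical
  set X : ℝ := ((Fintype.card (Constraint n k L) : ℕ) : ℝ) with hX
  set p := Real.exp (logGain k t n Δ M.card - logRatio n M.card * (t + 1) + 6 * k) with hp
  let W : Fin m → Constraint n k L → ℝ := fun f c =>
    if f = f₀ then (if Constraint.scope c ⊆ M then 1 else 0)
    else Real.exp (tilt (logGain k t n Δ M.card) (logRatio n M.card) t M c)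
  have e : ∀ I : Fin m → Constraint n k L, (if Constraint.scope (I f₀) ⊆ M then
        Real.exp (∑ f ∈ Finset.univ.erase f₀,
          tilt (logGain k t n Δ M.card) (logRatio n M.card) t M (I f)) else 0)
      = ∏ f, W f (I f) := by
    intro I
    rw [← Finset.mul_prod_erase _ _ (Finset.mem_univ f₀), Real.exp_sum]
    have : ∏ f ∈ Finset.univ.erase f₀, W f (I f) = ∏ f ∈ Finset.univ.erase f₀,
        Real.exp (tilt (logGain k t n Δ M.card) (logRatio n M.card) t M (I f)) :=
      Finset.prod_congr rfl fun f hf => by simp [W, Finset.ne_of_mem_erase hf]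
    rw [this]
    simp only [W, if_true]
    split_ifs <;> simp
  simp only [e]
  rw [sum_prod_eq, ← Finset.mul_prod_erase _ _ (Finset.mem_univ f₀)]
  have h0 : ∑ c, W f₀ c ≤ X * (2 * M.card / n) ^ k := by
    simp only [W, if_true]
    exact sum_scope_subset_le (L := L) h hn M
  have h1 : ∏ f ∈ Finset.univ.erase f₀, ∑ c, W f c ≤ (X * (1 + p)) ^ (m - 1) := by
    have hc : (Finset.univ.erase f₀).card = m - 1 := by
      rw [Finset.card_erase_of_mem (Finset.mem_univ f₀), Finset.card_univ, Fintype.card_fin]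
    rw [← hc, ← Finset.prod_const]
    refine Finset.prod_le_prod (fun f hf => Finset.sum_nonneg fun c _ => ?_) fun f hf => ?_
    · simp only [W, Finset.ne_of_mem_erase hf, if_false]
      exact (Real.exp_pos _).le
    · simp only [W, Finset.ne_of_mem_erase hf, if_false]
      exact sum_exp_tilt_le (L := L) h hn (exp_two_mul_logRatio hn hM)
  have hp0 : 0 < p := Real.exp_pos _
  have hX0 : 0 ≤ X := Nat.cast_nonneg _
  have hm1 : m - 1 + 1 = m := by have := f₀.pos; omega
  have h2 : (1 + p) ^ (m - 1) ≤ Real.exp M.card :=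
    (pow_le_pow_right₀ (by linarith) (Nat.sub_le m 1)).trans (one_add_exp_pow_le hn hΔ hm hM)
  calc (∑ c, W f₀ c) * ∏ f ∈ Finset.univ.erase f₀, ∑ c, W f c
      ≤ (X * (2 * M.card / n) ^ k) * (X * (1 + p)) ^ (m - 1) := by
        refine mul_le_mul h0 h1 (Finset.prod_nonneg fun f hf =>
          Finset.sum_nonneg fun c _ => ?_) (by positivity)
        simp only [W, Finset.ne_of_mem_erase hf, if_false]
        exact (Real.exp_pos _).le
    _ = X ^ m * ((2 * M.card / n) ^ k * (1 + p) ^ (m - 1)) := by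
        rw [mul_pow, ← hm1, pow_succ, Nat.add_sub_cancel]
        ring
    _ ≤ _ := by gcongr

/-- Here `c` counts the constraints with a positive contribution. As each contributes at most `2 *
k`, a large total forces many of them, each gaining `u`. -/
lemma sum_tilt_eq (u ζ : ℝ) (M : Finset (Fin n)) (S : Finset (Fin m))
    (I : Fin m → Constraint n k L) :
    ∃ c : ℕ, ∑ f ∈ S, tilt u ζ t M (I f) = u * c + ζ * ((∑ f ∈ S,
        max (2 * ((Constraint.scope (I f) ∩ M).card : ℤ) - (t + 1)) 0 : ℤ) : ℝ) ∧
      (∑ f ∈ S, max (2 * ((Constraint.scope (I f) ∩ M).card : ℤ) - (t + 1)) 0) ≤ 2 * k * c := by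
  refine ⟨(S.filter fun f => t + 1 < 2 * (Constraint.scope (I f) ∩ M).card).card, ?_, ?_⟩
  · rw [Finset.card_filter]
    push_cast
    rw [Finset.mul_sum, Finset.mul_sum, ← Finset.sum_add_distrib]
    refine Finset.sum_congr rfl fun f _ => ?_
    unfold tilt
    split_ifs with hf
    · have hf' : (t + 1 : ℝ) < 2 * (Constraint.scope (I f) ∩ M).card := by exact_mod_cast hf
      rw [max_eq_left (by linarith)]
      ring
    · have hf' : 2 * ((Constraint.scope (I f) ∩ M).card : ℝ) ≤ t + 1 := by
        exact_mod_cast not_lt.1 hf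
      rw [max_eq_right (by linarith)]
      ring
  · rw [Finset.card_filter]
    push_cast
    rw [Finset.mul_sum]
    refine Finset.sum_le_sum fun f _ => ?_
    have h1 : (Constraint.scope (I f) ∩ M).card ≤ k :=
      (Finset.card_le_card Finset.inter_subset_left).trans (Constraint.card_scope (I f)).le
    split_ifs with hf <;> omega

/-- The count is at least `1` and at least `|M| / (2k)`; the average of the two bounds is used. The
term `u / 2` will pay for `β`, the other for `η`. -/
lemma le_sum_tilt_of_weight_lt {u ζ η : ℝ} (hk : 0 < k) (hu : 0 ≤ u) (hζ : 0 ≤ ζ) (hη : η ≤ 1)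
    {M : Finset (Fin n)} (hM : 0 < M.card) {I : Fin m → Constraint n k L}
    (hw : (weight t (fun f => Constraint.scope (I f)) M : ℝ) < η * M.card) :
    u / 2 + u * M.card / (4 * k) + ζ * ((2 - η) * M.card) ≤ ∑ f, tilt u ζ t M (I f) := by
  obtain ⟨c, hc, hY⟩ := sum_tilt_eq (t := t) u ζ M Finset.univ I
  rw [hc]
  unfold weight at hw
  set Y : ℤ := ∑ f, max (2 * ((Constraint.scope (I f) ∩ M).card : ℤ) - (t + 1)) 0 with hYdef
  rw [Int.cast_sub] at hw
  push_cast at hw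
  have hY' : (Y : ℝ) ≤ 2 * k * c := by exact_mod_cast hY
  have hv : (0 : ℝ) < M.card := by exact_mod_cast hM
  have hk' : (0 : ℝ) < k := by exact_mod_cast hk
  have h1 : (2 - η) * M.card ≤ (Y : ℝ) := by linarith
  have h2 : (M.card : ℝ) ≤ Y := by nlinarith
  have h3 : (1 : ℝ) ≤ c := by
    have : 0 < c := by
      rcases Nat.eq_zero_or_pos c with h0 | h0
      · rw [h0] at hY'
        simp only [Nat.cast_zero, mul_zero] at hY'
        linarith
      · exact h0
    exact_mod_cast this
  have h4 : (M.card : ℝ) / (2 * k) ≤ c := by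
    rw [div_le_iff₀ (by positivity)]
    linarith
  have h5 := mul_le_mul_of_nonneg_left h3 hu
  have h6 := mul_le_mul_of_nonneg_left h4 hu
  have h7 := mul_le_mul_of_nonneg_left h1 hζ
  have h8 : u * (M.card / (2 * k)) = 2 * (u * M.card / (4 * k)) := by
    field_simp
    norm_num
  linarith

/-- By integrality, weight at most `t` rather than `t + 1` gives the extra `+ 1`; the additional `ζ`
becomes the factor `1 / √n` in `card_not_isIsolated_le`. -/
lemma le_sum_tilt_of_weight_le {u ζ : ℝ} (htk : t + 1 ≤ 2 * k) (hu : 0 ≤ u) (hζ : 0 ≤ ζ)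
    {M : Finset (Fin n)} {I : Fin m → Constraint n k L} {f₀ : Fin m}
    (hf₀ : Constraint.scope (I f₀) ⊆ M)
    (hw : weight t (fun f => Constraint.scope (I f)) M ≤ t) :
    u + ζ * (2 * ((M.card : ℝ) - k) + 1) ≤ ∑ f ∈ Finset.univ.erase f₀, tilt u ζ t M (I f) := by
  obtain ⟨c, hc, hY⟩ := sum_tilt_eq (t := t) u ζ M (Finset.univ.erase f₀) I
  rw [hc]
  unfold weight at hw
  rw [← Finset.add_sum_erase _ _ (Finset.mem_univ f₀), Finset.inter_eq_left.2 hf₀,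
    Constraint.card_scope] at hw
  have hkM : k ≤ M.card := by
    rw [← Constraint.card_scope (I f₀)]
    exact Finset.card_le_card hf₀
  set Y : ℤ := ∑ f ∈ Finset.univ.erase f₀,
    max (2 * ((Constraint.scope (I f) ∩ M).card : ℤ) - (t + 1)) 0 with hYdef
  have h1 : 2 * ((M.card : ℤ) - k) + 1 ≤ Y := by omega
  have h2 : 2 * ((M.card : ℝ) - k) + 1 ≤ Y := by exact_mod_cast h1
  have h3 : (1 : ℝ) ≤ c := by
    have : 0 < c := by
      rcases Nat.eq_zero_or_pos c with h0 | h0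
      · rw [h0] at hY
        simp only [Nat.cast_zero, mul_zero] at hY
        omega
      · exact h0
    exact_mod_cast this
  have h5 := mul_le_mul_of_nonneg_left h3 hu
  have h7 := mul_le_mul_of_nonneg_left h2 hζ
  linarith

end Moments

/-! ### Union bounds -/

section UnionBounds

variable {n m k t b : ℕ} {Ω : Type*} {L : Finset (Equiv.Perm Ω)} {Δ β : ℝ}

/-- This is `(e * n / v) ^ v`, since `2 * logRatio n v = 5 + log (n / v)`. -/
lemma choose_le_exp {v : ℕ} (hn : 0 < n) (hv : 0 < v) :
    (n.choose v : ℝ) ≤ Real.exp (v * (2 * logRatio n v - 4)) := by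
  have hv' : (0 : ℝ) < v := by exact_mod_cast hv
  have h1 : (n.choose v : ℝ) ≤ (n : ℝ) ^ v / v.factorial := Nat.choose_le_pow_div v n
  have h2 : (v : ℝ) ^ v / v.factorial ≤ Real.exp v :=
    Real.pow_div_factorial_le_exp _ (Nat.cast_nonneg v) v
  have h3 : (n : ℝ) = v * Real.exp (2 * logRatio n v - 5) := by
    rw [Real.exp_sub, mul_div_assoc', mul_comm, exp_two_mul_logRatio hn hv]
    field_simp
  calc (n.choose v : ℝ) ≤ (n : ℝ) ^ v / v.factorial := h1
    _ = (v : ℝ) ^ v / v.factorial * Real.exp (v * (2 * logRatio n v - 5)) := by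
        rw [Real.exp_nat_mul]
        conv_lhs => rw [h3]
        rw [mul_pow]
        ring
    _ ≤ Real.exp v * Real.exp (v * (2 * logRatio n v - 5)) :=
        mul_le_mul_of_nonneg_right h2 (Real.exp_pos _).le
    _ = Real.exp (v * (2 * logRatio n v - 4)) := by
        rw [← Real.exp_add]
        congr 1
        ring

lemma sum_exp_neg_le_one (b : ℕ) : ∑ v ∈ Finset.Icc 1 b, Real.exp (-(v : ℝ)) ≤ 1 := by
  have h1 : ∀ v : ℕ, Real.exp (-(v : ℝ)) ≤ (1 / 2) ^ v := by
    intro v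
    have h2 : Real.exp (-(v : ℝ)) = Real.exp (-1) ^ v := by
      rw [← Real.exp_nat_mul]
      congr 1
      ring
    rw [h2]
    refine pow_le_pow_left₀ (Real.exp_pos _).le ?_ v
    rw [Real.exp_neg, one_div]
    exact inv_anti₀ (by norm_num) (by linarith [Real.exp_one_gt_d9])
  have h3 : ∀ b : ℕ, ∑ v ∈ Finset.Icc 1 b, (1 / 2 : ℝ) ^ v = 1 - (1 / 2) ^ b := by
    intro b
    induction b with
    | zero => simp
    | succ b ih =>
      rw [Finset.sum_Icc_succ_top (by omega), ih, pow_succ]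
      ring
  refine (Finset.sum_le_sum fun v _ => h1 v).trans ?_
  rw [h3]
  have : (0 : ℝ) ≤ (1 / 2) ^ b := by positivity
  linarith

/-- A union bound over all small nonempty sets of variables. -/
lemma sum_small_sets_le {g : Finset (Fin n) → ℝ} {B : ℝ} (hB : 0 ≤ B)
    (hg : ∀ M, 0 < M.card → M.card ≤ b → n.choose M.card * g M ≤ B * Real.exp (-(M.card : ℝ))) :
    ∑ M ∈ Finset.univ.filter (fun M : Finset (Fin n) => 0 < M.card ∧ M.card ≤ b), g M ≤ B := by
  have hmaps : ∀ M ∈ Finset.univ.filter (fun M : Finset (Fin n) => 0 < M.card ∧ M.card ≤ b),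
      M.card ∈ Finset.Icc 1 b := by
    intro M hM
    have := (Finset.mem_filter.1 hM).2
    exact Finset.mem_Icc.2 ⟨this.1, this.2⟩
  rw [← Finset.sum_fiberwise_of_maps_to hmaps]
  calc _ ≤ ∑ v ∈ Finset.Icc 1 b, B * Real.exp (-(v : ℝ)) := by
        refine Finset.sum_le_sum fun v hv => ?_
        rw [Finset.mem_Icc] at hv
        have e : (Finset.univ.filter fun M : Finset (Fin n) => 0 < M.card ∧ M.card ≤ b).filter
            (fun M => M.card = v) = Finset.powersetCard v Finset.univ := by
          ext M
          simp only [Finset.mem_filter, Finset.mem_univ, true_and, Finset.mem_powersetCard,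
            Finset.subset_univ]
          constructor
          · exact fun h => h.2
          · intro h
            exact ⟨⟨by omega, by omega⟩, h⟩
        rw [e]
        rcases Nat.eq_zero_or_pos (n.choose v) with h0 | h0
        · have : Finset.powersetCard v (Finset.univ : Finset (Fin n)) = ∅ := by
            rw [← Finset.card_eq_zero, Finset.card_powersetCard, Finset.card_univ,
              Fintype.card_fin, h0]
          rw [this, Finset.sum_empty]
          positivity
        · have h0' : (0 : ℝ) < n.choose v := by exact_mod_cast h0
          have hle : ∀ M ∈ Finset.powersetCard v (Finset.univ : Finset (Fin n)),
              g M ≤ B * Real.exp (-(v : ℝ)) / n.choose v := by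
            intro M hM
            have hMv := (Finset.mem_powersetCard.1 hM).2
            have := hg M (by omega) (by omega)
            rw [hMv] at this
            rw [le_div_iff₀ h0']
            linarith
          refine (Finset.sum_le_sum hle).trans ?_
          rw [Finset.sum_const, Finset.card_powersetCard, Finset.card_univ, Fintype.card_fin,
            nsmul_eq_mul, mul_div_cancel₀ _ h0'.ne']
    _ ≤ B := by
        rw [← Finset.mul_sum]
        exact mul_le_of_le_one_right hB (sum_exp_neg_le_one b)

open Classical in
/-- Few instances are not expanding. -/
lemma card_not_isExpanding_le (hk : 0 < k) (ht : 1 < t) (h : 2 * k ≤ n) (hΔ : 10 ≤ Δ)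
    (hm : (m : ℝ) = Δ * n) (hβ : 0 < β) (hβ1 : β < 1)
    (hgain : ∀ v, 0 < v → v ≤ b → 6 * k + 2 * Real.log (2 / β) ≤ logGain k t n Δ v) :
    ((Finset.univ.filter fun I : Fin m → Constraint n k L =>
        ¬ IsExpanding t (fun f => Constraint.scope (I f)) (1 / (10 * k * Real.log Δ)) b).card : ℝ)
      ≤ (Fintype.card (Constraint n k L) : ℝ) ^ m * (β / 2) := by
  have hn : 0 < n := by omega
  have hk' : (1 : ℝ) ≤ k := by exact_mod_cast hk
  have hlogΔ : 1 ≤ Real.log Δ := by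
    rw [Real.le_log_iff_exp_le (by linarith)]
    linarith [Real.exp_one_lt_d9]
  set η : ℝ := 1 / (10 * k * Real.log Δ) with hη
  have hη0 : 0 < η := by positivity
  have hden : 10 ≤ 10 * k * Real.log Δ := by nlinarith
  have hη1 : η ≤ 1 := by
    rw [hη, div_le_one (by linarith)]
    linarith
  have hlogβ : 0 < Real.log (2 / β) := Real.log_pos (by rw [lt_div_iff₀ hβ]; linarith)
  set X : ℝ := ((Fintype.card (Constraint n k L) : ℕ) : ℝ) with hX
  set bad : Finset (Fin n) → Finset (Fin m → Constraint n k L) := fun M =>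
    Finset.univ.filter fun I =>
      (weight t (fun f => Constraint.scope (I f)) M : ℝ) < η * M.card with hbad
  have hsub : (Finset.univ.filter fun I : Fin m → Constraint n k L =>
      ¬ IsExpanding t (fun f => Constraint.scope (I f)) η b) ⊆
      (Finset.univ.filter fun M : Finset (Fin n) => 0 < M.card ∧ M.card ≤ b).biUnion bad := by
    intro I hI
    have hI' := (Finset.mem_filter.1 hI).2
    unfold IsExpanding at hI'
    push Not at hI'
    obtain ⟨M, hMb, hMw⟩ := hI'
    refine Finset.mem_biUnion.2 ⟨M, Finset.mem_filter.2 ⟨Finset.mem_univ _, ?_, hMb⟩,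
      Finset.mem_filter.2 ⟨Finset.mem_univ _, hMw⟩⟩
    by_contra h0
    have hM0 : M = ∅ := Finset.card_eq_zero.1 (by omega)
    subst hM0
    have : weight t (fun f => Constraint.scope (I f)) (∅ : Finset (Fin n)) = 0 := by
      simp only [weight, Finset.card_empty, Finset.inter_empty]
      rw [Finset.sum_eq_zero fun f _ => max_eq_right (by push_cast; linarith)]
      simp
    rw [this] at hMw
    simp at hMw
  have hcount : ∀ M : Finset (Fin n), 0 < M.card → M.card ≤ b →
      n.choose M.card * ((bad M).card : ℝ) ≤ X ^ m * (β / 2) * Real.exp (-(M.card : ℝ)) := by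
    intro M hM hMb
    have hMn : M.card ≤ n := by simpa using Finset.card_le_univ M
    have hv : (1 : ℝ) ≤ M.card := by exact_mod_cast hM
    set u := logGain k t n Δ M.card with hu
    set ζ := logRatio n M.card with hζdef
    have hζ : 0 ≤ ζ := logRatio_nonneg hM hMn
    have hug := hgain _ hM hMb
    have hu0 : 0 ≤ u := by linarith
    set T := u / 2 + u * M.card / (4 * k) + ζ * ((2 - η) * M.card) with hT
    -- Markov's inequality for the exponential moment.
    have h1 : ((bad M).card : ℝ) * Real.exp T ≤ X ^ m * Real.exp M.card := by
      refine le_trans ?_ (sum_exp_sum_tilt_le (L := L) (t := t) h hn (by linarith) hm hM)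
      rw [← nsmul_eq_mul, ← Finset.sum_const]
      refine le_trans ?_ (Finset.sum_le_sum_of_subset_of_nonneg (Finset.subset_univ (bad M))
        fun I _ _ => (Real.exp_pos _).le)
      refine Finset.sum_le_sum fun I hI => Real.exp_le_exp.2 ?_
      exact le_sum_tilt_of_weight_lt hk hu0 hζ hη1 hM (Finset.mem_filter.1 hI).2
    have h2 : ((bad M).card : ℝ) ≤ X ^ m * Real.exp (M.card - T) := by
      rw [Real.exp_sub, mul_div_assoc', le_div_iff₀ (Real.exp_pos _)]
      exact h1
    have h3 := choose_le_exp hn hM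
    -- This dictates `η = 1 / (10 k log Δ)`: as `t ≥ 2`, `ζ ≤ u + log Δ + 6k`, and `η` makes the
    -- last two terms at most one each and the first at most `u / (4k)`.
    have hkey : η * ζ ≤ 2 + u / (4 * k) := by
      have ht' : (2 : ℝ) ≤ t := by exact_mod_cast ht
      have e : ((t : ℝ) - 1) * ζ = u + Real.log Δ + 6 * k := by
        rw [hu, logGain]
        ring
      have h4 : ζ ≤ u + Real.log Δ + 6 * k := by nlinarith
      have h5 : η * ζ ≤ η * (u + Real.log Δ + 6 * k) := mul_le_mul_of_nonneg_left h4 hη0.le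
      have h6 : η * u ≤ u / (4 * k) := by
        rw [hη, one_div, inv_mul_eq_div]
        refine div_le_div_of_nonneg_left hu0 (by positivity) ?_
        nlinarith
      have h7 : η * Real.log Δ ≤ 1 := by
        rw [hη, one_div, inv_mul_eq_div, div_le_one (by linarith)]
        nlinarith
      have h8 : η * (6 * k) ≤ 1 := by
        rw [hη, one_div, inv_mul_eq_div, div_le_one (by linarith)]
        nlinarith
      linarith
    -- The entropy `2 * ζ * |M|` of the choice of `M` cancels against the tilt, up to `η * ζ * |M|`.
    have hexp : (M.card : ℝ) * (2 * ζ - 4) + (M.card - T)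
        ≤ -Real.log (2 / β) + -(M.card : ℝ) := by
      have h9 := mul_le_mul_of_nonneg_right hkey (zero_le_one.trans hv)
      have h10 : u / (4 * k) * M.card = u * M.card / (4 * k) := by ring
      rw [hT]
      have h11 : Real.log (2 / β) ≤ u / 2 := by linarith
      rw [add_mul, h10] at h9
      linarith
    calc n.choose M.card * ((bad M).card : ℝ)
        ≤ Real.exp (M.card * (2 * ζ - 4)) * (X ^ m * Real.exp (M.card - T)) :=
          mul_le_mul h3 h2 (Nat.cast_nonneg _) (Real.exp_pos _).le
      _ = X ^ m * Real.exp (M.card * (2 * ζ - 4) + (M.card - T)) := by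
          rw [Real.exp_add]
          ring
      _ ≤ X ^ m * Real.exp (-Real.log (2 / β) + -(M.card : ℝ)) :=
          mul_le_mul_of_nonneg_left (Real.exp_le_exp.2 hexp) (by positivity)
      _ = X ^ m * (β / 2) * Real.exp (-(M.card : ℝ)) := by
          rw [Real.exp_add, Real.exp_neg, Real.exp_log (by positivity), inv_div]
          ring
  calc _ ≤ (((Finset.univ.filter fun M : Finset (Fin n) => 0 < M.card ∧ M.card ≤ b).biUnion
        bad).card : ℝ) := by exact_mod_cast Finset.card_le_card hsub
    _ ≤ ∑ M ∈ Finset.univ.filter (fun M : Finset (Fin n) => 0 < M.card ∧ M.card ≤ b),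
        ((bad M).card : ℝ) := by exact_mod_cast Finset.card_biUnion_le
    _ ≤ X ^ m * (β / 2) := sum_small_sets_le (by positivity) hcount

open Classical in
/-- A given constraint is isolated in most instances. -/
lemma card_not_isIsolated_le (hk : 0 < k) (htk : t ≤ k) (h : 2 * k ≤ n) (hΔ : 10 ≤ Δ)
    (hm : (m : ℝ) = Δ * n) (hβ : 0 < β) (hβ1 : β < 1)
    (hgain : ∀ v, 0 < v → v ≤ b → 6 * k + 2 * Real.log (2 / β) ≤ logGain k t n Δ v)
    (f₀ : Fin m) :
    ((Finset.univ.filter fun I : Fin m → Constraint n k L =>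
        ¬ IsIsolated t (fun f => Constraint.scope (I f)) b f₀).card : ℝ)
      ≤ (Fintype.card (Constraint n k L) : ℝ) ^ m * (β / 2) / √n := by
  have hn : 0 < n := by omega
  have hn' : (0 : ℝ) < n := by exact_mod_cast hn
  have hk' : (1 : ℝ) ≤ k := by exact_mod_cast hk
  have hlogβ : 0 < Real.log (2 / β) := Real.log_pos (by rw [lt_div_iff₀ hβ]; linarith)
  set X : ℝ := ((Fintype.card (Constraint n k L) : ℕ) : ℝ) with hX
  set bad : Finset (Fin n) → Finset (Fin m → Constraint n k L) := fun M =>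
    Finset.univ.filter fun I => Constraint.scope (I f₀) ⊆ M ∧
      weight t (fun f => Constraint.scope (I f)) M ≤ t with hbad
  have hsub : (Finset.univ.filter fun I : Fin m → Constraint n k L =>
      ¬ IsIsolated t (fun f => Constraint.scope (I f)) b f₀) ⊆
      (Finset.univ.filter fun M : Finset (Fin n) => 0 < M.card ∧ M.card ≤ b).biUnion bad := by
    intro I hI
    have hI' := (Finset.mem_filter.1 hI).2
    unfold IsIsolated at hI'
    push Not at hI'
    obtain ⟨M, hIM, hMb, hMw⟩ := hI'
    refine Finset.mem_biUnion.2 ⟨M, Finset.mem_filter.2 ⟨Finset.mem_univ _, ?_, hMb⟩,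
      Finset.mem_filter.2 ⟨Finset.mem_univ _, hIM, by omega⟩⟩
    have := Finset.card_le_card hIM
    rw [Constraint.card_scope] at this
    omega
  have hcount : ∀ M : Finset (Fin n), 0 < M.card → M.card ≤ b →
      n.choose M.card * ((bad M).card : ℝ)
        ≤ X ^ m * (β / 2) / √n * Real.exp (-(M.card : ℝ)) := by
    intro M hM hMb
    rcases lt_or_ge M.card k with hlt | hkM
    · have : bad M = ∅ := by
        refine Finset.filter_eq_empty_iff.2 fun I _ hI => ?_
        have := Finset.card_le_card hI.1
        rw [Constraint.card_scope] at this
        omega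
      rw [this, Finset.card_empty, Nat.cast_zero, mul_zero]
      positivity
    have hMn : M.card ≤ n := by simpa using Finset.card_le_univ M
    have hv : (1 : ℝ) ≤ M.card := by exact_mod_cast hM
    have hv0 : (0 : ℝ) < M.card := by linarith
    set u := logGain k t n Δ M.card with hu
    set ζ := logRatio n M.card with hζdef
    have hζ : 0 ≤ ζ := logRatio_nonneg hM hMn
    have hug := hgain _ hM hMb
    have hu0 : 0 ≤ u := by linarith
    set T := u + ζ * (2 * ((M.card : ℝ) - k) + 1) with hT
    have h1 : ((bad M).card : ℝ) * Real.exp T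
        ≤ X ^ m * ((2 * M.card / n) ^ k * Real.exp M.card) := by
      refine le_trans ?_ (sum_scope_subset_exp_sum_tilt_le (L := L) (t := t) h hn
        (by linarith) hm hM f₀)
      rw [← nsmul_eq_mul, ← Finset.sum_const]
      refine le_trans ?_ (Finset.sum_le_sum_of_subset_of_nonneg (Finset.subset_univ (bad M))
        fun I _ _ => by split_ifs; exacts [(Real.exp_pos _).le, le_rfl])
      refine Finset.sum_le_sum fun I hI => ?_
      have hI' := (Finset.mem_filter.1 hI).2
      rw [if_pos hI'.1]
      exact Real.exp_le_exp.2 (le_sum_tilt_of_weight_le (by omega) hu0 hζ hI'.1 hI'.2)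
    have hratio : (2 * M.card / n : ℝ) ≤ Real.exp (1 + (5 - 2 * ζ)) := by
      have e : (M.card : ℝ) / n = Real.exp (5 - 2 * ζ) := by
        rw [Real.exp_sub, div_eq_div_iff hn'.ne' (Real.exp_pos _).ne', mul_comm,
          exp_two_mul_logRatio hn hM]
      rw [mul_div_assoc, e, Real.exp_add]
      exact mul_le_mul_of_nonneg_right (by linarith [Real.exp_one_gt_d9]) (Real.exp_pos _).le
    have h2 : ((bad M).card : ℝ) ≤ X ^ m * Real.exp (k * (6 - 2 * ζ) + M.card - T) := by
      rw [Real.exp_sub, mul_div_assoc', le_div_iff₀ (Real.exp_pos _)]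
      refine h1.trans (mul_le_mul_of_nonneg_left ?_ (by positivity))
      rw [Real.exp_add, Real.exp_nat_mul]
      refine mul_le_mul_of_nonneg_right ?_ (Real.exp_pos _).le
      have e : (6 - 2 * ζ) = 1 + (5 - 2 * ζ) := by ring
      rw [e]
      exact pow_le_pow_left₀ (by positivity) hratio k
    have h3 := choose_le_exp hn hM
    -- The terms `2 * ζ * |M|` and `2 * ζ * k` cancel below; the single surviving `-ζ` is the source
    -- of `1 / √n`.
    have hζ2 : -ζ ≤ M.card + -(Real.log n / 2) := by
      rw [hζdef, logRatio]
      have := Real.log_le_sub_one_of_pos hv0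
      linarith
    have hexp : (M.card : ℝ) * (2 * ζ - 4) + (k * (6 - 2 * ζ) + M.card - T)
        ≤ -Real.log (2 / β) + -(M.card : ℝ) + -(Real.log n / 2) := by
      rw [hT]
      linarith
    calc n.choose M.card * ((bad M).card : ℝ)
        ≤ Real.exp (M.card * (2 * ζ - 4)) *
          (X ^ m * Real.exp (k * (6 - 2 * ζ) + M.card - T)) :=
          mul_le_mul h3 h2 (Nat.cast_nonneg _) (Real.exp_pos _).le
      _ = X ^ m * Real.exp (M.card * (2 * ζ - 4) + (k * (6 - 2 * ζ) + M.card - T)) := by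
          rw [Real.exp_add (M.card * (2 * ζ - 4))]
          ring
      _ ≤ X ^ m * Real.exp (-Real.log (2 / β) + -(M.card : ℝ) + -(Real.log n / 2)) :=
          mul_le_mul_of_nonneg_left (Real.exp_le_exp.2 hexp) (by positivity)
      _ = X ^ m * (β / 2) / √n * Real.exp (-(M.card : ℝ)) := by
          have e : Real.exp (Real.log n / 2) = √n := by
            rw [Real.sqrt_eq_rpow, Real.rpow_def_of_pos hn']
            congr 1
            ring
          rw [Real.exp_add, Real.exp_add, Real.exp_neg (Real.log (2 / β)),
            Real.exp_log (by positivity), inv_div, Real.exp_neg (Real.log n / 2), e]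
          ring
  calc _ ≤ (((Finset.univ.filter fun M : Finset (Fin n) => 0 < M.card ∧ M.card ≤ b).biUnion
        bad).card : ℝ) := by exact_mod_cast Finset.card_le_card hsub
    _ ≤ ∑ M ∈ Finset.univ.filter (fun M : Finset (Fin n) => 0 < M.card ∧ M.card ≤ b),
        ((bad M).card : ℝ) := by exact_mod_cast Finset.card_biUnion_le
    _ ≤ X ^ m * (β / 2) / √n := sum_small_sets_le (by positivity) hcount

end UnionBounds

/-! ### Parameters -/

section Parameters

lemma one_le_log {Δ : ℝ} (hΔ : 10 ≤ Δ) : 1 ≤ Real.log Δ := by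
  rw [Real.le_log_iff_exp_le (by linarith)]
  linarith [Real.exp_one_lt_d9]

lemma inv_sqrt_le_slack {n : ℕ} {Δ : ℝ} (hΔ : 10 ≤ Δ) : 1 / √(n : ℝ) ≤ slack n Δ := by
  have h := one_le_log hΔ
  refine div_le_div_of_nonneg_right (Real.one_le_rpow (by norm_num) ?_) (Real.sqrt_nonneg _)
  exact div_nonneg (Real.log_natCast_nonneg n) (by linarith)

variable {k t n : ℕ} {Δ β : ℝ}

lemma two_mul_le_of_le_sosDegree (hk : 0 < k) (ht : 1 < t) (htk : t ≤ k) (hΔ : 10 ≤ Δ)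
    (hβ : 0 < β) (hβ1 : β < 1) (h : (k : ℝ) ≤ sosDegree 100 β k t n Δ) : 2 * k ≤ n := by
  have hk' : (1 : ℝ) ≤ k := by exact_mod_cast hk
  have ht' : (2 : ℝ) ≤ t := by exact_mod_cast ht
  have htk' : (t : ℝ) ≤ k := by exact_mod_cast htk
  have h1 : β ^ (100 / (t : ℝ)) ≤ 1 := Real.rpow_le_one hβ.le hβ1.le (by positivity)
  have h2 : (2 : ℝ) ≤ 2 ^ (100 * (k : ℝ) / t) := by
    conv_lhs => rw [← Real.rpow_one 2]
    refine Real.rpow_le_rpow_of_exponent_le (by norm_num) ?_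
    rw [le_div_iff₀ (by linarith)]
    linarith
  have h3 : 1 ≤ Δ ^ (2 / ((t : ℝ) - 1)) :=
    Real.one_le_rpow (by linarith) (div_nonneg (by norm_num) (by linarith))
  have h4 := one_le_log hΔ
  have h5 : sosDegree 100 β k t n Δ ≤ 1 / (k * 2) * (n / 1) := by
    unfold sosDegree
    gcongr
    nlinarith
  have h6 : (k : ℝ) ≤ n / (k * 2) := by
    refine h.trans (h5.trans (le_of_eq ?_))
    ring
  rw [le_div_iff₀ (by positivity)] at h6
  have h7 : (2 * k : ℝ) ≤ n := by nlinarith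
  exact_mod_cast h7

/-- The constant `80` is absorbed by `exp 5`, and `k * log Δ` by the denominator of `sosDegree`. -/
lemma log_le_of_le_sosDegree (hk : 0 < k) (hn : 0 < n) (hΔ : 10 ≤ Δ) (hβ : 0 < β) {v : ℕ}
    (hv : 0 < v) (hvD : (v : ℝ) ≤ 80 * k * Real.log Δ * sosDegree 100 β k t n Δ) :
    Real.log v ≤ 5 + 100 / t * Real.log β - 100 * k / t * Real.log 2 + Real.log n
      - 2 / ((t : ℝ) - 1) * Real.log Δ := by
  have hk' : (0 : ℝ) < k := by exact_mod_cast hk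
  have hn' : (0 : ℝ) < n := by exact_mod_cast hn
  have hv' : (0 : ℝ) < v := by exact_mod_cast hv
  have hΔ0 : 0 < Δ := by linarith
  have hlog : 0 < Real.log Δ := by linarith [one_le_log hΔ]
  rw [Real.log_le_iff_le_exp hv']
  refine hvD.trans ?_
  have h1 : Real.exp (5 + 100 / t * Real.log β - 100 * k / t * Real.log 2 + Real.log n
      - 2 / ((t : ℝ) - 1) * Real.log Δ)
      = Real.exp 5 * β ^ (100 / (t : ℝ)) / 2 ^ (100 * (k : ℝ) / t) * n
        / Δ ^ (2 / ((t : ℝ) - 1)) := by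
    rw [Real.exp_sub, Real.exp_add, Real.exp_sub, Real.exp_add, Real.exp_log hn',
      Real.rpow_def_of_pos hβ, Real.rpow_def_of_pos (by norm_num : (0 : ℝ) < 2),
      Real.rpow_def_of_pos hΔ0]
    simp only [mul_comm (Real.log _)]
  have h2 : 80 * k * Real.log Δ * sosDegree 100 β k t n Δ
      = 80 * β ^ (100 / (t : ℝ)) / 2 ^ (100 * (k : ℝ) / t) * n / Δ ^ (2 / ((t : ℝ) - 1)) := by
    unfold sosDegree
    field_simp
  have h3 : (80 : ℝ) ≤ Real.exp 5 := by
    have : Real.exp 5 = Real.exp 1 ^ 5 := by rw [← Real.exp_nat_mul]; norm_num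
    rw [this]
    calc (80 : ℝ) ≤ 2.7 ^ 5 := by norm_num
      _ ≤ Real.exp 1 ^ 5 := pow_le_pow_left₀ (by norm_num) (by linarith [Real.exp_one_gt_d9]) 5
  rw [h1, h2]
  gcongr

/-- The factor `Δ ^ (-2/(t-1))` in the degree offsets `log Δ`. As `(t - 1) / t ≥ 1 / 2`, the
exponent `C = 100` leaves `25 * (k * log 2 + log (1/β))`, enough for `12 * k + 2 * log (2/β)`. -/
lemma le_logGain (hk : 0 < k) (ht : 1 < t) (hn : 0 < n) (hΔ : 10 ≤ Δ)
    (hβ : 0 < β) (hβ1 : β < 1) {v : ℕ} (hv : 0 < v)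
    (hvD : (v : ℝ) ≤ 80 * k * Real.log Δ * sosDegree 100 β k t n Δ) :
    6 * k + 2 * Real.log (2 / β) ≤ logGain k t n Δ v := by
  have hk' : (1 : ℝ) ≤ k := by exact_mod_cast hk
  have ht' : (2 : ℝ) ≤ t := by exact_mod_cast ht
  have h1 := log_le_of_le_sosDegree hk hn hΔ hβ hv hvD
  set lb := -Real.log β with hlb
  have hlb0 : 0 < lb := by rw [hlb]; linarith [Real.log_neg hβ hβ1]
  have hl2 := Real.log_two_gt_d9
  have hl2' := Real.log_two_lt_d9
  rw [Real.log_div (by norm_num) hβ.ne']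
  set s := k * Real.log 2 + lb with hs
  have hs0 : 0 ≤ s := by positivity
  have h2 : 100 / t * s + 2 / ((t : ℝ) - 1) * Real.log Δ ≤ 2 * logRatio n v := by
    have e : 100 / t * s = 100 * k / t * Real.log 2 - 100 / t * Real.log β := by
      rw [hs, hlb]
      ring
    unfold logRatio
    linarith
  have h3 : ((t : ℝ) - 1) * (100 / t * s + 2 / ((t : ℝ) - 1) * Real.log Δ)
      ≤ (t - 1) * (2 * logRatio n v) := mul_le_mul_of_nonneg_left h2 (by linarith)
  have h4 : ((t : ℝ) - 1) * (2 / ((t : ℝ) - 1) * Real.log Δ) = 2 * Real.log Δ := by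
    have : (t : ℝ) - 1 ≠ 0 := by linarith
    field_simp
  have h5 : 50 * s ≤ ((t : ℝ) - 1) * (100 / t * s) := by
    have e : ((t : ℝ) - 1) * (100 / t * s) = (100 * (t - 1) / t) * s := by ring
    rw [e]
    refine mul_le_mul_of_nonneg_right ?_ hs0
    rw [le_div_iff₀ (by linarith)]
    linarith
  rw [mul_add, h4] at h3
  unfold logGain
  have h6 : 14 * (k : ℝ) ≤ 25 * (k * Real.log 2) := by nlinarith
  rw [hs] at h5
  linarith

end Parameters

/-! ### Random instances -/

section Random

variable {n m k : ℕ} {Ω : Type*} {L : Finset (Equiv.Perm Ω)}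

instance : MeasurableSingletonClass (CSPInstance n m k L) := ⟨fun _ => trivial⟩

instance : Fintype (CSPInstance n m k L) :=
  inferInstanceAs (Fintype (Fin m → Constraint n k L))

lemma card_cspInstance :
    Fintype.card (CSPInstance n m k L) = Fintype.card (Constraint n k L) ^ m := by
  rw [show Fintype.card (CSPInstance n m k L) = Fintype.card (Fin m → Constraint n k L) from rfl,
    Fintype.card_fun, Fintype.card_fin]

lemma randomInstance_le {S : Set (CSPInstance n m k L)} {T : Finset (CSPInstance n m k L)}
    (hST : S ⊆ T) {β : ℝ}
    (hT : (T.card : ℝ) ≤ (Fintype.card (Constraint n k L) : ℝ) ^ m * β) :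
    randomInstance n m k L S ≤ ENNReal.ofReal β := by
  refine (measure_mono hST).trans ?_
  rw [randomInstance, uniformOn_univ, Measure.count_apply_finset]
  refine ENNReal.div_le_of_le_mul ?_
  rw [card_cspInstance, ← ENNReal.ofReal_natCast, ← ENNReal.ofReal_natCast,
    ← ENNReal.ofReal_mul' (Nat.cast_nonneg _)]
  refine ENNReal.ofReal_le_ofReal (hT.trans (le_of_eq ?_))
  push_cast
  ring

open Classical in
/-- In most instances most constraints are isolated. -/
lemma card_many_not_isIsolated_le {t b : ℕ} {Δ β ε : ℝ} (hk : 0 < k) (htk : t ≤ k)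
    (h : 2 * k ≤ n) (hΔ : 10 ≤ Δ) (hm : (m : ℝ) = Δ * n) (hβ : 0 < β) (hβ1 : β < 1)
    (hgain : ∀ v, 0 < v → v ≤ b → 6 * k + 2 * Real.log (2 / β) ≤ logGain k t n Δ v)
    (hε : 1 / √(n : ℝ) ≤ ε) :
    ((Finset.univ.filter fun I : Fin m → Constraint n k L =>
        ε * m ≤ (Finset.univ.filter fun f =>
          ¬ IsIsolated t (fun f => Constraint.scope (I f)) b f).card).card : ℝ)
      ≤ (Fintype.card (Constraint n k L) : ℝ) ^ m * (β / 2) := by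
  have hn : 0 < n := by omega
  have hn' : (0 : ℝ) < n := by exact_mod_cast hn
  have hm' : (0 : ℝ) < m := by rw [hm]; positivity
  have hsq : 0 < √(n : ℝ) := Real.sqrt_pos.2 hn'
  set X : ℝ := ((Fintype.card (Constraint n k L) : ℕ) : ℝ) with hX
  set bad : Finset (Fin m → Constraint n k L) := Finset.univ.filter fun I =>
    ε * m ≤ (Finset.univ.filter fun f =>
      ¬ IsIsolated t (fun f => Constraint.scope (I f)) b f).card with hbad
  -- Markov's inequality for the number of non-isolated constraints, by double counting.
  have h1 : (bad.card : ℝ) * (ε * m) ≤ m * (X ^ m * (β / 2) / √n) := by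
    calc (bad.card : ℝ) * (ε * m) = ∑ I ∈ bad, ε * m := by rw [Finset.sum_const, nsmul_eq_mul]
      _ ≤ ∑ I ∈ bad, ((Finset.univ.filter fun f =>
          ¬ IsIsolated t (fun f => Constraint.scope (I f)) b f).card : ℝ) :=
          Finset.sum_le_sum fun I hI => (Finset.mem_filter.1 hI).2
      _ ≤ ∑ I : Fin m → Constraint n k L, ((Finset.univ.filter fun f =>
          ¬ IsIsolated t (fun f => Constraint.scope (I f)) b f).card : ℝ) :=
          Finset.sum_le_sum_of_subset_of_nonneg (Finset.subset_univ _)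
            fun _ _ _ => Nat.cast_nonneg _
      _ = ∑ f : Fin m, ((Finset.univ.filter fun I : Fin m → Constraint n k L =>
          ¬ IsIsolated t (fun f => Constraint.scope (I f)) b f).card : ℝ) := by
          have := Finset.sum_card_bipartiteAbove_eq_sum_card_bipartiteBelow
            (s := (Finset.univ : Finset (Fin m → Constraint n k L)))
            (t := (Finset.univ : Finset (Fin m)))
            (fun I f => ¬ IsIsolated t (fun f => Constraint.scope (I f)) b f)
          exact_mod_cast this
      _ ≤ ∑ f : Fin m, X ^ m * (β / 2) / √n :=
          Finset.sum_le_sum fun f _ => card_not_isIsolated_le hk htk h hΔ hm hβ hβ1 hgain f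
      _ = m * (X ^ m * (β / 2) / √n) := by
          rw [Finset.sum_const, nsmul_eq_mul, Finset.card_univ, Fintype.card_fin]
  have h2 : (bad.card : ℝ) * (1 / √n * m) ≤ m * (X ^ m * (β / 2) / √n) :=
    le_trans (by gcongr) h1
  have h3 : (bad.card : ℝ) * (m / √n) ≤ (X ^ m * (β / 2)) * (m / √n) := by
    calc (bad.card : ℝ) * (m / √n) = bad.card * (1 / √n * m) := by ring
      _ ≤ _ := h2
      _ = _ := by ring
  exact le_of_mul_le_mul_right h3 (by positivity)

theorem randomInstance_sosRefutes_le {Ω : Type*} [Fintype Ω] [DecidableEq Ω] [Nonempty Ω]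
    (L : Finset (Equiv.Perm Ω)) {k t : ℕ} (ht : 1 < t) (htk : t ≤ k)
    {P : (Fin k → Ω) → Bool} (hP : ∃ x, P x = true) {n m : ℕ} (hn : 0 < n) {Δ : ℝ}
    (hΔ : 10 ≤ Δ) (hm : (m : ℝ) = Δ * n) {β : ℝ} (hβ : 0 < β) (hβ1 : β < 1) :
    randomInstance n m k L
        {I | SOSRefutes ⌊sosDegree 100 β k t n Δ⌋₊ P (deltaP P t + slack n Δ) I}
      ≤ ENNReal.ofReal β := by
  classical
  have hn' : (0 : ℝ) < n := by exact_mod_cast hn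
  have hm' : (0 : ℝ) < m := by rw [hm]; positivity
  have hm0 : 0 < m := by exact_mod_cast hm'
  set D := ⌊sosDegree 100 β k t n Δ⌋₊ with hD
  -- The formal notion of refutation does not demand `D ≥ k`; for smaller `D` nothing is refuted,
  -- since the value polynomial has degree `k`.
  rcases lt_or_ge D k with hDk | hkD
  · refine randomInstance_le (T := ∅) (fun I hI => ?_) ?_
    · exact absurd hI (not_sosRefutes_of_lt hP hm0 hDk _)
    · rw [Finset.card_empty, Nat.cast_zero]
      positivity
  have hk : 0 < k := by omega
  have hk' : (1 : ℝ) ≤ k := by exact_mod_cast hk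
  have hDle : (D : ℝ) ≤ sosDegree 100 β k t n Δ :=
    Nat.floor_le (zero_le_one.trans (Nat.floor_pos.1 (hk.trans_le hkD)))
  have hkD' : (k : ℝ) ≤ D := by exact_mod_cast hkD
  have hlog := one_le_log hΔ
  have hkn := two_mul_le_of_le_sosDegree hk ht htk hΔ hβ hβ1 (hkD'.trans hDle)
  -- With `η = 1 / (10 k log Δ)` this is the least integer satisfying `4 * D ≤ η * b`; rounding up
  -- costs at most the factor two in the `80` of `hbD`.
  set b := ⌈40 * k * Real.log Δ * D⌉₊ with hb
  have hprod : 1 ≤ (k : ℝ) * Real.log Δ * D := by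
    have : 1 ≤ (k : ℝ) * Real.log Δ := by nlinarith
    nlinarith
  have hbD : (b : ℝ) ≤ 80 * k * Real.log Δ * sosDegree 100 β k t n Δ := by
    have h1 : (b : ℝ) < 40 * k * Real.log Δ * D + 1 := Nat.ceil_lt_add_one (by positivity)
    have h2 : 80 * k * Real.log Δ * D ≤ 80 * k * Real.log Δ * sosDegree 100 β k t n Δ :=
      mul_le_mul_of_nonneg_left hDle (by positivity)
    linarith
  have hgain : ∀ v, 0 < v → v ≤ b → 6 * k + 2 * Real.log (2 / β) ≤ logGain k t n Δ v := by
    intro v hv hvb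
    exact le_logGain hk ht hn hΔ hβ hβ1 hv (le_trans (by exact_mod_cast hvb) hbD)
  set η : ℝ := 1 / (10 * k * Real.log Δ) with hη
  have hden : 10 ≤ 10 * k * Real.log Δ := by nlinarith
  have hη0 : 0 < η := by positivity
  have hη1 : η ≤ 1 := by
    rw [hη, div_le_one (by linarith)]
    linarith
  have hDb : 4 * (D : ℝ) ≤ η * b := by
    have h1 : 40 * k * Real.log Δ * D ≤ (b : ℝ) := Nat.le_ceil _
    rw [hη, one_div, inv_mul_eq_div, le_div_iff₀ (by linarith)]
    linarith
  set T₁ : Finset (Fin m → Constraint n k L) := Finset.univ.filter fun I =>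
    ¬ IsExpanding t (fun f => Constraint.scope (I f)) η b with hT₁
  set T₂ : Finset (Fin m → Constraint n k L) := Finset.univ.filter fun I =>
    slack n Δ * m ≤ (Finset.univ.filter fun f =>
      ¬ IsIsolated t (fun f => Constraint.scope (I f)) b f).card with hT₂
  have hc₁ := card_not_isExpanding_le (L := L) hk ht hkn hΔ hm hβ hβ1 hgain
  have hc₂ := card_many_not_isIsolated_le (L := L) hk htk hkn hΔ hm hβ hβ1 hgain
    (inv_sqrt_le_slack (n := n) hΔ)
  refine randomInstance_le (T := (T₁ ∪ T₂ : Finset (Fin m → Constraint n k L))) ?_ ?_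
  · intro I hI
    by_contra hcon
    have hmem : ∀ J : Fin m → Constraint n k L, J ∉ T₁ ∪ T₂ →
        IsExpanding t (fun f => Constraint.scope (J f)) η b ∧
        ((Finset.univ.filter fun f =>
          ¬ IsIsolated t (fun f => Constraint.scope (J f)) b f).card : ℝ) < slack n Δ * m := by
      intro J hJ
      rw [Finset.mem_union, not_or, hT₁, hT₂, Finset.mem_filter, Finset.mem_filter] at hJ
      simpa only [Finset.mem_univ, true_and, not_not, not_le] using hJ
    have hcon' := hmem I hcon
    refine not_sosRefutes_of_isExpanding (G := Finset.univ.filter fun f =>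
      IsIsolated t (fun f => Constraint.scope (I f)) b f) ht htk hP hm0 hcon'.1 hη0 hη1 hDb hkD
      (fun f hf => (Finset.mem_filter.1 hf).2) ?_ hI
    have hsplit := Finset.card_filter_add_card_filter_not
      (s := (Finset.univ : Finset (Fin m)))
      (fun f => IsIsolated t (fun f => Constraint.scope (I f)) b f)
    rw [Finset.card_univ, Fintype.card_fin] at hsplit
    have hsplit' : (((Finset.univ.filter fun f =>
        IsIsolated t (fun f => Constraint.scope (I f)) b f).card : ℕ) : ℝ)
        + ((Finset.univ.filter fun f =>
        ¬ IsIsolated t (fun f => Constraint.scope (I f)) b f).card : ℕ) = m := by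
      exact_mod_cast hsplit
    have := hcon'.2
    linarith
  · have h1 : ((T₁ ∪ T₂).card : ℝ) ≤ T₁.card + T₂.card := by
      exact_mod_cast Finset.card_union_le T₁ T₂
    refine h1.trans ?_
    linarith

end Random

/-! ### Asymptotics of the slack -/

section Asymptotics

lemma slack_le {n : ℕ} {Δ c : ℝ} (h : Real.log n / (2 * Real.log Δ) ≤ c) :
    slack n Δ ≤ 2 ^ c * (1 / √(n : ℝ)) := by
  unfold slack
  rw [mul_one_div]
  exact div_le_div_of_nonneg_right (Real.rpow_le_rpow_of_exponent_le (by norm_num) h)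
    (Real.sqrt_nonneg _)

lemma slack_nonneg (n : ℕ) (Δ : ℝ) : 0 ≤ slack n Δ := by
  unfold slack
  positivity

lemma tendsto_slack {Δ : ℕ → ℝ} (hΔ : ∀ᶠ n in atTop, 10 ≤ Δ n) :
    Tendsto (fun n => slack n (Δ n)) atTop (𝓝 0) := by
  have hlim : Tendsto (fun n : ℕ => (n : ℝ) ^ (-(1 / 4) : ℝ)) atTop (𝓝 0) :=
    (tendsto_rpow_neg_atTop (by norm_num)).comp tendsto_natCast_atTop_atTop
  refine tendsto_of_tendsto_of_tendsto_of_le_of_le' tendsto_const_nhds hlim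
    (Eventually.of_forall fun n => slack_nonneg n _) ?_
  filter_upwards [hΔ, eventually_gt_atTop 0] with n hn hn0
  have hn' : (0 : ℝ) < n := by exact_mod_cast hn0
  have hlogn : 0 ≤ Real.log n := Real.log_natCast_nonneg n
  -- Since `exp 2 ≤ 10`, the numerator of the slack is at most `2 ^ (log n / 4) ≤ n ^ (1/4)`, which
  -- leaves `n ^ (-1/4)`.
  have hlog : 2 ≤ Real.log (Δ n) := by
    rw [Real.le_log_iff_exp_le (by linarith)]
    have : Real.exp 2 = Real.exp 1 ^ 2 := by rw [← Real.exp_nat_mul]; norm_num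
    rw [this]
    nlinarith [Real.exp_one_lt_d9, Real.exp_pos 1]
  have h1 : Real.log n / (2 * Real.log (Δ n)) ≤ Real.log n / 4 :=
    div_le_div_of_nonneg_left hlogn (by norm_num) (by linarith)
  refine (slack_le h1).trans ?_
  rw [Real.sqrt_eq_rpow, one_div, ← Real.rpow_neg hn'.le,
    Real.rpow_def_of_pos (by norm_num : (0 : ℝ) < 2), Real.rpow_def_of_pos hn',
    Real.rpow_def_of_pos hn', ← Real.exp_add]
  refine Real.exp_le_exp.2 ?_
  have h2 := Real.log_two_lt_d9
  nlinarith

lemma slack_isBigO {Δ : ℕ → ℝ} (hΔ : ∃ c : ℝ, 0 < c ∧ ∀ᶠ n : ℕ in atTop, (n : ℝ) ^ c ≤ Δ n) :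
    (fun n => slack n (Δ n)) =O[atTop] fun n : ℕ => 1 / √(n : ℝ) := by
  obtain ⟨c, hc, hΔ⟩ := hΔ
  refine IsBigO.of_bound (2 ^ (1 / (2 * c))) ?_
  filter_upwards [hΔ, eventually_gt_atTop 1] with n hn hn1
  have hn' : (1 : ℝ) < n := by exact_mod_cast hn1
  have hlogn : 0 < Real.log n := Real.log_pos hn'
  have hlog : c * Real.log n ≤ Real.log (Δ n) := by
    rw [← Real.log_rpow (by linarith)]
    exact Real.log_le_log (Real.rpow_pos_of_pos (by linarith) c) hn
  rw [Real.norm_of_nonneg (slack_nonneg _ _), Real.norm_of_nonneg (by positivity)]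
  refine slack_le ?_
  have hpos : 0 < c * Real.log n := mul_pos hc hlogn
  rw [div_le_div_iff₀ (by linarith) (by linarith)]
  linarith

end Asymptotics

end RandomCSP

end

theorem theorem8p2 :
    (∃ C : ℝ, 0 < C ∧
      ∀ (Ω : Type) [Fintype Ω] [DecidableEq Ω] (_ : 2 ≤ Fintype.card Ω)
        (L : Finset (Equiv.Perm Ω)) (_ : L.Nonempty)
        (k t : ℕ) (_ : 1 < t) (_ : t ≤ k)
        (P : (Fin k → Ω) → Bool) (_ : ∃ x, P x = true)
        (n m : ℕ) (_ : 0 < n) (Δ : ℝ) (_ : 10 ≤ Δ) (_ : (m : ℝ) = Δ * n)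
        (β : ℝ) (_ : 0 < β) (_ : β < 1),
        RandomCSP.randomInstance n m k L
            {I | RandomCSP.SOSRefutes ⌊RandomCSP.sosDegree C β k t n Δ⌋₊ P
              (RandomCSP.deltaP P t + RandomCSP.slack n Δ) I}
          ≤ ENNReal.ofReal β) ∧
    (∀ Δ : ℕ → ℝ, (∀ᶠ n in atTop, 10 ≤ Δ n) →
      Tendsto (fun n => RandomCSP.slack n (Δ n)) atTop (𝓝 0)) ∧
    (∀ Δ : ℕ → ℝ, (∃ c : ℝ, 0 < c ∧ ∀ᶠ n : ℕ in atTop, (n : ℝ) ^ c ≤ Δ n) →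
      (fun n => RandomCSP.slack n (Δ n)) =O[atTop] fun n : ℕ => 1 / √(n : ℝ)) := by
  refine ⟨⟨100, by norm_num, ?_⟩, fun Δ hΔ => RandomCSP.tendsto_slack hΔ,
    fun Δ hΔ => RandomCSP.slack_isBigO hΔ⟩
  intro Ω _ _ hΩ L _ k t ht htk P hP n m hn Δ hΔ hm β hβ hβ1
  have : Nonempty Ω := Fintype.card_pos_iff.1 (by omega)
  exact RandomCSP.randomInstance_sosRefutes_le L ht htk hP hn hΔ hm hβ hβ1
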